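/- There is an absolute constant $C$ such that, for all real numbers $Q, T \ge 3$ and all real $c$ with $0 \le c \le 1/100$, $$\sum_{1 \le q \le Q}\ \sum_{\chi \,(\mathrm{mod}\ q)} \int_0^T \left|L\left(\tfrac12 + c + it, \chi\right)\right|^8 dt \ \le\ C\, Q^2 T^2 (\log (QT))^{16}.$$ Here $q$ runs over the positive integers up to $Q$, the inner sum is over all Dirichlet characters $\chi$ modulo $q$ (primitive or not, the principal one included), and $L(s,\chi)$ denotes the analytically continued Dirichlet $L$-function of $\chi$. -/

import Mathlib

/-! Take first a primitive character χ with modulus in [Q, 2Q) and t with 1 + t in [T, 2T]. The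
analytic conductor of L(s, χ)^4 is about (QT)^4, so an approximate functional equation should
express it through two Dirichlet polynomials with coefficients d_4(n)χ(n) and their conjugates, both
of length X = (QT)^2. Squaring turns the eighth moment into mean squares of such polynomials.
`hybrid_large_sieve` bounds these by (Q^2 T + X) Σ d_4(n)^2 n^(-2σ). Rankin's trick with d_4^2 ≤
d_16 then gives 16 powers of the logarithm, and the length X is what produces Q^2 T^2.

Both sums are cut sharply at X, and the remainder is bounded only in mean square. Normalized to be
holomorphic and of controlled size (`normalizedRemainder`), it is easy on two lines. On Re s = 3/2
it consists of the tail of the series of L^4 and the dual polynomial, and the sieve gives X^(-1)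
log^16. On Re s = -1/2 the functional equation exchanges the two roles and the sieve gives X^3
log^16. A three lines theorem for mean squares, `meanSquare_three_lines`, interpolates to X^(2 - 2σ)
log^16, which is at most X log^16 once σ ≥ 1/2. The exponential growth lemmas only license this
convexity argument. Stirling's formula is avoided: on the lines -1/2, 1/2 and 3/2 complex
conjugation and the recurrence of Γ give the modulus of the archimedean factor exactly.

The blocks are summed dyadically in the modulus and in t (`sum_integral_primitive_LFunction_le`);
both sums are geometric, so no logarithm is lost. A character of modulus N = md induced from a
primitive one of modulus d loses at most the factor 2^ω(m) ≤ d_2(m) in its L-function. The primitive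
bound with moduli up to Q/m saves m^2, and Σ d_2(m)^8 / m^2 converges. -/

section LargeSieve

/-! ### Additive and multiplicative large sieve inequalities. -/

open MeasureTheory Set

/-- A Sobolev-type inequality bounding a point value by an average over an interval. -/
theorem sq_norm_le_integral_of_hasDerivAt {f f' : ℝ → ℂ} (hf : ∀ x, HasDerivAt f (f' x) x)
    (hf' : Continuous f') {α δ M : ℝ} (hδ : 0 < δ) (hM : 0 < M) :
    ‖f α‖ ^ 2 ≤ ∫ x in α..α + δ, ((δ⁻¹ + M) * ‖f x‖ ^ 2 + M⁻¹ * ‖f' x‖ ^ 2) := by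
  have hfc : Continuous f := continuous_iff_continuousAt.2 fun x ↦ (hf x).continuousAt
  set g : ℝ → ℝ := fun x ↦ M * ‖f x‖ ^ 2 + M⁻¹ * ‖f' x‖ ^ 2 with hg
  have hgc : Continuous g := by fun_prop
  have hg0 : ∀ x, 0 ≤ g x := fun x ↦ by positivity
  have key : ∀ x ∈ Icc α (α + δ), ‖f α‖ ^ 2 - (∫ y in α..α + δ, g y) ≤ ‖f x‖ ^ 2 := by
    intro x hx
    have h1 : ∫ y in α..x, 2 * f y * f' y = f x ^ 2 - f α ^ 2 := by
      apply intervalIntegral.integral_eq_sub_of_hasDerivAt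
      · intro y _
        simpa using (hf y).fun_pow 2
      · exact (by fun_prop : Continuous fun y ↦ 2 * f y * f' y).intervalIntegrable _ _
    have h2 : ‖∫ y in α..x, 2 * f y * f' y‖ ≤ ∫ y in α..x, g y := by
      apply intervalIntegral.norm_integral_le_of_norm_le hx.1 _ (hgc.intervalIntegrable _ _)
      filter_upwards with y _
      rw [norm_mul, norm_mul, Complex.norm_ofNat, hg]
      -- Weighted AM-GM: the free weight M is later matched to the size of the frequencies.
      have : 0 ≤ (M * ‖f y‖ - ‖f' y‖) ^ 2 * M⁻¹ := by positivity
      have e : (M * ‖f y‖ - ‖f' y‖) ^ 2 * M⁻¹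
          = M * ‖f y‖ ^ 2 + M⁻¹ * ‖f' y‖ ^ 2 - 2 * ‖f y‖ * ‖f' y‖ := by
        field_simp
        ring
      linarith
    have h3 : ∫ y in α..x, g y ≤ ∫ y in α..α + δ, g y := by
      apply intervalIntegral.integral_mono_interval le_rfl hx.1 hx.2
      · filter_upwards with y using hg0 y
      · exact hgc.intervalIntegrable _ _
    have h4 : ‖f α‖ ^ 2 ≤ ‖f x‖ ^ 2 + ‖f x ^ 2 - f α ^ 2‖ := by
      rw [← norm_pow, ← norm_pow]
      have := norm_sub_norm_le (f α ^ 2) (f x ^ 2)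
      rw [norm_sub_rev] at this
      linarith
    rw [h1] at h2
    linarith
  -- Averaging over x in the interval of length δ replaces the unknown point value at x by a mean.
  have h5 : ∫ x in α..α + δ, (‖f α‖ ^ 2 - (∫ y in α..α + δ, g y)) ≤
      ∫ x in α..α + δ, ‖f x‖ ^ 2 := by
    apply intervalIntegral.integral_mono_on (by linarith) (by simp)
      ((by fun_prop : Continuous fun x ↦ ‖f x‖ ^ 2).intervalIntegrable _ _) key
  rw [intervalIntegral.integral_const, smul_eq_mul, add_sub_cancel_left] at h5
  have h6 : ∫ x in α..α + δ, ((δ⁻¹ + M) * ‖f x‖ ^ 2 + M⁻¹ * ‖f' x‖ ^ 2)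
      = δ⁻¹ * (∫ x in α..α + δ, ‖f x‖ ^ 2) + ∫ x in α..α + δ, g x := by
    rw [← intervalIntegral.integral_const_mul, ← intervalIntegral.integral_add]
    · congr 1; ext x; simp only [hg]; ring
    · exact (by fun_prop : Continuous fun x ↦ δ⁻¹ * ‖f x‖ ^ 2).intervalIntegrable _ _
    · exact hgc.intervalIntegrable _ _
  rw [h6]
  have h7 := mul_le_mul_of_nonneg_left h5 (inv_pos.2 hδ).le
  rw [← mul_assoc, inv_mul_cancel₀ hδ.ne', one_mul] at h7
  linarith

/-- The additive character `x ↦ e^{2πix}`. -/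
noncomputable def expTwoPi (x : ℝ) : ℂ := Complex.exp (2 * Real.pi * Complex.I * x)

theorem norm_expTwoPi (x : ℝ) : ‖expTwoPi x‖ = 1 := by
  rw [expTwoPi, show (2 * Real.pi * Complex.I * x : ℂ) = ((2 * Real.pi * x : ℝ) : ℂ) * Complex.I by
    push_cast; ring, Complex.norm_exp_ofReal_mul_I]

theorem expTwoPi_add (x y : ℝ) : expTwoPi (x + y) = expTwoPi x * expTwoPi y := by
  rw [expTwoPi, expTwoPi, expTwoPi, ← Complex.exp_add]; push_cast; ring_nf

theorem expTwoPi_neg (x : ℝ) : expTwoPi (-x) = starRingEnd ℂ (expTwoPi x) := by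
  rw [expTwoPi, expTwoPi, ← Complex.exp_conj]; simp [Complex.conj_ofNat]

@[fun_prop]
theorem continuous_expTwoPi : Continuous expTwoPi := by unfold expTwoPi; fun_prop

theorem hasDerivAt_expTwoPi_mul (c x : ℝ) :
    HasDerivAt (fun x ↦ expTwoPi (c * x)) (2 * Real.pi * Complex.I * c * expTwoPi (c * x)) x := by
  unfold expTwoPi
  have h : HasDerivAt (fun x : ℝ ↦ (2 * Real.pi * Complex.I * ((c * x : ℝ) : ℂ)))
      (2 * Real.pi * Complex.I * c) x := by
    have h0 : HasDerivAt (fun x : ℝ ↦ (c * x : ℝ)) c x := by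
      simpa using (hasDerivAt_id x).const_mul c
    simpa using h0.ofReal_comp.const_mul (2 * Real.pi * Complex.I)
  convert h.cexp using 1
  ring

theorem integral_expTwoPi_int_mul (n : ℤ) :
    ∫ x in (0 : ℝ)..2, expTwoPi (n * x) = if n = 0 then 2 else 0 := by
  split_ifs with h
  · subst h
    simp [expTwoPi]
  · have hc : (2 * Real.pi * Complex.I * (n : ℂ)) ≠ 0 := by
      have := Real.pi_ne_zero
      simp [h, this]
    have : ∀ x : ℝ, expTwoPi (n * x) = Complex.exp (2 * Real.pi * Complex.I * n * x) := by
      intro x; rw [expTwoPi]; push_cast; ring_nf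
    simp_rw [this]
    rw [integral_exp_mul_complex hc]
    have h2 : Complex.exp (2 * Real.pi * Complex.I * n * (2 : ℝ)) = 1 := by
      rw [Complex.exp_eq_one_iff]; exact ⟨2 * n, by push_cast; ring⟩
    rw [h2]; simp

theorem sq_norm_sum_mul_expTwoPi {ι : Type*} (s : Finset ι) (b : ι → ℂ) (l : ι → ℝ) (x : ℝ) :
    ((‖∑ n ∈ s, b n * expTwoPi (l n * x)‖ ^ 2 : ℝ) : ℂ)
      = ∑ m ∈ s, ∑ n ∈ s, b m * starRingEnd ℂ (b n) * expTwoPi ((l m - l n) * x) := by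
  push_cast
  rw [← Complex.mul_conj', map_sum, Finset.sum_mul_sum]
  refine Finset.sum_congr rfl fun m _ ↦ Finset.sum_congr rfl fun n _ ↦ ?_
  rw [map_mul, ← expTwoPi_neg, sub_mul, sub_eq_add_neg, expTwoPi_add]
  ring

/-- Parseval over two periods: the intervals [x, x + δ] with x < 1 and δ ≤ 1 lie in [0, 2], so
nothing has to be reduced modulo 1 later. -/
theorem integral_sq_norm_trigPoly (s : Finset ℕ) (b : ℕ → ℂ) :
    ∫ x in (0 : ℝ)..2, ‖∑ n ∈ s, b n * expTwoPi (n * x)‖ ^ 2 = 2 * ∑ n ∈ s, ‖b n‖ ^ 2 := by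
  apply Complex.ofReal_injective
  rw [← intervalIntegral.integral_ofReal]
  simp_rw [sq_norm_sum_mul_expTwoPi s b (fun n ↦ (n : ℝ))]
  rw [intervalIntegral.integral_finsetSum]
  swap
  · intro m _
    exact Continuous.intervalIntegrable (by fun_prop) _ _
  have : ∀ m ∈ s, ∫ x in (0 : ℝ)..2, ∑ n ∈ s, b m * starRingEnd ℂ (b n) *
      expTwoPi (((m : ℝ) - n) * x) = 2 * (‖b m‖ ^ 2 : ℝ) := by
    intro m hm
    rw [intervalIntegral.integral_finsetSum]
    swap
    · intro n _
      exact Continuous.intervalIntegrable (by fun_prop) _ _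
    have h : ∀ n ∈ s, ∫ x in (0 : ℝ)..2, b m * starRingEnd ℂ (b n) *
        expTwoPi (((m : ℝ) - n) * x) = if n = m then 2 * b m * starRingEnd ℂ (b n) else 0 := by
      intro n _
      rw [intervalIntegral.integral_const_mul]
      have := integral_expTwoPi_int_mul ((m : ℤ) - n)
      push_cast at this
      rw [this]
      by_cases hmn : n = m
      · subst hmn; simp; ring
      · rw [if_neg (by omega), if_neg hmn, mul_zero]
    rw [Finset.sum_congr rfl h, Finset.sum_ite_eq' s m, if_pos hm, mul_assoc, Complex.mul_conj']
    push_cast; rfl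
  rw [Finset.sum_congr rfl this]
  push_cast
  rw [Finset.mul_sum]

/-- The additive large sieve inequality for `δ`-separated points of `[0, 1)`. -/
theorem additive_large_sieve {ι : Type*} (P : Finset ι) (x : ι → ℝ) {δ M A : ℝ} (hδ : 0 < δ)
    (hδ1 : δ ≤ 1) (hM : 0 < M) (hx : ∀ i ∈ P, x i ∈ Ico (0 : ℝ) 1)
    (hsep : ∀ i ∈ P, ∀ j ∈ P, i ≠ j → δ ≤ |x i - x j|)
    (s : Finset ℕ) (hs : ∀ n ∈ s, |(n : ℝ) - A| ≤ M) (b : ℕ → ℂ) :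
    ∑ i ∈ P, ‖∑ n ∈ s, b n * expTwoPi (n * x i)‖ ^ 2
      ≤ 2 * (δ⁻¹ + 41 * M) * ∑ n ∈ s, ‖b n‖ ^ 2 := by
  -- The twist by e(-Ax) keeps every modulus and centres the frequencies, so a derivative costs only
  -- 2πM rather than 2π max n.
  set f : ℝ → ℂ := fun x ↦ ∑ n ∈ s, b n * expTwoPi ((n - A) * x) with hf
  set f' : ℝ → ℂ := fun x ↦ ∑ n ∈ s, b n * (2 * Real.pi * Complex.I * ((n - A : ℝ) : ℂ) *
    expTwoPi ((n - A) * x)) with hf'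
  have hder : ∀ x, HasDerivAt f (f' x) x := by
    intro x
    apply HasDerivAt.fun_sum
    intro n _
    exact (hasDerivAt_expTwoPi_mul _ _).const_mul _
  have hfc : Continuous f := by fun_prop
  have hfc' : Continuous f' := by fun_prop
  have e1 : ∀ x, ‖f x‖ = ‖∑ n ∈ s, b n * expTwoPi (n * x)‖ := by
    intro x
    have : f x = expTwoPi (-A * x) * ∑ n ∈ s, b n * expTwoPi (n * x) := by
      rw [hf, Finset.mul_sum]
      refine Finset.sum_congr rfl fun n _ ↦ ?_
      rw [show ((n : ℝ) - A) * x = -A * x + n * x by ring, expTwoPi_add]; ring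
    rw [this, norm_mul, norm_expTwoPi, one_mul]
  have e2 : ∀ x, ‖f' x‖ = ‖∑ n ∈ s, (b n * (2 * Real.pi * Complex.I * ((n - A : ℝ) : ℂ))) *
      expTwoPi (n * x)‖ := by
    intro x
    have : f' x = expTwoPi (-A * x) * ∑ n ∈ s, (b n * (2 * Real.pi * Complex.I *
        ((n - A : ℝ) : ℂ))) * expTwoPi (n * x) := by
      rw [hf', Finset.mul_sum]
      refine Finset.sum_congr rfl fun n _ ↦ ?_
      rw [show ((n : ℝ) - A) * x = -A * x + n * x by ring, expTwoPi_add]; ring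
    rw [this, norm_mul, norm_expTwoPi, one_mul]
  set G : ℝ → ℝ := fun x ↦ (δ⁻¹ + M) * ‖f x‖ ^ 2 + M⁻¹ * ‖f' x‖ ^ 2 with hG
  have hGc : Continuous G := by fun_prop
  have hG0 : ∀ x, 0 ≤ G x := fun x ↦ by positivity
  have h1 : ∀ i ∈ P, ‖∑ n ∈ s, b n * expTwoPi (n * x i)‖ ^ 2 ≤
      ∫ y in Ioc (x i) (x i + δ), G y := by
    intro i _
    rw [← e1, ← intervalIntegral.integral_of_le (by linarith)]
    exact sq_norm_le_integral_of_hasDerivAt hder hfc' hδ hM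
  have hint : ∀ a b : ℝ, IntegrableOn G (Ioc a b) := fun a b ↦
    (hGc.integrableOn_Icc).mono_set Ioc_subset_Icc_self
  have h2 : ∑ i ∈ P, ∫ y in Ioc (x i) (x i + δ), G y = ∫ y in ⋃ i ∈ P, Ioc (x i) (x i + δ), G y := by
    rw [integral_biUnion_finset]
    · intro i _; exact measurableSet_Ioc
    · intro i hi j hj hij
      rw [Function.onFun, Set.disjoint_left]
      intro y hy1 hy2
      have := hsep i hi j hj hij
      rcases le_abs.1 this with h | h
      · linarith [hy1.1, hy2.2]
      · linarith [hy1.2, hy2.1]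
    · intro i _; exact hint _ _
  have h3 : ∫ y in ⋃ i ∈ P, Ioc (x i) (x i + δ), G y ≤ ∫ y in Ioc 0 2, G y := by
    apply setIntegral_mono_set (hint _ _)
    · filter_upwards with y using hG0 y
    · apply LE.le.eventuallyLE
      refine iUnion₂_subset fun i hi ↦ Ioc_subset_Ioc (hx i hi).1 ?_
      linarith [(hx i hi).2]
  have h4 : ∫ y in Ioc 0 2, G y = (δ⁻¹ + M) * (2 * ∑ n ∈ s, ‖b n‖ ^ 2) + M⁻¹ *
      (2 * ∑ n ∈ s, ‖b n * (2 * Real.pi * Complex.I * ((n - A : ℝ) : ℂ))‖ ^ 2) := by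
    rw [← intervalIntegral.integral_of_le (by norm_num), ← integral_sq_norm_trigPoly,
      ← integral_sq_norm_trigPoly, ← intervalIntegral.integral_const_mul,
      ← intervalIntegral.integral_const_mul, ← intervalIntegral.integral_add]
    · simp only [hG, e1, e2]
    · exact Continuous.intervalIntegrable (by fun_prop) _ _
    · exact Continuous.intervalIntegrable (by fun_prop) _ _
  have h5 : ∑ n ∈ s, ‖b n * (2 * Real.pi * Complex.I * ((n - A : ℝ) : ℂ))‖ ^ 2
      ≤ 40 * M ^ 2 * ∑ n ∈ s, ‖b n‖ ^ 2 := by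
    rw [Finset.mul_sum]
    refine Finset.sum_le_sum fun n hn ↦ ?_
    have hpi : ‖(2 * Real.pi * Complex.I * ((n - A : ℝ) : ℂ))‖ = 2 * Real.pi * |(n : ℝ) - A| := by
      rw [norm_mul, norm_mul, norm_mul, Complex.norm_I, Complex.norm_real, Complex.norm_real,
        Complex.norm_ofNat, Real.norm_of_nonneg Real.pi_pos.le, Real.norm_eq_abs]
      ring
    rw [norm_mul, hpi, mul_pow, mul_comm]
    apply mul_le_mul_of_nonneg_right _ (by positivity)
    -- Source of 41 = 1 + 40: the derivative contributes (2π)^2 ≤ 40, the function itself 1.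
    have hp : Real.pi ^ 2 ≤ 10 := by nlinarith [Real.pi_lt_d2, Real.pi_pos]
    have hq : |(n : ℝ) - A| ^ 2 ≤ M ^ 2 := by
      have := hs n hn
      gcongr
    calc (2 * Real.pi * |(n : ℝ) - A|) ^ 2 = 4 * Real.pi ^ 2 * |(n : ℝ) - A| ^ 2 := by ring
      _ ≤ 4 * 10 * M ^ 2 := by gcongr
      _ = 40 * M ^ 2 := by ring
  calc ∑ i ∈ P, ‖∑ n ∈ s, b n * expTwoPi (n * x i)‖ ^ 2
      ≤ ∫ y in Ioc 0 2, G y := (Finset.sum_le_sum h1).trans (h2.trans_le h3)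
    _ ≤ (δ⁻¹ + M) * (2 * ∑ n ∈ s, ‖b n‖ ^ 2) + M⁻¹ *
      (2 * (40 * M ^ 2 * ∑ n ∈ s, ‖b n‖ ^ 2)) := by rw [h4]; gcongr
    _ = _ := by field_simp; ring

open ZMod DirichletCharacter

/-- The discrete Fourier transform of a primitive χ is a multiple of χ⁻¹ by its Gauss sum; applying
the transform twice multiplies by N and reflects. The identity is read off at -1. -/
theorem norm_gaussSum_stdAddChar_sq {N : ℕ} [NeZero N] {χ : DirichletCharacter ℂ N}
    (hχ : χ.IsPrimitive) : ‖gaussSum χ (stdAddChar (N := N))‖ ^ 2 = N := by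
  have h1 := congrFun (dft_dft (χ : ZMod N → ℂ)) (-1)
  have h2 : (ZMod.dft (ZMod.dft (χ : ZMod N → ℂ))) (-1)
      = gaussSum χ (stdAddChar (N := N)) * starRingEnd ℂ (gaussSum χ (stdAddChar (N := N))) := by
    rw [dft_apply, ← Equiv.sum_comp (Equiv.neg (ZMod N))]
    conv_rhs => rw [mul_comm, gaussSum, map_sum, Finset.sum_mul]
    refine Finset.sum_congr rfl fun j _ ↦ ?_
    rw [hχ.fourierTransform_eq_inv_mul_gaussSum, Equiv.neg_apply, neg_neg, map_mul,
      ← MulChar.star_apply', RCLike.star_def, smul_eq_mul, ← AddChar.map_neg_eq_conj]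
    rw [show gaussSum χ (stdAddChar (N := N)) = ∑ x, χ x * stdAddChar x from rfl]
    ring_nf
  rw [h2] at h1
  simp only [neg_neg, map_one, smul_eq_mul, mul_one] at h1
  rw [Complex.mul_conj'] at h1
  exact_mod_cast h1

open Classical in
/-- The primitive characters of level `N`. -/
noncomputable def primitiveCharacters (N : ℕ) : Finset (DirichletCharacter ℂ N) :=
  {χ | χ.IsPrimitive}

theorem mem_primitiveCharacters {N : ℕ} {χ : DirichletCharacter ℂ N} :
    χ ∈ primitiveCharacters N ↔ χ.IsPrimitive := by
  simp [primitiveCharacters]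

/-- Plancherel on the unit group, from orthogonality of characters. -/
theorem sum_sq_norm_sum_units {N : ℕ} [NeZero N] (g : (ZMod N)ˣ → ℂ) :
    ∑ χ : DirichletCharacter ℂ N, ‖∑ u : (ZMod N)ˣ, χ u * g u‖ ^ 2
      = N.totient * ∑ u, ‖g u‖ ^ 2 := by
  apply Complex.ofReal_injective
  push_cast
  have h : ∀ χ : DirichletCharacter ℂ N, ((‖∑ u : (ZMod N)ˣ, χ u * g u‖ : ℝ) : ℂ) ^ 2
      = ∑ u : (ZMod N)ˣ, ∑ v : (ZMod N)ˣ, (χ (v : ZMod N)⁻¹ * χ u) * (g u * starRingEnd ℂ (g v)) := by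
    intro χ
    rw [← Complex.mul_conj', map_sum, Finset.sum_mul_sum]
    refine Finset.sum_congr rfl fun u _ ↦ Finset.sum_congr rfl fun v _ ↦ ?_
    rw [map_mul, ← RCLike.star_def, MulChar.star_apply', MulChar.inv_apply,
      ZMod.inv_coe_unit, Ring.inverse_unit]
    ring
  simp_rw [h]
  rw [Finset.sum_comm, Finset.mul_sum]
  refine Finset.sum_congr rfl fun u _ ↦ ?_
  rw [Finset.sum_comm]
  have : ∀ v : (ZMod N)ˣ, ∑ χ : DirichletCharacter ℂ N,
      (χ (v : ZMod N)⁻¹ * χ u) * (g u * starRingEnd ℂ (g v))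
      = if v = u then (N.totient : ℂ) * (g u * starRingEnd ℂ (g v)) else 0 := by
    intro v
    rw [← Finset.sum_mul, sum_char_inv_mul_char_eq ℂ v.isUnit]
    simp only [Units.val_inj, ite_mul, zero_mul]
  simp_rw [this]
  rw [Finset.sum_ite_eq' _ u, if_pos (Finset.mem_univ _), Complex.mul_conj']

/-- The sum over primitive characters is dominated by the additive sum over reduced fractions. -/
theorem sum_primitive_sq_norm_le {N : ℕ} [NeZero N] (s : Finset ℕ) (a : ℕ → ℂ) :
    ∑ χ ∈ primitiveCharacters N, ‖∑ n ∈ s, a n * χ n‖ ^ 2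
      ≤ ∑ u : (ZMod N)ˣ, ‖∑ n ∈ s, a n * stdAddChar ((u : ZMod N) * (n : ZMod N))‖ ^ 2 := by
  classical
  have hN : (0 : ℝ) < N := by exact_mod_cast NeZero.pos N
  set g : (ZMod N)ˣ → ℂ := fun u ↦ ∑ n ∈ s, starRingEnd ℂ (a n) *
    stdAddChar ((u : ZMod N) * (n : ZMod N)) with hg
  -- Primitivity makes the Gauss sum of χ twisted by n equal to χ⁻¹(n) times the untwisted one for
  -- every n, coprime to N or not; the squared modulus N of the Gauss sum appears on the left.
  have h1 : ∀ χ ∈ primitiveCharacters N,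
      (N : ℝ) * ‖∑ n ∈ s, a n * χ n‖ ^ 2 = ‖∑ u : (ZMod N)ˣ, χ u * g u‖ ^ 2 := by
    intro χ hχ
    rw [mem_primitiveCharacters] at hχ
    have e1 : ‖∑ n ∈ s, a n * χ n‖ = ‖∑ n ∈ s, starRingEnd ℂ (a n) * χ⁻¹ n‖ := by
      rw [← Complex.norm_conj, map_sum]
      simp_rw [map_mul, ← RCLike.star_def, MulChar.star_apply']
    rw [e1, ← norm_gaussSum_stdAddChar_sq hχ, ← mul_pow, ← norm_mul]
    congr 2
    rw [Finset.mul_sum]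
    have e2 : ∀ n ∈ s, gaussSum χ (stdAddChar (N := N)) * (starRingEnd ℂ (a n) * χ⁻¹ n)
        = ∑ u : (ZMod N)ˣ, χ u * (starRingEnd ℂ (a n) *
          stdAddChar ((u : ZMod N) * (n : ZMod N))) := by
      intro n _
      rw [mul_left_comm, mul_comm (gaussSum _ _), ← gaussSum_mulShift_of_isPrimitive _ hχ,
        gaussSum, Finset.mul_sum]
      symm
      apply Finset.sum_of_injOn (fun u : (ZMod N)ˣ ↦ (u : ZMod N))
      · exact Units.val_injective.injOn
      · intro _ _; simp
      · intro x _ hx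
        rw [MulChar.map_nonunit χ (fun h ↦ hx ⟨h.unit, by simp⟩)]
        simp
      · intro u _
        rw [AddChar.mulShift_apply, mul_comm (n : ZMod N)]
        ring
    rw [Finset.sum_congr rfl e2, Finset.sum_comm]
    simp_rw [hg, Finset.mul_sum]
  -- By positivity the sum may be extended to all characters, where Plancherel applies.
  have h2 : (N : ℝ) * ∑ χ ∈ primitiveCharacters N, ‖∑ n ∈ s, a n * χ n‖ ^ 2
      ≤ N.totient * ∑ u, ‖g u‖ ^ 2 := by
    rw [Finset.mul_sum, Finset.sum_congr rfl h1, ← sum_sq_norm_sum_units]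
    exact Finset.sum_le_sum_of_subset_of_nonneg (Finset.subset_univ _) fun _ _ _ ↦ by positivity
  have h3 : ∑ u, ‖g u‖ ^ 2 =
      ∑ u : (ZMod N)ˣ, ‖∑ n ∈ s, a n * stdAddChar ((u : ZMod N) * (n : ZMod N))‖ ^ 2 := by
    rw [← Equiv.sum_comp (Equiv.neg (ZMod N)ˣ)]
    refine Finset.sum_congr rfl fun u _ ↦ ?_
    congr 1
    rw [← Complex.norm_conj, hg, map_sum]
    simp [← AddChar.map_neg_eq_conj]
  have h4 : (N.totient : ℝ) ≤ N := by exact_mod_cast Nat.totient_le N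
  rw [h3] at h2
  refine le_of_mul_le_mul_left (h2.trans ?_) hN
  gcongr

/-- The primitive Dirichlet characters of level at most `K`. -/
noncomputable def primitiveCharactersUpTo (K : ℕ) : Finset (Σ k : ℕ, DirichletCharacter ℂ (k + 1)) :=
  (Finset.range K).sigma fun k ↦ primitiveCharacters (k + 1)

theorem stdAddChar_natCast_mul {N : ℕ} [NeZero N] (u : ZMod N) (n : ℕ) :
    stdAddChar (u * (n : ZMod N)) = expTwoPi (n * ((u.val : ℝ) / N)) := by
  have : u * (n : ZMod N) = ((u.val * n : ℤ) : ZMod N) := by simp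
  rw [this, stdAddChar_coe, expTwoPi]
  push_cast
  ring_nf

/-- The multiplicative large sieve inequality. -/
theorem multiplicative_large_sieve (K : ℕ) (s : Finset ℕ) {A M : ℝ} (hM : 0 < M)
    (hs : ∀ n ∈ s, |(n : ℝ) - A| ≤ M) (a : ℕ → ℂ) :
    ∑ p ∈ primitiveCharactersUpTo K, ‖∑ n ∈ s, a n * p.2 n‖ ^ 2
      ≤ 2 * ((K : ℝ) ^ 2 + 41 * M) * ∑ n ∈ s, ‖a n‖ ^ 2 := by
  rcases Nat.eq_zero_or_pos K with rfl | hK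
  · simp [primitiveCharactersUpTo]
    positivity
  have hK' : (1 : ℝ) ≤ K := by exact_mod_cast hK
  set P : Finset (Σ k : ℕ, (ZMod (k + 1))ˣ) := (Finset.range K).sigma fun k ↦ Finset.univ with hP
  have h1 : ∑ p ∈ primitiveCharactersUpTo K, ‖∑ n ∈ s, a n * p.2 n‖ ^ 2 ≤
      ∑ i ∈ P, ‖∑ n ∈ s, a n * expTwoPi (n * (((i.2 : ZMod (i.1 + 1)).val : ℝ) /
        ((i.1 + 1 : ℕ) : ℝ)))‖ ^ 2 := by
    rw [primitiveCharactersUpTo, hP, Finset.sum_sigma, Finset.sum_sigma]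
    refine Finset.sum_le_sum fun k _ ↦ ?_
    simp_rw [← stdAddChar_natCast_mul]
    exact sum_primitive_sq_norm_le s a
  refine h1.trans ?_
  have hinv : (K : ℝ) ^ 2 = (((K : ℝ) ^ 2)⁻¹)⁻¹ := by simp
  rw [hinv]
  refine additive_large_sieve P (fun i ↦ ((i.2 : ZMod (i.1 + 1)).val : ℝ) /
        ((i.1 + 1 : ℕ) : ℝ)) (by positivity) ?_ hM ?_ ?_ s hs a
  · exact inv_le_one_of_one_le₀ (one_le_pow₀ hK')
  · intro i _
    refine ⟨by positivity, ?_⟩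
    rw [div_lt_one (by positivity)]
    exact_mod_cast ZMod.val_lt _
  · rintro ⟨k, u⟩ hi ⟨l, v⟩ hj hij
    simp only [hP, Finset.mem_sigma, Finset.mem_range, Finset.mem_univ, and_true] at hi hj
    have hu := ZMod.val_coe_unit_coprime u
    have hv := ZMod.val_coe_unit_coprime v
    set x := (u : ZMod (k + 1)).val with hx
    set y := (v : ZMod (l + 1)).val with hy
    -- Reduced fractions that coincide have equal denominators; distinct ones differ by at least 1
    -- over the product of the denominators, hence by at least K^(-2).
    have hne : x * (l + 1) ≠ y * (k + 1) := by
      intro h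
      apply hij
      have hkl : k + 1 = l + 1 := by
        apply Nat.dvd_antisymm
        · exact hu.symm.dvd_of_dvd_mul_left (h ▸ Dvd.intro_left _ rfl)
        · exact hv.symm.dvd_of_dvd_mul_left (h ▸ Dvd.intro_left _ rfl)
      obtain rfl : k = l := by omega
      have : x = y := Nat.eq_of_mul_eq_mul_right (Nat.succ_pos k) h
      rw [hx, hy] at this
      have := ZMod.val_injective _ this
      rw [Units.ext this]
    have hz : (1 : ℝ) ≤ |(x : ℝ) * ((l + 1 : ℕ) : ℝ) - y * ((k + 1 : ℕ) : ℝ)| := by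
      have : ((x * (l + 1) : ℕ) : ℤ) - ((y * (k + 1) : ℕ) : ℤ) ≠ 0 := by
        intro h; apply hne; omega
      have := Int.one_le_abs this
      exact_mod_cast this
    have hk : ((k + 1 : ℕ) : ℝ) ≤ K := by exact_mod_cast hi
    have hl : ((l + 1 : ℕ) : ℝ) ≤ K := by exact_mod_cast hj
    have hk0 : (0 : ℝ) < ((k + 1 : ℕ) : ℝ) := by positivity
    have hl0 : (0 : ℝ) < ((l + 1 : ℕ) : ℝ) := by positivity
    rw [div_sub_div _ _ hk0.ne' hl0.ne', abs_div, abs_of_pos (mul_pos hk0 hl0),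
      mul_comm ((k + 1 : ℕ) : ℝ) (y : ℝ), inv_eq_one_div]
    apply div_le_div₀ (by positivity) hz (by positivity)
    rw [sq]
    gcongr

end LargeSieve

/-! ### Gallagher's lemma and the large sieve averaged over t. -/

section HybridLargeSieve

open MeasureTheory Set

open scoped FourierTransform Convolution

/-- The indicator function of `[-1/2, 1/2]`. -/
noncomputable def boxFun : ℝ → ℂ := (Icc (-1 / 2 : ℝ) (1 / 2)).indicator 1

theorem boxFun_neg (x : ℝ) : boxFun (-x) = boxFun x := by
  unfold boxFun
  by_cases h : x ∈ Icc (-1 / 2 : ℝ) (1 / 2)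
  · rw [indicator_of_mem h, indicator_of_mem]; · simp
    exact ⟨by linarith [h.2], by linarith [h.1]⟩
  · rw [indicator_of_notMem h, indicator_of_notMem]
    intro h'
    exact h ⟨by linarith [h'.2], by linarith [h'.1]⟩

theorem integrable_boxFun : Integrable boxFun :=
  (integrable_indicator_iff measurableSet_Icc).2 (integrableOn_const (by simp))

theorem fourier_boxFun (ξ : ℝ) : 𝓕 boxFun ξ = (Real.sinc (Real.pi * ξ) : ℝ) := by
  rw [Real.fourier_real_eq_integral_exp_smul]
  have h1 : ∀ v : ℝ, Complex.exp (((-2 * Real.pi * v * ξ : ℝ) : ℂ) * Complex.I) • boxFun v =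
      (Icc (-1 / 2 : ℝ) (1 / 2)).indicator
        (fun v : ℝ ↦ Complex.exp ((-2 * Real.pi * Complex.I * ξ) * v)) v := by
    intro v
    unfold boxFun
    by_cases h : v ∈ Icc (-1 / 2 : ℝ) (1 / 2)
    · rw [indicator_of_mem h, indicator_of_mem h]
      simp
      ring_nf
    · rw [indicator_of_notMem h, indicator_of_notMem h, smul_zero]
  simp_rw [h1]
  rw [integral_indicator measurableSet_Icc, integral_Icc_eq_integral_Ioc,
    ← intervalIntegral.integral_of_le (by norm_num)]
  rcases eq_or_ne ξ 0 with rfl | h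
  · simp; norm_num
  · have hp : (Real.pi : ℂ) ≠ 0 := by exact_mod_cast Real.pi_ne_zero
    have hx : (ξ : ℂ) ≠ 0 := by exact_mod_cast h
    rw [integral_exp_mul_complex (by simp [hp, hx]),
      Real.sinc_of_ne_zero (mul_ne_zero Real.pi_ne_zero h)]
    push_cast
    rw [Complex.sin]
    have hI := Complex.I_ne_zero
    field_simp
    rw [Complex.I_sq]
    ring_nf

/-- The autocorrelation of `boxFun` is continuous. -/
theorem continuous_boxFun_convolution :
    Continuous (boxFun ⋆[ContinuousLinearMap.mul ℂ ℂ] boxFun) := by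
  -- The convolution at x is the length of the overlap of two unit intervals, an explicit triangle
  -- function.
  have : (boxFun ⋆[ContinuousLinearMap.mul ℂ ℂ] boxFun) =
      fun x ↦ ((max (min (1 / 2) (x + 1 / 2) - max (-1 / 2) (x - 1 / 2)) 0 : ℝ) : ℂ) := by
    ext x
    rw [convolution]
    have h1 : ∀ t : ℝ, (ContinuousLinearMap.mul ℂ ℂ (boxFun t)) (boxFun (x - t)) =
        (Icc (max (-1 / 2) (x - 1 / 2)) (min (1 / 2) (x + 1 / 2))).indicator
          (fun _ ↦ (1 : ℂ)) t := by
      intro t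
      rw [ContinuousLinearMap.mul_apply']
      unfold boxFun
      by_cases ha : t ∈ Icc (-1 / 2 : ℝ) (1 / 2)
      · by_cases hb : x - t ∈ Icc (-1 / 2 : ℝ) (1 / 2)
        · rw [indicator_of_mem ha, indicator_of_mem hb, indicator_of_mem]
          · simp
          · exact ⟨max_le ha.1 (by linarith [hb.2]), le_min ha.2 (by linarith [hb.1])⟩
        · rw [indicator_of_notMem hb, mul_zero, indicator_of_notMem]
          intro h
          exact hb ⟨by linarith [h.2.trans (min_le_right _ _)],
            by linarith [(le_max_right _ _).trans h.1]⟩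
      · rw [indicator_of_notMem ha, zero_mul, indicator_of_notMem]
        intro h
        exact ha ⟨(le_max_left _ _).trans h.1, h.2.trans (min_le_left _ _)⟩
    simp_rw [h1]
    rw [integral_indicator measurableSet_Icc, setIntegral_const, Measure.real, Real.volume_Icc,
      ENNReal.toReal_ofReal']
    simp
  rw [this]
  fun_prop

theorem fourier_boxFun_convolution (ξ : ℝ) :
    𝓕 (boxFun ⋆[ContinuousLinearMap.mul ℂ ℂ] boxFun) ξ
      = ((Real.sinc (Real.pi * ξ) ^ 2 : ℝ) : ℂ) := by
  rw [Real.fourier_mul_convolution_eq integrable_boxFun integrable_boxFun, fourier_boxFun]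
  push_cast; ring

theorem integrable_sinc_sq : Integrable fun ξ : ℝ ↦ Real.sinc (Real.pi * ξ) ^ 2 := by
  apply (integrable_inv_one_add_sq.const_mul 2).mono'
  · exact (by fun_prop : Continuous fun ξ : ℝ ↦ Real.sinc (Real.pi * ξ) ^ 2).aestronglyMeasurable
  · filter_upwards with ξ
    rw [Real.norm_of_nonneg (sq_nonneg _), ← div_eq_mul_inv, le_div_iff₀ (by positivity)]
    have h1 : Real.sinc (Real.pi * ξ) ^ 2 ≤ 1 := by
      rw [sq_le_one_iff_abs_le_one]; exact Real.abs_sinc_le_one _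
    have h2 : Real.sinc (Real.pi * ξ) ^ 2 * ξ ^ 2 ≤ 1 := by
      rcases eq_or_ne ξ 0 with rfl | h
      · simp
      · rw [Real.sinc_of_ne_zero (mul_ne_zero Real.pi_ne_zero h), ← mul_pow,
          show Real.sin (Real.pi * ξ) / (Real.pi * ξ) * ξ = Real.sin (Real.pi * ξ) / Real.pi by
            field_simp, div_pow, div_le_one (by positivity)]
        have := Real.sin_sq_le_one (Real.pi * ξ)
        nlinarith [Real.pi_gt_three]
    linarith

/-- Fourier inversion for the triangle function. The weight sinc² is used because its transform is a
convolution of boxes, which turns a weighted mean square over ξ into a mean square of short sums. -/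
theorem integral_sinc_sq_mul_expTwoPi (x : ℝ) :
    ∫ ξ : ℝ, ((Real.sinc (Real.pi * ξ) ^ 2 : ℝ) : ℂ) * expTwoPi (x * ξ)
      = ∫ t, boxFun t * boxFun (x - t) := by
  have h := congrFun (continuous_boxFun_convolution.fourierInv_fourier_eq
    (integrable_boxFun.integrable_convolution _ integrable_boxFun) (by
      rw [funext fourier_boxFun_convolution]
      exact integrable_sinc_sq.ofReal)) x
  rw [convolution] at h
  simp only [ContinuousLinearMap.mul_apply'] at h
  rw [← h, Real.fourierInv_eq_fourier_neg, Real.fourier_real_eq_integral_exp_smul]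
  congr 1
  ext ξ
  rw [fourier_boxFun_convolution, smul_eq_mul, mul_comm, expTwoPi]
  push_cast; ring_nf

/-- Jordan's inequality; it lets the weight sinc² majorize the indicator of [-1/2, 1/2] up to π²/4.
-/
theorem four_div_pi_sq_le_sinc_sq {ξ : ℝ} (h : |ξ| ≤ 1 / 2) :
    4 / Real.pi ^ 2 ≤ Real.sinc (Real.pi * ξ) ^ 2 := by
  wlog h0 : 0 ≤ ξ generalizing ξ
  · have := this (ξ := -ξ) (by rwa [abs_neg]) (by linarith)
    rwa [mul_neg, Real.sinc_neg] at this
  rw [show (4 : ℝ) / Real.pi ^ 2 = (2 / Real.pi) ^ 2 by rw [div_pow]; norm_num]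
  apply pow_le_pow_left₀ (by positivity)
  rw [abs_of_nonneg h0] at h
  have hp := Real.pi_pos
  rcases eq_or_lt_of_le h0 with rfl | h0
  · simp only [mul_zero, Real.sinc_zero]
    rw [div_le_one hp]; linarith [Real.pi_gt_three]
  · rw [Real.sinc_of_ne_zero (by positivity), le_div_iff₀ (by positivity)]
    exact Real.mul_le_sin (by positivity) (by nlinarith)

/-- Gallagher's lemma, for frequencies `l n`. -/
theorem integral_sq_norm_expSum_le (s : Finset ℕ) (b : ℕ → ℂ) (l : ℕ → ℝ) :
    ∫ ξ in (-1 / 2 : ℝ)..(1 / 2), ‖∑ n ∈ s, b n * expTwoPi (l n * ξ)‖ ^ 2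
      ≤ Real.pi ^ 2 / 4 * ∫ y, ‖∑ n ∈ s, b n * boxFun (y - l n)‖ ^ 2 := by
  set A : ℝ → ℂ := fun ξ ↦ ∑ n ∈ s, b n * expTwoPi (l n * ξ) with hA
  have hAc : Continuous A := by fun_prop
  have hint : ∀ m n, Integrable fun ξ : ℝ ↦ b m * starRingEnd ℂ (b n) *
      (((Real.sinc (Real.pi * ξ) ^ 2 : ℝ) : ℂ) * expTwoPi ((l m - l n) * ξ)) := by
    intro m n
    refine (integrable_sinc_sq.ofReal.mul_bdd (c := 1) (by fun_prop) ?_).const_mul _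
    filter_upwards with ξ using (norm_expTwoPi _).le
  have hE : ∀ ξ, ((Real.sinc (Real.pi * ξ) ^ 2 * ‖A ξ‖ ^ 2 : ℝ) : ℂ) = ∑ m ∈ s, ∑ n ∈ s,
      b m * starRingEnd ℂ (b n) *
      (((Real.sinc (Real.pi * ξ) ^ 2 : ℝ) : ℂ) * expTwoPi ((l m - l n) * ξ)) := by
    intro ξ
    rw [Complex.ofReal_mul, hA, sq_norm_sum_mul_expTwoPi, Finset.mul_sum]
    refine Finset.sum_congr rfl fun m _ ↦ ?_
    rw [Finset.mul_sum]
    refine Finset.sum_congr rfl fun n _ ↦ ?_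
    ring
  have hwint : Integrable fun ξ ↦ Real.sinc (Real.pi * ξ) ^ 2 * ‖A ξ‖ ^ 2 := by
    have : Integrable fun ξ ↦ ((Real.sinc (Real.pi * ξ) ^ 2 * ‖A ξ‖ ^ 2 : ℝ) : ℂ) := by
      simp_rw [hE]
      exact integrable_finsetSum _ fun m _ ↦ integrable_finsetSum _ fun n _ ↦ hint m n
    simpa only [RCLike.re_to_complex, Complex.ofReal_re] using this.re
  have h1 : ∫ ξ in (-1 / 2 : ℝ)..(1 / 2), ‖A ξ‖ ^ 2 ≤
      Real.pi ^ 2 / 4 * ∫ ξ, Real.sinc (Real.pi * ξ) ^ 2 * ‖A ξ‖ ^ 2 := by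
    calc ∫ ξ in (-1 / 2 : ℝ)..(1 / 2), ‖A ξ‖ ^ 2 ≤ ∫ ξ in (-1 / 2 : ℝ)..(1 / 2),
        Real.pi ^ 2 / 4 * (Real.sinc (Real.pi * ξ) ^ 2 * ‖A ξ‖ ^ 2) := by
          apply intervalIntegral.integral_mono_on (by norm_num)
          · exact Continuous.intervalIntegrable (by fun_prop) _ _
          · exact Continuous.intervalIntegrable (by fun_prop) _ _
          · intro ξ hξ
            have := four_div_pi_sq_le_sinc_sq (ξ := ξ) (abs_le.2 ⟨by linarith [hξ.1], hξ.2⟩)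
            rw [div_le_iff₀ (by positivity)] at this
            rw [← mul_assoc]
            apply le_mul_of_one_le_left (by positivity)
            linarith
      _ ≤ ∫ ξ, Real.pi ^ 2 / 4 * (Real.sinc (Real.pi * ξ) ^ 2 * ‖A ξ‖ ^ 2) := by
          rw [intervalIntegral.integral_of_le (by norm_num)]
          apply setIntegral_le_integral (hwint.const_mul _)
          filter_upwards with ξ
          positivity
      _ = _ := integral_const_mul _ _
  refine h1.trans (le_of_eq ?_)
  congr 1
  apply Complex.ofReal_injective
  rw [← integral_complex_ofReal, ← integral_complex_ofReal]
  simp_rw [hE]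
  have hb : ∀ x y : ℝ, Integrable fun t ↦ boxFun (t - x) * boxFun (t - y) := by
    intro x y
    refine (integrable_boxFun.comp_sub_right x).mul_bdd (c := 1)
      (integrable_boxFun.comp_sub_right y).aestronglyMeasurable ?_
    filter_upwards with t
    unfold boxFun
    exact (norm_indicator_le_norm_self _ _).trans (by simp)
  have hF : ∀ y, ((‖∑ n ∈ s, b n * boxFun (y - l n)‖ ^ 2 : ℝ) : ℂ) = ∑ m ∈ s, ∑ n ∈ s,
      b m * starRingEnd ℂ (b n) * (boxFun (y - l m) * boxFun (y - l n)) := by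
    intro y
    push_cast
    rw [← Complex.mul_conj', map_sum, Finset.sum_mul_sum]
    refine Finset.sum_congr rfl fun m _ ↦ Finset.sum_congr rfl fun n _ ↦ ?_
    have : starRingEnd ℂ (boxFun (y - l n)) = boxFun (y - l n) := by
      unfold boxFun
      by_cases h : y - l n ∈ Icc (-1 / 2 : ℝ) (1 / 2)
      · rw [indicator_of_mem h]; simp
      · rw [indicator_of_notMem h]; simp
    rw [map_mul, this]
    ring
  simp_rw [hF]
  rw [integral_finsetSum _ fun m _ ↦ integrable_finsetSum _ fun n _ ↦ hint m n,
    integral_finsetSum _ fun m _ ↦ integrable_finsetSum _ fun n _ ↦ (hb _ _).const_mul _]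
  refine Finset.sum_congr rfl fun m _ ↦ ?_
  rw [integral_finsetSum _ fun n _ ↦ hint m n,
    integral_finsetSum _ fun n _ ↦ (hb _ _).const_mul _]
  refine Finset.sum_congr rfl fun n _ ↦ ?_
  rw [integral_const_mul, integral_const_mul, integral_sinc_sq_mul_expTwoPi,
    ← integral_sub_right_eq_self _ (l n)]
  congr 1
  congr 1
  ext y
  rw [show l m - l n - (y - l n) = -(y - l m) by ring, boxFun_neg, mul_comm]

/-- The hybrid large sieve inequality for primitive characters, averaged over `|t| ≤ T`. -/
theorem hybrid_large_sieve (K : ℕ) {T : ℝ} (hT : 1 ≤ T) (s : Finset ℕ) (hs : ∀ n ∈ s, 1 ≤ n)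
    (a : ℕ → ℂ) :
    ∑ p ∈ primitiveCharactersUpTo K, ∫ t in (-T)..T,
        ‖∑ n ∈ s, a n * p.2 n * (n : ℂ) ^ (-(Complex.I * t))‖ ^ 2
      ≤ 50000 * ∑ n ∈ s, ((K : ℝ) ^ 2 * T + n) * ‖a n‖ ^ 2 := by
  have hT0 : 0 < T := by linarith
  have hpi := Real.pi_pos
  -- With t = 2Tξ one has n^(-it) = e(l(n) ξ). A window of half-width 1/2 for l(n) is one of
  -- half-width h = π/(2T) for log n.
  set l : ℕ → ℝ := fun n ↦ -(T * Real.log n / Real.pi) with hl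
  set h : ℝ := Real.pi / (2 * T) with hh
  have hh0 : 0 < h := by positivity
  have hh2 : h ≤ 2 := by
    rw [hh, div_le_iff₀ (by positivity)]
    linarith [Real.pi_lt_four]
  have hhT : h ≤ 2 / T := by
    rw [hh, div_le_div_iff₀ (by positivity) hT0]
    nlinarith [Real.pi_lt_four]
  have h1 : ∀ p ∈ primitiveCharactersUpTo K, ∫ t in (-T)..T,
        ‖∑ n ∈ s, a n * p.2 n * (n : ℂ) ^ (-(Complex.I * t))‖ ^ 2 =
      2 * T * ∫ ξ in (-1 / 2 : ℝ)..(1 / 2), ‖∑ n ∈ s, a n * p.2 n * expTwoPi (l n * ξ)‖ ^ 2 := by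
    intro p _
    have := intervalIntegral.mul_integral_comp_mul_left (a := -1 / 2) (b := 1 / 2)
      (f := fun t : ℝ ↦ ‖∑ n ∈ s, a n * p.2 n * (n : ℂ) ^ (-(Complex.I * t))‖ ^ 2) (2 * T)
    rw [show 2 * T * (-1 / 2) = -T by ring, show 2 * T * (1 / 2) = T by ring] at this
    rw [← this]
    congr 2
    ext ξ
    congr 2
    refine Finset.sum_congr rfl fun n hn ↦ ?_
    congr 1
    have hn0 : (n : ℂ) ≠ 0 := by
      have := hs n hn
      exact_mod_cast (by omega : n ≠ 0)
    rw [Complex.cpow_def_of_ne_zero hn0, expTwoPi, hl]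
    congr 1
    have hp : (Real.pi : ℂ) ≠ 0 := by exact_mod_cast hpi.ne'
    push_cast
    field_simp
  rw [Finset.sum_congr rfl h1, ← Finset.mul_sum]
  have hint : ∀ b : ℕ → ℂ, Integrable fun y ↦ ‖∑ n ∈ s, b n * boxFun (y - l n)‖ ^ 2 := by
    intro b
    have hm : Integrable fun y ↦ ∑ n ∈ s, b n * boxFun (y - l n) :=
      integrable_finsetSum _ fun n _ ↦ (integrable_boxFun.comp_sub_right _).const_mul _
    have hbd : ∀ y, ‖∑ n ∈ s, b n * boxFun (y - l n)‖ ≤ ∑ n ∈ s, ‖b n‖ := by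
      intro y
      refine (norm_sum_le _ _).trans (Finset.sum_le_sum fun n _ ↦ ?_)
      rw [norm_mul]
      apply mul_le_of_le_one_right (norm_nonneg _)
      unfold boxFun
      exact (norm_indicator_le_norm_self _ _).trans (by simp)
    simp_rw [sq]
    refine hm.norm.mul_bdd (c := ∑ n ∈ s, ‖b n‖) hm.aestronglyMeasurable.norm ?_
    filter_upwards with y
    rw [norm_norm]
    exact hbd y
  set I : ℕ → ℝ → ℝ := fun n ↦ (Icc (l n - 1 / 2) (l n + 1 / 2)).indicator 1 with hI
  have hIint : ∀ n, Integrable (I n) := fun n ↦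
    (integrable_indicator_iff measurableSet_Icc).2 (integrableOn_const (by simp))
  have hIval : ∀ n, ∫ y, I n y = 1 := by
    intro n
    rw [hI, integral_indicator_one measurableSet_Icc, Measure.real, Real.volume_Icc]
    norm_num
  -- For fixed y the box keeps only n with |log n - Y| ≤ h, a window around exp Y of length
  -- comparable to n/T. The multiplicative sieve on it costs K² + O(n/T), and integrating over y
  -- counts each n once.
  have hpt : ∀ y, ∑ p ∈ primitiveCharactersUpTo K, ‖∑ n ∈ s, a n * p.2 n * boxFun (y - l n)‖ ^ 2
      ≤ ∑ n ∈ s, (2 * ((K : ℝ) ^ 2 + 41 * (120 * n / T)) * ‖a n‖ ^ 2) * I n y := by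
    intro y
    set Y : ℝ := -(Real.pi * y / T) with hY
    set u := s.filter fun n ↦ y ∈ Icc (l n - 1 / 2) (l n + 1 / 2) with hu
    have hsum : ∀ f : ℕ → ℂ, ∑ n ∈ s, f n * boxFun (y - l n) = ∑ n ∈ u, f n := by
      intro f
      rw [hu, Finset.sum_filter]
      refine Finset.sum_congr rfl fun n _ ↦ ?_
      unfold boxFun
      split_ifs with hy
      · rw [indicator_of_mem]
        · simp
        · exact ⟨by linarith [hy.1], by linarith [hy.2]⟩
      · rw [indicator_of_notMem _, mul_zero]
        intro h'
        exact hy ⟨by linarith [h'.1], by linarith [h'.2]⟩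
    simp_rw [hsum]
    have hlog : ∀ n ∈ u, Y - h ≤ Real.log n ∧ Real.log n ≤ Y + h := by
      intro n hn
      have hy := (Finset.mem_filter.1 hn).2
      have e : Real.log n - Y = Real.pi / T * (y - l n) := by
        rw [hY, hl]; field_simp; ring
      have e2 : h = Real.pi / T * (1 / 2) := by rw [hh]; field_simp
      have h1 : Real.pi / T * (y - l n) ≤ Real.pi / T * (1 / 2) := by
        apply mul_le_mul_of_nonneg_left _ (by positivity); linarith [hy.2]
      have h2 : Real.pi / T * (-(1 / 2)) ≤ Real.pi / T * (y - l n) := by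
        apply mul_le_mul_of_nonneg_left _ (by positivity); linarith [hy.1]
      constructor <;> linarith
    have hn0 : ∀ n ∈ u, (0 : ℝ) < n := by
      intro n hn
      exact_mod_cast hs n (Finset.mem_filter.1 hn).1
    have hexph : Real.exp h - 1 ≤ h * Real.exp h := by
      have h1 := Real.add_one_le_exp (-h)
      have h2 : Real.exp (-h) * Real.exp h = 1 := by rw [← Real.exp_add]; simp
      nlinarith [Real.exp_pos h]
    have hls := multiplicative_large_sieve K u (A := Real.exp Y)
      (M := Real.exp Y * (h * Real.exp h)) (by positivity) (by
        intro n hn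
        obtain ⟨h1, h2⟩ := hlog n hn
        have h3 : Real.exp (Y - h) ≤ n := by
          rw [← Real.exp_log (hn0 n hn)]; exact Real.exp_le_exp.2 h1
        have h4 : (n : ℝ) ≤ Real.exp (Y + h) := by
          rw [← Real.exp_log (hn0 n hn)]; exact Real.exp_le_exp.2 h2
        rw [Real.exp_add] at h4
        rw [Real.exp_sub, div_le_iff₀ (Real.exp_pos h)] at h3
        rw [abs_le]
        have := Real.exp_pos Y
        have := Real.exp_pos h
        have h5 : (1 : ℝ) ≤ Real.exp h := Real.one_le_exp hh0.le
        constructor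
        · have h6 : Real.exp Y * (1 - h * Real.exp h) * Real.exp h ≤ Real.exp Y := by
            rw [mul_assoc]
            apply mul_le_of_le_one_right (Real.exp_pos Y).le
            nlinarith
          have h7 : Real.exp Y * (1 - h * Real.exp h) ≤ n :=
            le_of_mul_le_mul_right (h6.trans h3) (Real.exp_pos h)
          linarith
        · nlinarith) a
    refine hls.trans ?_
    rw [Finset.mul_sum, hu, Finset.sum_filter]
    refine Finset.sum_le_sum fun n hn ↦ ?_
    split_ifs with hy
    · rw [hI]
      simp only [indicator_of_mem hy, Pi.one_apply, mul_one]
      have hnu : n ∈ u := Finset.mem_filter.2 ⟨hn, hy⟩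
      have h3 : Real.exp Y ≤ n * Real.exp h := by
        rw [← Real.exp_log (hn0 n hnu), ← Real.exp_add]
        exact Real.exp_le_exp.2 (by linarith [(hlog n hnu).1])
      have hM : Real.exp Y * (h * Real.exp h) ≤ 120 * n / T := by
        -- One factor exp h compares exp Y with n, the other comes from M; h ≤ 2 gives e^4 ≤ 60, and
        -- h ≤ 2/T makes 120.
        have e4 : Real.exp h * Real.exp h ≤ 60 := by
          rw [← Real.exp_add]
          calc Real.exp (h + h) ≤ Real.exp (4 * 1) := Real.exp_le_exp.2 (by linarith)
            _ = Real.exp 1 ^ 4 := by rw [← Real.exp_nat_mul]; norm_num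
            _ ≤ 2.72 ^ 4 := by gcongr; linarith [Real.exp_one_lt_d9]
            _ ≤ 60 := by norm_num
        calc Real.exp Y * (h * Real.exp h) ≤ (n * Real.exp h) * (2 / T * Real.exp h) := by gcongr
          _ = 2 * n / T * (Real.exp h * Real.exp h) := by ring
          _ ≤ 2 * n / T * 60 := by gcongr
          _ = _ := by ring
      gcongr
    · have : 0 ≤ I n y := indicator_nonneg (fun _ _ ↦ by simp) _
      positivity
  have h2 : ∑ p ∈ primitiveCharactersUpTo K, ∫ y, ‖∑ n ∈ s, a n * p.2 n * boxFun (y - l n)‖ ^ 2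
      ≤ ∑ n ∈ s, 2 * ((K : ℝ) ^ 2 + 41 * (120 * n / T)) * ‖a n‖ ^ 2 := by
    rw [← integral_finsetSum _ fun p _ ↦ hint (fun n ↦ a n * p.2 n)]
    refine (integral_mono (integrable_finsetSum _ fun p _ ↦ hint (fun n ↦ a n * p.2 n))
      (integrable_finsetSum _ fun n _ ↦ (hIint n).const_mul _) hpt).trans (le_of_eq ?_)
    rw [integral_finsetSum _ fun n _ ↦ (hIint n).const_mul _]
    refine Finset.sum_congr rfl fun n _ ↦ ?_
    rw [integral_const_mul, hIval, mul_one]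
  have h3 : ∑ p ∈ primitiveCharactersUpTo K, ∫ ξ in (-1 / 2 : ℝ)..(1 / 2),
      ‖∑ n ∈ s, a n * p.2 n * expTwoPi (l n * ξ)‖ ^ 2 ≤ Real.pi ^ 2 / 4 *
      ∑ n ∈ s, 2 * ((K : ℝ) ^ 2 + 41 * (120 * n / T)) * ‖a n‖ ^ 2 := by
    refine (Finset.sum_le_sum fun p _ ↦
      integral_sq_norm_expSum_le s (fun n ↦ a n * p.2 n) l).trans ?_
    rw [← Finset.mul_sum]
    gcongr
  have hp : Real.pi ^ 2 / 4 ≤ 5 / 2 := by nlinarith [Real.pi_lt_d2, Real.pi_pos]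
  calc _ ≤ 2 * T * (5 / 2 * ∑ n ∈ s, 2 * ((K : ℝ) ^ 2 + 41 * (120 * n / T)) * ‖a n‖ ^ 2) := by
        gcongr
        refine h3.trans ?_
        gcongr
    _ = ∑ n ∈ s, (10 * ((K : ℝ) ^ 2 * T + 41 * 120 * n)) * ‖a n‖ ^ 2 := by
        rw [Finset.mul_sum, Finset.mul_sum]
        refine Finset.sum_congr rfl fun n _ ↦ ?_
        field_simp
        ring
    _ ≤ _ := by
        rw [Finset.mul_sum]
        refine Finset.sum_le_sum fun n _ ↦ ?_
        rw [← mul_assoc]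
        apply mul_le_mul_of_nonneg_right _ (by positivity)
        have : 0 ≤ (K : ℝ) ^ 2 * T := by positivity
        have : (0 : ℝ) ≤ n := by positivity
        linarith

end HybridLargeSieve

/-! ### Divisor functions d_k and Rankin's bounds. -/

section DivisorFunctions

open ArithmeticFunction

/-- The `k`-fold divisor function `d_k`, the Dirichlet coefficients of `ζ(s)^k`. -/
def divisorFun (k n : ℕ) : ℕ := (ArithmeticFunction.zeta ^ k : ArithmeticFunction ℕ) n

theorem divisorFun_zero_right (k : ℕ) : divisorFun k 0 = 0 := by simp [divisorFun]

theorem divisorFun_succ (k n : ℕ) :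
    divisorFun (k + 1) n = ∑ d ∈ n.divisors, divisorFun k d := by
  rw [divisorFun, pow_succ, mul_zeta_apply]; rfl

theorem divisorFun_succ' (k n : ℕ) :
    divisorFun (k + 1) n = ∑ x ∈ n.divisorsAntidiagonal, divisorFun k x.1 := by
  rw [divisorFun_succ, Nat.sum_divisorsAntidiagonal (fun i _ ↦ divisorFun k i)]

theorem divisorFun_zero_left (n : ℕ) : divisorFun 0 n = if n = 1 then 1 else 0 := by
  simp [divisorFun, one_apply]

theorem divisorFun_one_right (k : ℕ) : divisorFun k 1 = 1 := by
  induction k with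
  | zero => simp [divisorFun_zero_left]
  | succ k ih => simp [divisorFun_succ, ih]

/-- Every divisor of ab is a product of a divisor of a and one of b, so induction on k loses only
multiplicities. -/
theorem divisorFun_mul_le (k a b : ℕ) :
    divisorFun k (a * b) ≤ divisorFun k a * divisorFun k b := by
  classical
  induction k generalizing a b with
  | zero =>
    simp only [divisorFun_zero_left]
    by_cases h : a * b = 1
    · obtain ⟨rfl, rfl⟩ := mul_eq_one.1 h
      simp
    · simp [h]
  | succ k ih =>
    rw [divisorFun_succ, divisorFun_succ, divisorFun_succ, Nat.divisors_mul, Finset.mul_def]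
    refine (Finset.sum_le_sum_of_subset_of_nonneg (t := (a.divisors ×ˢ b.divisors).image
      fun p ↦ p.1 * p.2) subset_rfl fun _ _ _ ↦ Nat.zero_le _).trans ?_
    have : ∑ x ∈ (a.divisors ×ˢ b.divisors).image (fun p ↦ p.1 * p.2), divisorFun k x ≤
        ∑ p ∈ a.divisors ×ˢ b.divisors, divisorFun k (p.1 * p.2) :=
      Finset.sum_image_le_of_nonneg fun _ _ ↦ Nat.zero_le _
    refine this.trans ?_
    rw [Finset.sum_mul_sum, ← Finset.sum_product']
    exact Finset.sum_le_sum fun p _ ↦ ih _ _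

/-- Induction on l: split n = x₁x₂ in the convolution and use submultiplicativity of d_k. This keeps
powers of divisor functions inside the family d_k, whose Dirichlet series are powers of ζ. -/
theorem divisorFun_mul_divisorFun_le (k l n : ℕ) :
    divisorFun k n * divisorFun l n ≤ divisorFun (k * l) n := by
  induction l generalizing n with
  | zero =>
    simp only [divisorFun_zero_left, mul_zero]
    split_ifs with h
    · simp [h, divisorFun_one_right]
    · simp
  | succ l ih =>
    rw [divisorFun_succ', Finset.mul_sum, mul_add, mul_one]
    conv_rhs => rw [divisorFun, pow_add, mul_apply]
    refine Finset.sum_le_sum fun x hx ↦ ?_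
    rw [← (Nat.mem_divisorsAntidiagonal.1 hx).1]
    calc divisorFun k (x.1 * x.2) * divisorFun l x.1
        ≤ divisorFun k x.1 * divisorFun k x.2 * divisorFun l x.1 := by
          gcongr; exact divisorFun_mul_le _ _ _
      _ = divisorFun k x.1 * divisorFun l x.1 * divisorFun k x.2 := by ring
      _ ≤ divisorFun (k * l) x.1 * divisorFun k x.2 := by gcongr; exact ih _

theorem divisorFun_pow_le (k j : ℕ) {n : ℕ} (hn : n ≠ 0) :
    divisorFun k n ^ j ≤ divisorFun (k ^ j) n := by
  induction j with
  | zero => simp [divisorFun, hn]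
  | succ j ih =>
    rw [pow_succ, pow_succ]
    exact (Nat.mul_le_mul_right _ ih).trans (divisorFun_mul_divisorFun_le _ _ _)

/-- Complete multiplicativity of χ lets it pass through the Dirichlet convolution that defines d_k.
-/
theorem LSeriesHasSum_mul_divisorFun {N : ℕ} (χ : DirichletCharacter ℂ N) (k : ℕ) {s : ℂ}
    (hs : 1 < s.re) :
    LSeriesHasSum (fun n ↦ χ n * (divisorFun k n : ℂ)) s (LSeries (χ ·) s ^ k) := by
  induction k with
  | zero =>
    have h : LSeriesHasSum LSeries.delta s 1 := by
      rw [LSeriesHasSum, funext (LSeries.term_delta s)]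
      exact hasSum_ite_eq 1 1
    rw [pow_zero]
    refine (LSeriesHasSum_congr s _ fun {n} hn ↦ ?_).1 h
    rw [LSeries.delta, divisorFun_zero_left]
    split_ifs with h1
    · simp [h1]
    · simp
  | succ k ih =>
    have h1 := ih.convolution (DirichletCharacter.LSeriesSummable_of_one_lt_re χ hs).LSeriesHasSum
    rw [← pow_succ] at h1
    refine (LSeriesHasSum_congr s _ fun {n} hn ↦ ?_).1 h1
    rw [LSeries.convolution_def, divisorFun_succ', Nat.cast_sum, Finset.mul_sum]
    refine Finset.sum_congr rfl fun x hx ↦ ?_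
    rw [← (Nat.mem_divisorsAntidiagonal.1 hx).1]
    push_cast
    rw [map_mul]
    ring

theorem tsum_one_div_rpow_le {δ : ℝ} (hδ : 0 < δ) :
    ∑' n : ℕ, 1 / (n + 1 : ℝ) ^ (1 + δ) ≤ 1 + 1 / δ := by
  have h := ZetaAsymptotics.zeta_limit_aux1 (s := 1 + δ) (by linarith)
  have h2 : 0 ≤ (1 + δ) * ZetaAsymptotics.termTSum (1 + δ) :=
    mul_nonneg (by linarith) (tsum_nonneg fun n ↦ ZetaAsymptotics.term_nonneg _ _)
  rw [add_sub_cancel_left] at h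
  linarith

theorem hasSum_divisorFun_div (k : ℕ) {δ : ℝ} (hδ : 0 < δ) :
    HasSum (fun n : ℕ ↦ (divisorFun k n : ℝ) / (n : ℝ) ^ (1 + δ))
      ((∑' n : ℕ, 1 / (n + 1 : ℝ) ^ (1 + δ)) ^ k) := by
  have hs : 1 < ((1 + δ : ℝ) : ℂ).re := by simpa using hδ
  have h := LSeriesHasSum_mul_divisorFun (1 : DirichletCharacter ℂ 1) k hs
  rw [DirichletCharacter.LSeries_modOne_eq, LSeries_one_eq_riemannZeta hs,
    zeta_eq_tsum_one_div_nat_add_one_cpow hs] at h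
  rw [← Complex.hasSum_ofReal]
  have e : (((∑' n : ℕ, 1 / (n + 1 : ℝ) ^ (1 + δ)) ^ k : ℝ) : ℂ)
      = (∑' n : ℕ, 1 / (n + 1 : ℂ) ^ (((1 + δ : ℝ)) : ℂ)) ^ k := by
    rw [Complex.ofReal_pow, Complex.ofReal_tsum]
    congr 2
    ext n
    rw [Complex.ofReal_div, Complex.ofReal_cpow (by positivity)]
    push_cast; rfl
  rw [e]
  refine HasSum.congr_fun h fun n ↦ ?_
  rw [LSeries.term]
  split_ifs with hn
  · simp [hn, divisorFun_zero_right]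
  · rw [MulChar.one_apply (isUnit_of_subsingleton _), one_mul, Complex.ofReal_div,
      Complex.ofReal_cpow (by positivity)]
    push_cast; rfl

theorem tsum_divisorFun_div_le (k : ℕ) {δ : ℝ} (hδ : 0 < δ) :
    ∑' n : ℕ, (divisorFun k n : ℝ) / (n : ℝ) ^ (1 + δ) ≤ (1 + 1 / δ) ^ k := by
  rw [(hasSum_divisorFun_div k hδ).tsum_eq]
  gcongr
  · exact tsum_one_div_rpow_le hδ

theorem sum_divisorFun_div_le (k : ℕ) {δ : ℝ} (hδ : 0 < δ) (s : Finset ℕ) :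
    ∑ n ∈ s, (divisorFun k n : ℝ) / (n : ℝ) ^ (1 + δ) ≤ (1 + 1 / δ) ^ k :=
  ((hasSum_divisorFun_div k hδ).summable.sum_le_tsum s fun _ _ ↦ by positivity).trans
    (tsum_divisorFun_div_le k hδ)

theorem divisorFun_sq_le (n : ℕ) : (divisorFun 4 n : ℝ) ^ 2 ≤ divisorFun 16 n := by
  rw [sq]
  exact_mod_cast divisorFun_mul_divisorFun_le 4 4 n

/-- The price of Rankin's trick with δ = 1/(1 + log N): x^δ ≤ e, while ζ(1 + δ) ≤ 1 + 1/δ = 2 + log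
N. -/
theorem rpow_inv_one_add_log_le {N x : ℝ} (hN : 1 ≤ N) (hx : 0 < x) (hxN : x ≤ N) :
    x ^ (1 / (1 + Real.log N)) ≤ 3 := by
  have hL := Real.log_nonneg hN
  calc x ^ (1 / (1 + Real.log N)) ≤ N ^ (1 / (1 + Real.log N)) := by gcongr
    _ = Real.exp (Real.log N * (1 / (1 + Real.log N))) := Real.rpow_def_of_pos (by linarith) _
    _ ≤ Real.exp 1 := by
        apply Real.exp_le_exp.2
        rw [mul_one_div, div_le_one (by linarith)]
        linarith
    _ ≤ 3 := by linarith [Real.exp_one_lt_d9]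

/-- Rankin's bound for the short sum of `d_4(n)^2 / n`. -/
theorem sum_divisorFun_sq_div_le {N : ℝ} (hN : 1 ≤ N) (s : Finset ℕ)
    (hs : ∀ n ∈ s, 1 ≤ n ∧ (n : ℝ) ≤ N) :
    ∑ n ∈ s, (divisorFun 4 n : ℝ) ^ 2 / n ≤ 3 * (2 + Real.log N) ^ 16 := by
  have hL := Real.log_nonneg hN
  set δ := 1 / (1 + Real.log N) with hδ
  have hδ0 : 0 < δ := by positivity
  have h := sum_divisorFun_div_le 16 hδ0 s
  rw [show 1 + 1 / δ = 2 + Real.log N by rw [hδ, one_div_one_div]; ring] at h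
  refine le_trans ?_ (mul_le_mul_of_nonneg_left h (by norm_num))
  rw [Finset.mul_sum]
  refine Finset.sum_le_sum fun n hn ↦ ?_
  have hn0 : (0 : ℝ) < n := by exact_mod_cast (hs n hn).1
  have h1 := rpow_inv_one_add_log_le hN hn0 (hs n hn).2
  rw [Real.rpow_add hn0, Real.rpow_one, ← mul_div_assoc, div_le_div_iff₀ hn0 (by positivity)]
  calc (divisorFun 4 n : ℝ) ^ 2 * (n * n ^ δ) ≤ divisorFun 16 n * (n * 3) := by
        gcongr; exact divisorFun_sq_le n
    _ = _ := by ring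

/-- Rankin's bound for the tail of the sum of `d_4(n)^2 / n^2`. -/
theorem sum_divisorFun_sq_div_sq_le {N : ℝ} (hN : 1 ≤ N) (s : Finset ℕ)
    (hs : ∀ n ∈ s, N < n) :
    ∑ n ∈ s, (divisorFun 4 n : ℝ) ^ 2 / n ^ 2 ≤ 3 * (2 + Real.log N) ^ 16 / N := by
  have hL := Real.log_nonneg hN
  set δ := 1 / (1 + Real.log N) with hδ
  have hδ0 : 0 < δ := by positivity
  have hδ1 : δ ≤ 1 := by rw [hδ, div_le_one] <;> linarith
  have h := sum_divisorFun_div_le 16 hδ0 s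
  rw [show 1 + 1 / δ = 2 + Real.log N by rw [hδ, one_div_one_div]; ring] at h
  have hN0 : 0 < N := by linarith
  rw [mul_div_right_comm]
  refine le_trans ?_ (mul_le_mul_of_nonneg_left h (by positivity))
  rw [Finset.mul_sum]
  refine Finset.sum_le_sum fun n hn ↦ ?_
  have hnN := hs n hn
  have hn0 : (0 : ℝ) < n := by linarith
  have h1 := rpow_inv_one_add_log_le hN hN0 le_rfl
  rw [← hδ] at h1
  -- Beyond N the roles change: since δ ≤ 1, n^(1 - δ) is at least N^(1 - δ), and this yields the
  -- saving 1/N.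
  have h2 : (n : ℝ) ^ δ * N ≤ 3 * n := by
    have h3 : N ^ (1 - δ) ≤ (n : ℝ) ^ (1 - δ) := by
      apply Real.rpow_le_rpow hN0.le hnN.le; linarith
    calc (n : ℝ) ^ δ * N = n ^ δ * (N ^ δ * N ^ (1 - δ)) := by
          rw [← Real.rpow_add hN0]; simp
      _ ≤ n ^ δ * (3 * n ^ (1 - δ)) := by gcongr
      _ = 3 * (n ^ δ * n ^ (1 - δ)) := by ring
      _ = 3 * n := by rw [← Real.rpow_add hn0]; simp
  rw [Real.rpow_add hn0, Real.rpow_one, div_mul_div_comm, div_le_div_iff₀ (by positivity)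
    (by positivity)]
  calc (divisorFun 4 n : ℝ) ^ 2 * (N * ((n : ℝ) * (n : ℝ) ^ δ)) = (divisorFun 4 n : ℝ) ^ 2 * n *
        ((n : ℝ) ^ δ * N) := by ring
    _ ≤ (divisorFun 16 n : ℝ) * n * (3 * n) := by gcongr; exact divisorFun_sq_le n
    _ = _ := by ring

end DivisorFunctions

/-! ### A three lines theorem for mean squares. -/

section MeanSquareThreeLines

open MeasureTheory Set Complex

/-- The open strip `-1 < re z < 2`. -/
def wideStrip : Set ℂ := {z | -1 < z.re ∧ z.re < 2}

/-- The closed strip `-1/2 ≤ re z ≤ 3/2`. -/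
def closedStrip : Set ℂ := {z | -1 / 2 ≤ z.re ∧ z.re ≤ 3 / 2}

theorem isOpen_wideStrip : IsOpen wideStrip :=
  (isOpen_lt continuous_const continuous_re).inter (isOpen_lt continuous_re continuous_const)

theorem closedStrip_subset_wideStrip : closedStrip ⊆ wideStrip := fun z hz ↦
  ⟨by linarith [hz.1], by linarith [hz.2]⟩

theorem im_add_I_mul (z : ℂ) (t : ℝ) : (z + I * t).im = z.im + t := by simp

theorem add_I_mul_mem_wideStrip {z : ℂ} (hz : z ∈ wideStrip) (t : ℝ) : z + I * t ∈ wideStrip := by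
  simpa [wideStrip] using hz

theorem add_I_mul_mem_closedStrip {z : ℂ} (hz : z ∈ closedStrip) (t : ℝ) :
    z + I * t ∈ closedStrip := by
  simpa [closedStrip] using hz

theorem continuous_vertical {f : ℂ → ℂ} (hf : ContinuousOn f wideStrip) {z : ℂ}
    (hz : z ∈ wideStrip) : Continuous fun t : ℝ ↦ f (z + I * t) :=
  hf.comp_continuous (by fun_prop) fun t ↦ add_I_mul_mem_wideStrip hz t

/-- Differentiation under the integral: near z the derivative is bounded on the compact set swept
out by a small ball and the segment. -/
theorem differentiableOn_integral_vertical {f : ℂ → ℂ} (hf : DifferentiableOn ℂ f wideStrip)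
    {g : ℝ → ℂ} (hg : Continuous g) (u v : ℝ) :
    DifferentiableOn ℂ (fun z ↦ ∫ t in u..v, f (z + I * t) * g t) wideStrip := by
  intro z hz
  apply DifferentiableAt.differentiableWithinAt
  have hf' : ContinuousOn (deriv f) wideStrip :=
    (hf.deriv isOpen_wideStrip).continuousOn
  obtain ⟨ε, hε, hball⟩ := Metric.nhds_basis_closedBall.mem_iff.1 (isOpen_wideStrip.mem_nhds hz)
  have hK : IsCompact ((fun p : ℂ × ℝ ↦ p.1 + I * p.2) '' (Metric.closedBall z ε ×ˢ uIcc u v)) :=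
    ((isCompact_closedBall z ε).prod isCompact_uIcc).image (by fun_prop)
  have hKs : ((fun p : ℂ × ℝ ↦ p.1 + I * p.2) '' (Metric.closedBall z ε ×ˢ uIcc u v))
      ⊆ wideStrip := by
    rintro _ ⟨p, hp, rfl⟩
    exact add_I_mul_mem_wideStrip (hball hp.1) _
  obtain ⟨C, hC⟩ := hK.exists_bound_of_continuousOn (hf'.mono hKs)
  refine (intervalIntegral.hasDerivAt_integral_of_dominated_loc_of_deriv_le
    (F := fun z t ↦ f (z + I * t) * g t) (F' := fun z t ↦ deriv f (z + I * t) * g t)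
    (bound := fun t ↦ C * ‖g t‖)
    (Metric.closedBall_mem_nhds z hε) ?_ ?_ ?_ ?_ ?_ ?_).2.differentiableAt
  · filter_upwards [isOpen_wideStrip.mem_nhds hz] with w hw
    exact ((continuous_vertical hf.continuousOn hw).mul hg).aestronglyMeasurable
  · exact ((continuous_vertical hf.continuousOn hz).mul hg).intervalIntegrable _ _
  · exact ((continuous_vertical hf' hz).mul hg).aestronglyMeasurable
  · filter_upwards with t ht w hw
    rw [norm_mul]
    gcongr
    exact hC _ ⟨(w, t), ⟨hw, uIoc_subset_uIcc ht⟩, rfl⟩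
  · exact (by fun_prop : Continuous fun t ↦ C * ‖g t‖).intervalIntegrable _ _
  · filter_upwards with t ht w hw
    have h1 : HasDerivAt f (deriv f (w + I * t)) (w + I * t) :=
      (hf.differentiableAt (isOpen_wideStrip.mem_nhds
        (add_I_mul_mem_wideStrip (hball hw) t))).hasDerivAt
    have h2 := h1.comp w ((hasDerivAt_id w).add_const (I * (t : ℂ)))
    simpa using h2.mul_const (g t)

/-- At most exponential growth in the closed strip, away from the real axis. -/
def HasExpGrowth (f : ℂ → ℂ) : Prop :=
  ∃ C A : ℝ, 0 ≤ C ∧ 0 ≤ A ∧ ∀ z ∈ closedStrip, 1 ≤ |z.im| → ‖f z‖ ≤ C * Real.exp (A * |z.im|)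

theorem HasExpGrowth.exists_bound {f : ℂ → ℂ} (hg : HasExpGrowth f)
    (hf : ContinuousOn f wideStrip) :
    ∃ C A : ℝ, 0 ≤ C ∧ 0 ≤ A ∧ ∀ z ∈ closedStrip, ‖f z‖ ≤ C * Real.exp (A * |z.im|) := by
  obtain ⟨C, A, hC, hA, h⟩ := hg
  have hK : IsCompact (Icc (-1 / 2 : ℝ) (3 / 2) ×ℂ Icc (-1 : ℝ) 1) :=
    isCompact_Icc.reProdIm isCompact_Icc
  obtain ⟨D, hD⟩ := hK.exists_bound_of_continuousOn (hf.mono (by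
    intro z hz
    exact closedStrip_subset_wideStrip hz.1))
  refine ⟨max C D, A, le_max_of_le_left hC, hA, fun z hz ↦ ?_⟩
  rcases le_total 1 |z.im| with h1 | h1
  · refine (h z hz h1).trans ?_
    gcongr
    exact le_max_left _ _
  · have h2 : 1 ≤ Real.exp (A * |z.im|) := Real.one_le_exp (by positivity)
    calc ‖f z‖ ≤ D := hD z ⟨hz, abs_le.1 h1⟩
      _ ≤ max C D := le_max_right _ _
      _ ≤ _ := le_mul_of_one_le_right (le_max_of_le_left hC) h2

/-- Cauchy-Schwarz over characters and t jointly, as AM-GM with the optimal weight c = √b/√a. -/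
theorem sum_integral_mul_le_sqrt {ι : Type*} (s : Finset ι) {F G : ι → ℝ → ℝ}
    (hF : ∀ i ∈ s, Continuous (F i)) (hG : ∀ i ∈ s, Continuous (G i))
    {u v a b : ℝ} (huv : u ≤ v) (ha : 0 < a) (hb : 0 < b)
    (hFa : ∑ i ∈ s, ∫ t in u..v, F i t ^ 2 ≤ a) (hGb : ∑ i ∈ s, ∫ t in u..v, G i t ^ 2 ≤ b) :
    ∑ i ∈ s, ∫ t in u..v, F i t * G i t ≤ √a * √b := by
  set c := √b / √a with hc
  have hc0 : 0 < c := by positivity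
  have h1 : ∑ i ∈ s, ∫ t in u..v, F i t * G i t ≤
      ∑ i ∈ s, ∫ t in u..v, (c / 2 * F i t ^ 2 + c⁻¹ / 2 * G i t ^ 2) := by
    refine Finset.sum_le_sum fun i hi ↦ ?_
    have := hF i hi
    have := hG i hi
    apply intervalIntegral.integral_mono_on huv
    · exact Continuous.intervalIntegrable (by fun_prop) _ _
    · exact Continuous.intervalIntegrable (by fun_prop) _ _
    · intro t _
      have : 0 ≤ (c * F i t - G i t) ^ 2 * (c⁻¹ / 2) := by positivity
      have e : (c * F i t - G i t) ^ 2 * (c⁻¹ / 2)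
          = c / 2 * F i t ^ 2 + c⁻¹ / 2 * G i t ^ 2 - F i t * G i t := by
        field_simp; ring
      linarith
  have h2 : ∑ i ∈ s, ∫ t in u..v, (c / 2 * F i t ^ 2 + c⁻¹ / 2 * G i t ^ 2)
      = c / 2 * ∑ i ∈ s, (∫ t in u..v, F i t ^ 2) + c⁻¹ / 2 * ∑ i ∈ s, ∫ t in u..v, G i t ^ 2 := by
    rw [Finset.mul_sum, Finset.mul_sum, ← Finset.sum_add_distrib]
    refine Finset.sum_congr rfl fun i hi ↦ ?_
    have := hF i hi
    have := hG i hi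
    rw [intervalIntegral.integral_add, intervalIntegral.integral_const_mul,
      intervalIntegral.integral_const_mul]
    · exact Continuous.intervalIntegrable (by fun_prop) _ _
    · exact Continuous.intervalIntegrable (by fun_prop) _ _
  have ea := Real.mul_self_sqrt ha.le
  have eb := Real.mul_self_sqrt hb.le
  have ha' := Real.sqrt_pos.2 ha
  have hb' := Real.sqrt_pos.2 hb
  calc _ ≤ c / 2 * a + c⁻¹ / 2 * b := by rw [h2] at h1; refine h1.trans ?_; gcongr
    _ = c / 2 * (√a * √a) + c⁻¹ / 2 * (√b * √b) := by rw [ea, eb]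
    _ = √a * √b := by rw [hc]; field_simp; ring

/-- A three lines theorem for mean squares of a family of functions over vertical segments. -/
theorem meanSquare_three_lines {ι : Type*} (s : Finset ι) (f : ι → ℂ → ℂ)
    (hd : ∀ i ∈ s, DifferentiableOn ℂ (f i) wideStrip) (hgr : ∀ i ∈ s, HasExpGrowth (f i))
    {u v : ℝ} (huv : u ≤ v) {A B : ℝ} (hA0 : 0 < A) (hB0 : 0 < B)
    (hA : ∀ y : ℝ, ∑ i ∈ s, ∫ t in u..v, ‖f i (((-1 / 2 : ℝ) : ℂ) + I * y + I * t)‖ ^ 2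
      ≤ A * Real.exp (2 * y ^ 2))
    (hB : ∀ y : ℝ, ∑ i ∈ s, ∫ t in u..v, ‖f i (((3 / 2 : ℝ) : ℂ) + I * y + I * t)‖ ^ 2
      ≤ B * Real.exp (2 * y ^ 2))
    {x : ℝ} (hx1 : -1 / 2 ≤ x) (hx2 : x ≤ 3 / 2) :
    ∑ i ∈ s, ∫ t in u..v, ‖f i (x + I * t)‖ ^ 2
      ≤ 100 * (A ^ (1 - (x + 1 / 2) / 2) * B ^ ((x + 1 / 2) / 2)) := by
  set J := ∑ i ∈ s, ∫ t in u..v, ‖f i (x + I * t)‖ ^ 2 with hJ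
  have hJ0 : 0 ≤ J := Finset.sum_nonneg fun i _ ↦
    intervalIntegral.integral_nonneg huv fun t _ ↦ by positivity
  rcases hJ0.eq_or_lt with hJ0 | hJ0
  · rw [← hJ0]; positivity
  have hxs : (x : ℂ) ∈ closedStrip := ⟨by simpa using hx1, by simpa using hx2⟩
  have hc : ∀ i ∈ s, ∀ z ∈ closedStrip, Continuous fun t : ℝ ↦ f i (z + I * t) := fun i hi z hz ↦
    continuous_vertical (hd i hi).continuousOn (closedStrip_subset_wideStrip hz)
  set g : ι → ℝ → ℂ := fun i t ↦ starRingEnd ℂ (f i (x + I * t)) with hg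
  have hgc : ∀ i ∈ s, Continuous (g i) := fun i hi ↦ continuous_conj.comp (hc i hi _ hxs)
  -- Duality: pairing with the conjugate values on the target line gives one holomorphic function
  -- with H(x) = J. On the boundary lines Cauchy-Schwarz bounds it by √J times the root of the mean
  -- square there.
  set H : ℂ → ℂ := fun z ↦ ∑ i ∈ s, ∫ t in u..v, f i (z + I * t) * g i t with hH
  have hHle : ∀ z, ‖H z‖ ≤ ∑ i ∈ s, ∫ t in u..v, ‖f i (z + I * t)‖ * ‖g i t‖ := by
    intro z
    refine (norm_sum_le _ _).trans (Finset.sum_le_sum fun i _ ↦ ?_)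
    refine (intervalIntegral.norm_integral_le_integral_norm huv).trans (le_of_eq ?_)
    simp_rw [norm_mul]
  have hHd : DifferentiableOn ℂ H wideStrip := by
    apply DifferentiableOn.fun_sum
    intro i hi
    have := hd i hi
    exact differentiableOn_integral_vertical (hd i hi) (hgc i hi) u v
  have hgJ : ∑ i ∈ s, ∫ t in u..v, ‖g i t‖ ^ 2 ≤ J := by
    simp only [hg, norm_conj]; exact le_rfl
  have hline : ∀ z ∈ closedStrip, ∀ D : ℝ, 0 < D →
      ∑ i ∈ s, ∫ t in u..v, ‖f i (z + I * t)‖ ^ 2 ≤ D → ‖H z‖ ≤ √D * √J := by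
    intro z hz D hD hle
    exact (hHle z).trans (sum_integral_mul_le_sqrt s (fun i hi ↦ (hc i hi z hz).norm)
      (fun i hi ↦ (hgc i hi).norm) huv hD hJ0 hle hgJ)
  -- The Gaussian decay cancels the permitted boundary growth exp(2y²), whose root is exp(y²), and
  -- makes F bounded in the strip; at the real point x its modulus is at least 1.
  set F : ℂ → ℂ := fun z ↦ cexp (z ^ 2) * H z with hF
  have hexp : ∀ z : ℂ, ‖cexp (z ^ 2)‖ = Real.exp (z.re ^ 2 - z.im ^ 2) := by
    intro z
    rw [norm_exp, sq, mul_re, sq, sq]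
  have hre2 : ∀ z ∈ closedStrip, z.re ^ 2 ≤ 9 / 4 := by
    intro z hz; nlinarith [hz.1, hz.2]
  have hFline : ∀ z ∈ closedStrip, ∀ D : ℝ, 0 < D →
      ∑ i ∈ s, ∫ t in u..v, ‖f i (z + I * t)‖ ^ 2 ≤ D * Real.exp (2 * z.im ^ 2) →
      ‖F z‖ ≤ Real.exp (9 / 4) * √J * √D := by
    intro z hz D hD hle
    have h1 := hline z hz _ (by positivity) hle
    have h2 : √(Real.exp (2 * z.im ^ 2)) = Real.exp (z.im ^ 2) := by
      rw [mul_comm, Real.exp_mul, Real.rpow_two, Real.sqrt_sq (Real.exp_pos _).le]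
    rw [Real.sqrt_mul hD.le, h2] at h1
    rw [hF, norm_mul, hexp]
    calc _ ≤ Real.exp (z.re ^ 2 - z.im ^ 2) * (√D * Real.exp (z.im ^ 2) * √J) := by gcongr
      _ = (Real.exp (z.re ^ 2 - z.im ^ 2) * Real.exp (z.im ^ 2)) * √J * √D := by ring
      _ = Real.exp (z.re ^ 2) * √J * √D := by rw [← Real.exp_add, sub_add_cancel]
      _ ≤ _ := by gcongr; exact hre2 z hz
  have hbdd : BddAbove ((norm ∘ F) '' HadamardThreeLines.verticalClosedStrip (-1 / 2) (3 / 2)) := by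
    have hb : ∀ i ∈ s, ∃ C A : ℝ, 0 ≤ C ∧ 0 ≤ A ∧ ∀ z ∈ closedStrip,
        ‖f i z‖ ≤ C * Real.exp (A * |z.im|) := fun i hi ↦
      (hgr i hi).exists_bound (hd i hi).continuousOn
    choose! C A' hC hA' hCA using hb
    set R := max |u| |v| with hR
    have hone : ∀ i ∈ s, ∃ D : ℝ, ∀ z ∈ closedStrip,
        ‖cexp (z ^ 2) * ∫ t in u..v, f i (z + I * t) * g i t‖ ≤ D := by
      intro i hi
      have hg1 := (hgc i hi).norm
      refine ⟨Real.exp (9 / 4) * (C i * Real.exp (A' i * R) * Real.exp (A' i ^ 2) *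
        ∫ t in u..v, ‖g i t‖), fun z hz ↦ ?_⟩
      have h1 : ‖∫ t in u..v, f i (z + I * t) * g i t‖ ≤
          ∫ t in u..v, C i * Real.exp (A' i * (|z.im| + R)) * ‖g i t‖ := by
        apply intervalIntegral.norm_integral_le_of_norm_le huv
        · filter_upwards with t ht
          rw [norm_mul]
          gcongr
          refine (hCA i hi _ (add_I_mul_mem_closedStrip hz t)).trans ?_
          have := hC i hi
          have := hA' i hi
          gcongr
          rw [im_add_I_mul]
          refine (abs_add_le _ _).trans ?_
          gcongr
          rw [hR]
          exact abs_le_max_abs_abs ht.1.le ht.2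
        · exact Continuous.intervalIntegrable (by fun_prop) _ _
      rw [intervalIntegral.integral_const_mul] at h1
      rw [norm_mul, hexp]
      have hI0 : 0 ≤ ∫ t in u..v, ‖g i t‖ :=
        intervalIntegral.integral_nonneg huv fun t _ ↦ norm_nonneg _
      have := hC i hi
      calc _ ≤ Real.exp (z.re ^ 2 - z.im ^ 2) *
            (C i * Real.exp (A' i * (|z.im| + R)) * ∫ t in u..v, ‖g i t‖) := by gcongr
        _ = Real.exp (z.re ^ 2) * (C i * Real.exp (A' i * R) *
            Real.exp (A' i * |z.im| - z.im ^ 2) * ∫ t in u..v, ‖g i t‖) := by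
            rw [mul_add, Real.exp_add, Real.exp_sub, Real.exp_sub]; field_simp
        _ ≤ _ := by
            gcongr
            · exact hre2 z hz
            · rw [← sq_abs z.im]
              nlinarith [sq_nonneg (A' i - |z.im|), sq_nonneg (A' i), sq_nonneg |z.im|]
    choose! D hD using hone
    refine ⟨∑ i ∈ s, D i, ?_⟩
    rintro _ ⟨z, hz, rfl⟩
    have hz' : z ∈ closedStrip := hz
    rw [Function.comp_apply, hF]
    simp only [hH, Finset.mul_sum]
    exact (norm_sum_le _ _).trans (Finset.sum_le_sum fun i hi ↦ hD i hi z hz')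
  have hFd : DifferentiableOn ℂ F wideStrip := by
    apply DifferentiableOn.mul _ hHd
    exact (by fun_prop : Differentiable ℂ fun z : ℂ ↦ cexp (z ^ 2)).differentiableOn
  have hdc : DiffContOnCl ℂ F (HadamardThreeLines.verticalStrip (-1 / 2) (3 / 2)) := by
    apply (hFd.mono _).diffContOnCl
    refine (closure_minimal (t := closedStrip) ?_ ?_).trans closedStrip_subset_wideStrip
    · intro z hz; exact ⟨hz.1.le, hz.2.le⟩
    · exact (isClosed_le continuous_const continuous_re).inter
        (isClosed_le continuous_re continuous_const)
  have hmain := HadamardThreeLines.norm_le_interp_of_mem_verticalClosedStrip' (f := F) (z := x)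
    (l := -1 / 2) (u := 3 / 2) (a := Real.exp (9 / 4) * √J * √A) (b := Real.exp (9 / 4) * √J * √B)
    (by norm_num) hxs hdc hbdd
    (by
      intro z hz
      have hz : z.re = -1 / 2 := hz
      refine hFline z ⟨by rw [hz], by rw [hz]; norm_num⟩ A hA0 ?_
      have := hA z.im
      rw [← hz, mul_comm I (z.im : ℂ), re_add_im] at this
      exact this)
    (by
      intro z hz
      have hz : z.re = 3 / 2 := hz
      refine hFline z ⟨by rw [hz]; norm_num, by rw [hz]⟩ B hB0 ?_
      have := hB z.im
      rw [← hz, mul_comm I (z.im : ℂ), re_add_im] at this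
      exact this)
  have hθ : (((x : ℂ).re - -1 / 2) / (3 / 2 - -1 / 2) : ℝ) = (x + 1 / 2) / 2 := by
    rw [ofReal_re]; norm_num
  rw [hθ] at hmain
  set θ := (x + 1 / 2) / 2 with hθd
  have hFx : J ≤ ‖F x‖ := by
    have h1 : H x = (J : ℂ) := by
      rw [hH, hJ]
      push_cast
      refine Finset.sum_congr rfl fun i _ ↦ ?_
      rw [← intervalIntegral.integral_ofReal]
      congr 1
      ext t
      rw [hg, mul_conj']
      push_cast; rfl
    rw [hF, norm_mul, hexp, h1, norm_real, Real.norm_of_nonneg hJ0.le]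
    apply le_mul_of_one_le_left hJ0.le
    apply Real.one_le_exp
    simp [sq_nonneg]
  have hpow : (Real.exp (9 / 4) * √J * √A) ^ (1 - θ) * (Real.exp (9 / 4) * √J * √B) ^ θ
      = Real.exp (9 / 4) * √J * √(A ^ (1 - θ) * B ^ θ) := by
    have hE : 0 < Real.exp (9 / 4) * √J := by positivity
    rw [Real.mul_rpow hE.le (by positivity), Real.mul_rpow hE.le (by positivity),
      Real.sqrt_mul (by positivity)]
    have e1 : √(A ^ (1 - θ)) = √A ^ (1 - θ) := by
      rw [Real.sqrt_eq_rpow, Real.sqrt_eq_rpow, ← Real.rpow_mul hA0.le, ← Real.rpow_mul hA0.le,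
        mul_comm]
    have e2 : √(B ^ θ) = √B ^ θ := by
      rw [Real.sqrt_eq_rpow, Real.sqrt_eq_rpow, ← Real.rpow_mul hB0.le, ← Real.rpow_mul hB0.le,
        mul_comm]
    rw [e1, e2]
    calc _ = ((Real.exp (9 / 4) * √J) ^ (1 - θ) * (Real.exp (9 / 4) * √J) ^ θ) *
          (√A ^ (1 - θ) * √B ^ θ) := by ring
      _ = _ := by rw [← Real.rpow_add hE, sub_add_cancel, Real.rpow_one]
  rw [hpow] at hmain
  set W := A ^ (1 - θ) * B ^ θ with hW
  have hW0 : 0 ≤ W := by positivity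
  have h1 : J ≤ Real.exp (9 / 4) * √J * √W := hFx.trans hmain
  have h2 : √J ≤ Real.exp (9 / 4) * √W := by
    -- Cancelling the √J carried by the dual function leaves √J itself bounded.
    have h3 : √J * √J ≤ √J * (Real.exp (9 / 4) * √W) := by
      rw [Real.mul_self_sqrt hJ0.le]; linarith
    exact le_of_mul_le_mul_left h3 (Real.sqrt_pos.2 hJ0)
  have h4 : J ≤ Real.exp (9 / 4) ^ 2 * W := by
    calc J = √J ^ 2 := (Real.sq_sqrt hJ0.le).symm
      _ ≤ (Real.exp (9 / 4) * √W) ^ 2 := by gcongr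
      _ = _ := by rw [mul_pow, Real.sq_sqrt hW0]
  refine h4.trans (mul_le_mul_of_nonneg_right ?_ hW0)
  have h5 : Real.exp (9 / 4) ^ 4 ≤ 100 ^ 2 := by
    calc Real.exp (9 / 4) ^ 4 = Real.exp 1 ^ 9 := by
          rw [← Real.exp_nat_mul, ← Real.exp_nat_mul]; norm_num
      _ ≤ 2.7182818286 ^ 9 := by gcongr; exact Real.exp_one_lt_d9.le
      _ ≤ 100 ^ 2 := by norm_num
  have h6 : (Real.exp (9 / 4) ^ 2) ^ 2 ≤ 100 ^ 2 := by rw [← pow_mul]; exact h5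
  exact le_of_sq_le_sq h6 (by norm_num)

end MeanSquareThreeLines

/-! ### Qualitative growth bounds for Γ factors and completed zeta functions. -/

section GrowthInStrip

open MeasureTheory Set Complex

/-! ### Exponential growth in the strip -/

theorem HasExpGrowth.of_bound {f : ℂ → ℂ} (C : ℝ) (h : ∀ z ∈ closedStrip, 1 ≤ |z.im| → ‖f z‖ ≤ C) :
    HasExpGrowth f :=
  ⟨max C 0, 0, le_max_right _ _, le_rfl, fun z hz h1 ↦ by simpa using Or.inl (h z hz h1)⟩

theorem HasExpGrowth.mul {f g : ℂ → ℂ} (hf : HasExpGrowth f) (hg : HasExpGrowth g) :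
    HasExpGrowth fun z ↦ f z * g z := by
  obtain ⟨C, A, hC, hA, h⟩ := hf
  obtain ⟨D, B, hD, hB, h'⟩ := hg
  refine ⟨C * D, A + B, by positivity, by positivity, fun z hz h1 ↦ ?_⟩
  rw [norm_mul, add_mul, Real.exp_add]
  calc _ ≤ (C * Real.exp (A * |z.im|)) * (D * Real.exp (B * |z.im|)) := by
        gcongr
        · exact h z hz h1
        · exact h' z hz h1
    _ = _ := by ring

theorem HasExpGrowth.add {f g : ℂ → ℂ} (hf : HasExpGrowth f) (hg : HasExpGrowth g) :
    HasExpGrowth fun z ↦ f z + g z := by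
  obtain ⟨C, A, hC, hA, h⟩ := hf
  obtain ⟨D, B, hD, hB, h'⟩ := hg
  refine ⟨C + D, max A B, by positivity, le_max_of_le_left hA, fun z hz h1 ↦ ?_⟩
  calc _ ≤ ‖f z‖ + ‖g z‖ := norm_add_le _ _
    _ ≤ C * Real.exp (A * |z.im|) + D * Real.exp (B * |z.im|) := add_le_add (h z hz h1) (h' z hz h1)
    _ ≤ C * Real.exp (max A B * |z.im|) + D * Real.exp (max A B * |z.im|) := by
        gcongr
        · exact le_max_left _ _
        · exact le_max_right _ _
    _ = _ := by ring

theorem HasExpGrowth.const (c : ℂ) : HasExpGrowth fun _ ↦ c :=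
  .of_bound ‖c‖ fun _ _ _ ↦ le_rfl

theorem HasExpGrowth.neg {f : ℂ → ℂ} (hf : HasExpGrowth f) : HasExpGrowth fun z ↦ -f z := by
  obtain ⟨C, A, hC, hA, h⟩ := hf
  exact ⟨C, A, hC, hA, by simpa using h⟩

theorem HasExpGrowth.sub {f g : ℂ → ℂ} (hf : HasExpGrowth f) (hg : HasExpGrowth g) :
    HasExpGrowth fun z ↦ f z - g z := by
  simpa [sub_eq_add_neg] using hf.add hg.neg

theorem HasExpGrowth.pow {f : ℂ → ℂ} (hf : HasExpGrowth f) (n : ℕ) :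
    HasExpGrowth fun z ↦ f z ^ n := by
  induction n with
  | zero => simpa using HasExpGrowth.const 1
  | succ n ih => simpa [pow_succ] using ih.mul hf

theorem HasExpGrowth.sum {ι : Type*} (s : Finset ι) {f : ι → ℂ → ℂ}
    (hf : ∀ i ∈ s, HasExpGrowth (f i)) : HasExpGrowth fun z ↦ ∑ i ∈ s, f i z := by
  classical
  induction s using Finset.induction_on with
  | empty => simpa using HasExpGrowth.const 0
  | insert a s ha ih =>
    simp_rw [Finset.sum_insert ha]
    exact (hf a (by simp)).add (ih fun i hi ↦ hf i (by simp [hi]))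

theorem HasExpGrowth.id : HasExpGrowth fun z ↦ z := by
  refine ⟨3, 1, by norm_num, by norm_num, fun z hz h1 ↦ ?_⟩
  have h2 := Real.add_one_le_exp (1 * |z.im|)
  have h3 : |z.re| ≤ 3 / 2 := abs_le.2 ⟨by linarith [hz.1], hz.2⟩
  have := norm_le_abs_re_add_abs_im z
  linarith

theorem HasExpGrowth.cpow_of_pos {x : ℝ} (hx : 0 < x) {g : ℂ → ℂ} (c : ℝ)
    (hg : ∀ z ∈ closedStrip, |(g z).re| ≤ c) : HasExpGrowth fun z ↦ (x : ℂ) ^ g z := by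
  refine .of_bound (Real.exp (|Real.log x| * c)) fun z hz _ ↦ ?_
  rw [norm_cpow_eq_rpow_re_of_pos hx, Real.rpow_def_of_pos hx]
  apply Real.exp_le_exp.2
  refine (le_abs_self _).trans ?_
  rw [abs_mul]
  gcongr
  exact hg z hz

theorem HasExpGrowth.comp_one_sub {f : ℂ → ℂ} (hf : HasExpGrowth f) :
    HasExpGrowth fun z ↦ f (1 - z) := by
  obtain ⟨C, A, hC, hA, h⟩ := hf
  refine ⟨C, A, hC, hA, fun z hz h1 ↦ ?_⟩
  have hz' : 1 - z ∈ closedStrip := by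
    constructor <;> simp only [sub_re, one_re] <;> linarith [hz.1, hz.2]
  have := h (1 - z) hz' (by simpa using h1)
  simpa using this

/-! ### Bounds for the Gamma function -/

theorem norm_Gamma_le_Gamma_re {w : ℂ} (hw : 0 < w.re) : ‖Gamma w‖ ≤ Real.Gamma w.re := by
  rw [Complex.Gamma_eq_integral hw, GammaIntegral, Real.Gamma_eq_integral hw]
  refine (norm_integral_le_integral_norm _).trans (le_of_eq ?_)
  refine setIntegral_congr_fun measurableSet_Ioi fun x hx ↦ ?_
  rw [norm_mul, norm_real, Real.norm_of_nonneg (Real.exp_pos _).le,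
    norm_cpow_eq_rpow_re_of_pos hx]
  simp

theorem exists_norm_Gamma_le :
    ∃ C : ℝ, 0 ≤ C ∧ ∀ w : ℂ, 1 ≤ w.re → w.re ≤ 6 → ‖Gamma w‖ ≤ C := by
  have hc : ContinuousOn Real.Gamma (Icc 1 6) := fun x hx ↦
    (Real.differentiableAt_Gamma fun m ↦ by
      have : (0 : ℝ) ≤ m := m.cast_nonneg
      linarith [hx.1]).continuousAt.continuousWithinAt
  obtain ⟨C, hC⟩ := isCompact_Icc.exists_bound_of_continuousOn hc
  refine ⟨C, (norm_nonneg _).trans (hC 1 (by norm_num)), fun w h1 h2 ↦ ?_⟩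
  exact (norm_Gamma_le_Gamma_re (by linarith)).trans ((le_abs_self _).trans (hC w.re ⟨h1, h2⟩))

/-- Two applications of the recurrence move the argument into 1 ≤ Re ≤ 6; the factors w and w + 1
are bounded below because |Im w| ≥ 1/2. -/
theorem exists_norm_Gamma_le_of_im :
    ∃ C : ℝ, 0 ≤ C ∧ ∀ w : ℂ, -1 ≤ w.re → w.re ≤ 4 → 1 / 2 ≤ |w.im| → ‖Gamma w‖ ≤ C := by
  obtain ⟨C, hC0, hC⟩ := exists_norm_Gamma_le
  refine ⟨4 * C, by positivity, fun w h1 h2 h3 ↦ ?_⟩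
  have hw0 : w ≠ 0 := by rintro rfl; norm_num at h3
  have hw1 : w + 1 ≠ 0 := by
    intro h
    have := congrArg Complex.im h
    simp at this
    rw [this] at h3
    norm_num at h3
  have e : Gamma (w + 1 + 1) = (w + 1) * (w * Gamma w) := by
    rw [Gamma_add_one _ hw1, Gamma_add_one _ hw0]
  have hb := hC (w + 1 + 1) (by simp; linarith) (by simp; linarith)
  rw [e, norm_mul, norm_mul] at hb
  have n0 : 1 / 2 ≤ ‖w‖ := h3.trans (abs_im_le_norm w)
  have n1 : 1 / 2 ≤ ‖w + 1‖ := h3.trans (by simpa using abs_im_le_norm (w + 1))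
  have : 1 / 2 * (1 / 2 * ‖Gamma w‖) ≤ ‖w + 1‖ * (‖w‖ * ‖Gamma w‖) := by gcongr
  linarith

theorem norm_sin_le_exp_abs_im (w : ℂ) : ‖sin w‖ ≤ Real.exp |w.im| := by
  rw [Complex.sin, norm_div, norm_mul, norm_I, mul_one, Complex.norm_ofNat]
  have h1 : ‖cexp (-w * I)‖ ≤ Real.exp |w.im| := by
    rw [norm_exp]; simp [le_abs_self]
  have h2 : ‖cexp (w * I)‖ ≤ Real.exp |w.im| := by
    rw [norm_exp]; simp [neg_le_abs]
  have := norm_sub_le (cexp (-w * I)) (cexp (w * I))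
  linarith

/-- The reflection formula writes 1/Γ(w) as Γ(1 - w) sin(πw)/π, and the sine supplies the
exponential. -/
theorem exists_norm_inv_Gamma_le :
    ∃ C : ℝ, 0 ≤ C ∧ ∀ w : ℂ, -1 ≤ w.re → w.re ≤ 2 → 1 / 2 ≤ |w.im| →
      ‖(Gamma w)⁻¹‖ ≤ C * Real.exp (Real.pi * |w.im|) := by
  obtain ⟨C, hC0, hC⟩ := exists_norm_Gamma_le_of_im
  refine ⟨C, hC0, fun w h1 h2 h3 ↦ ?_⟩
  have hp := Real.pi_pos
  have hs : sin (Real.pi * w) ≠ 0 := by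
    rw [Complex.sin_ne_zero_iff]
    intro k hk
    have hw : w = k := by
      apply mul_left_cancel₀ (ofReal_ne_zero.2 hp.ne')
      rw [hk, mul_comm]
    rw [hw] at h3
    norm_num at h3
  have e := Gamma_mul_Gamma_one_sub w
  have hprod : Gamma w * Gamma (1 - w) ≠ 0 := by
    rw [e]; exact div_ne_zero (ofReal_ne_zero.2 hp.ne') hs
  have e2 : (Gamma w)⁻¹ = Gamma (1 - w) * sin (Real.pi * w) / Real.pi := by
    have h1 := left_ne_zero_of_mul hprod
    have hpi : (Real.pi : ℂ) ≠ 0 := ofReal_ne_zero.2 hp.ne'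
    rw [eq_div_iff hs] at e
    rw [inv_eq_one_div, div_eq_div_iff h1 hpi, one_mul]
    linear_combination -e
  rw [e2, norm_div, norm_mul, norm_real, Real.norm_of_nonneg hp.le]
  have b1 := hC (1 - w) (by simp; linarith) (by simp; linarith) (by simpa using h3)
  have b2 : ‖sin (Real.pi * w)‖ ≤ Real.exp (Real.pi * |w.im|) := by
    refine (norm_sin_le_exp_abs_im _).trans (le_of_eq ?_)
    simp [abs_mul, abs_of_pos hp]
  rw [div_le_iff₀ hp]
  calc _ ≤ C * Real.exp (Real.pi * |w.im|) := by gcongr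
    _ ≤ _ := le_mul_of_one_le_right (by positivity) (by linarith [Real.pi_gt_three])

/-- Needed with k = 2 for even and k = 1 for odd characters. -/
theorem hasExpGrowth_Gammaℝ_one_sub_add {k : ℝ} (hk0 : 0 ≤ k) (hk : k ≤ 2) :
    HasExpGrowth fun z ↦ Gammaℝ (1 - z + k) := by
  have hp := Real.pi_pos
  simp_rw [Gammaℝ_def]
  refine (HasExpGrowth.cpow_of_pos hp 2 fun z hz ↦ ?_).mul ?_
  · have : (-(1 - z + (k : ℂ)) / 2).re = -(1 - z.re + k) / 2 := by simp
    rw [this, abs_le]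
    constructor <;> linarith [hz.1, hz.2]
  · obtain ⟨C, hC0, hC⟩ := exists_norm_Gamma_le_of_im
    refine .of_bound C fun z hz h1 ↦ hC _ ?_ ?_ ?_
    · have : ((1 - z + (k : ℂ)) / 2).re = (1 - z.re + k) / 2 := by simp
      rw [this]; linarith [hz.2]
    · have : ((1 - z + (k : ℂ)) / 2).re = (1 - z.re + k) / 2 := by simp
      rw [this]; linarith [hz.1]
    · have : ((1 - z + (k : ℂ)) / 2).im = -z.im / 2 := by simp
      rw [this, abs_div, abs_neg]; norm_num; linarith

theorem hasExpGrowth_inv_Gammaℝ_add {k : ℝ} (hk0 : 0 ≤ k) (hk : k ≤ 2) :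
    HasExpGrowth fun z ↦ (Gammaℝ (z + k))⁻¹ := by
  have hp := Real.pi_pos
  simp_rw [Gammaℝ_def, mul_inv, ← cpow_neg]
  refine (HasExpGrowth.cpow_of_pos hp 2 fun z hz ↦ ?_).mul ?_
  · have : (-(-(z + (k : ℂ)) / 2)).re = (z.re + k) / 2 := by simp; ring
    rw [this, abs_le]
    constructor <;> linarith [hz.1, hz.2]
  · obtain ⟨C, hC0, hC⟩ := exists_norm_inv_Gamma_le
    refine ⟨C, Real.pi, hC0, hp.le, fun z hz h1 ↦ ?_⟩
    have e1 : ((z + (k : ℂ)) / 2).re = (z.re + k) / 2 := by simp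
    have e2 : ((z + (k : ℂ)) / 2).im = z.im / 2 := by simp
    have e3 : |z.im / 2| = |z.im| / 2 := by rw [abs_div]; norm_num
    refine (hC _ ?_ ?_ ?_).trans ?_
    · rw [e1]; linarith [hz.1]
    · rw [e1]; linarith [hz.2]
    · rw [e2, e3]; linarith
    · rw [e2, e3]
      gcongr
      linarith

/-! ### Boundedness of Mellin transforms on vertical strips -/

/-- Inside the strip t^(Re s - 1) is at most t^(a - 1) + t^(b - 1), so absolute convergence at both
edges bounds the transform uniformly. -/
theorem norm_mellin_le_of_mem_strip {f : ℝ → ℂ} {a b : ℝ} (ha : MellinConvergent f a)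
    (hb : MellinConvergent f b) :
    ∃ C : ℝ, ∀ s : ℂ, a ≤ s.re → s.re ≤ b → ‖mellin f s‖ ≤ C := by
  refine ⟨∫ t in Ioi (0 : ℝ), (‖(t : ℂ) ^ ((a : ℂ) - 1) • f t‖ + ‖(t : ℂ) ^ ((b : ℂ) - 1) • f t‖),
    fun s h1 h2 ↦ ?_⟩
  rw [mellin]
  refine norm_integral_le_of_norm_le (Integrable.add ha.norm hb.norm) ?_
  filter_upwards [ae_restrict_mem measurableSet_Ioi] with t ht
  have ht : 0 < t := ht
  rw [norm_smul, norm_smul, norm_smul, norm_cpow_eq_rpow_re_of_pos ht,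
    norm_cpow_eq_rpow_re_of_pos ht, norm_cpow_eq_rpow_re_of_pos ht, ← add_mul]
  gcongr
  simp only [sub_re, one_re, ofReal_re]
  rcases le_total 1 t with h | h
  · have : t ^ (s.re - 1) ≤ t ^ (b - 1) := by gcongr
    have : 0 ≤ t ^ (a - 1) := by positivity
    linarith
  · have : t ^ (s.re - 1) ≤ t ^ (a - 1) :=
      Real.rpow_le_rpow_of_exponent_ge ht h (by linarith)
    have : 0 ≤ t ^ (b - 1) := by positivity
    linarith

theorem exists_bound_of_isStrongFEPair {P : WeakFEPair ℂ} (hP : IsStrongFEPair P) (a b : ℝ) :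
    ∃ C : ℝ, ∀ s : ℂ, a ≤ s.re → s.re ≤ b → ‖mellin P.f s‖ ≤ C :=
  norm_mellin_le_of_mem_strip (hP.hasMellin a).1 (hP.hasMellin b).1

/-- With the poles removed this is a Mellin transform converging everywhere, hence bounded on
vertical strips. -/
theorem hasExpGrowth_completedHurwitzZetaEven₀ (a : UnitAddCircle) :
    HasExpGrowth (HurwitzZeta.completedHurwitzZetaEven₀ a) := by
  obtain ⟨C, hC⟩ := exists_bound_of_isStrongFEPair
    (HurwitzZeta.hurwitzEvenFEPair a).isStrongFEPair_toStrongFEPair (-1) 1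
  refine .of_bound (C / 2) fun z hz _ ↦ ?_
  rw [HurwitzZeta.completedHurwitzZetaEven₀, norm_div, Complex.norm_ofNat]
  gcongr
  refine hC (z / 2) ?_ ?_
  · simp; linarith [hz.1]
  · simp; linarith [hz.2]

theorem hasExpGrowth_completedHurwitzZetaOdd (a : UnitAddCircle) :
    HasExpGrowth (HurwitzZeta.completedHurwitzZetaOdd a) := by
  obtain ⟨C, hC⟩ := exists_bound_of_isStrongFEPair
    (HurwitzZeta.isStrong_hurwitzOddFEPair a) (-2) 2
  refine .of_bound (C / 2) fun z hz _ ↦ ?_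
  rw [HurwitzZeta.completedHurwitzZetaOdd, norm_div, Complex.norm_ofNat,
    (HurwitzZeta.isStrong_hurwitzOddFEPair a).Λ_eq]
  gcongr
  refine hC ((z + 1) / 2) ?_ ?_
  · simp; linarith [hz.1]
  · simp; linarith [hz.2]

end GrowthInStrip

/-! ### L-functions with poles cleared and the factor of the functional equation. -/

section LFunctionGrowth

open Set Complex DirichletCharacter

section LFunction

variable {N : ℕ} [NeZero N]

/-- The entire function `s (s - 1) L(s, χ)`. -/
noncomputable def entireLFunction (χ : DirichletCharacter ℂ N) (s : ℂ) : ℂ :=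
  (s * (s - 1) * ZMod.completedLFunction₀ χ s - (s - 1) * ((N : ℂ) ^ (-s) * χ 0)
    + s * ((N : ℂ) ^ (-s) * ∑ j, χ j)) * (gammaFactor χ s)⁻¹

theorem entireLFunction_eq (χ : DirichletCharacter ℂ N) {s : ℂ} (h0 : s ≠ 0) (h1 : s ≠ 1) :
    entireLFunction χ s = s * (s - 1) * LFunction χ s := by
  have h1' : 1 - s ≠ 0 := sub_ne_zero.2 h1.symm
  -- The completed function is its entire part minus polar terms at 0 and 1; multiplying by s(s - 1)
  -- clears both.
  rw [LFunction_eq_completed_div_gammaFactor χ s (.inl h0), completedLFunction,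
    ZMod.completedLFunction_eq, entireLFunction, div_eq_mul_inv]
  have e (A B C : ℂ) : s * (s - 1) * A - (s - 1) * B + s * C
      = s * (s - 1) * (A - B / s - C / (1 - s)) := by
    field_simp
    ring
  rw [e, mul_assoc]

theorem differentiable_inv_gammaFactor {M : ℕ} (χ : DirichletCharacter ℂ M) :
    Differentiable ℂ fun s ↦ (gammaFactor χ s)⁻¹ := by
  rcases χ.even_or_odd with h | h
  · simp_rw [h.gammaFactor_def]
    exact differentiable_Gammaℝ_inv
  · simp_rw [h.gammaFactor_def]
    exact differentiable_Gammaℝ_inv.comp (differentiable_id.add_const 1)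

theorem hasExpGrowth_inv_gammaFactor {M : ℕ} (χ : DirichletCharacter ℂ M) :
    HasExpGrowth fun s ↦ (gammaFactor χ s)⁻¹ := by
  rcases χ.even_or_odd with h | h
  · simp_rw [h.gammaFactor_def]
    simpa using hasExpGrowth_inv_Gammaℝ_add (k := 0) le_rfl (by norm_num)
  · simp_rw [h.gammaFactor_def]
    simpa using hasExpGrowth_inv_Gammaℝ_add (k := 1) (by norm_num) (by norm_num)

theorem differentiable_natCast_cpow {g : ℂ → ℂ} (hg : Differentiable ℂ g) :
    Differentiable ℂ fun s ↦ (N : ℂ) ^ g s := fun s ↦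
  (hg s).const_cpow (.inl (NeZero.ne _))

theorem hasExpGrowth_natCast_cpow {n : ℕ} (hn : n ≠ 0) {g : ℂ → ℂ} (c : ℝ)
    (hg : ∀ z ∈ closedStrip, |(g z).re| ≤ c) : HasExpGrowth fun s ↦ (n : ℂ) ^ g s := by
  have := HasExpGrowth.cpow_of_pos (x := n) (by positivity) c hg
  simpa using this

theorem abs_neg_re_le {z : ℂ} (hz : z ∈ closedStrip) : |(-z).re| ≤ 2 := by
  rw [neg_re, abs_neg, abs_le]
  constructor <;> linarith [hz.1, hz.2]

theorem differentiable_entireLFunction (χ : DirichletCharacter ℂ N) :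
    Differentiable ℂ (entireLFunction χ) := by
  have h1 := ZMod.differentiable_completedLFunction₀ (χ : ZMod N → ℂ)
  have h2 : Differentiable ℂ fun s : ℂ ↦ (N : ℂ) ^ (-s) :=
    differentiable_natCast_cpow differentiable_neg
  have h3 := differentiable_inv_gammaFactor χ
  unfold entireLFunction
  fun_prop

theorem hasExpGrowth_completedLFunction₀ (χ : DirichletCharacter ℂ N) :
    HasExpGrowth (ZMod.completedLFunction₀ χ) := by
  have h2 : HasExpGrowth fun s ↦ (N : ℂ) ^ (-s) :=
    hasExpGrowth_natCast_cpow (NeZero.ne _) 2 fun z hz ↦ abs_neg_re_le hz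
  unfold ZMod.completedLFunction₀
  exact (h2.mul (.sum _ fun j _ ↦ (HasExpGrowth.const _).mul
    (hasExpGrowth_completedHurwitzZetaEven₀ _))).add (h2.mul (.sum _ fun j _ ↦
      (HasExpGrowth.const _).mul (hasExpGrowth_completedHurwitzZetaOdd _)))

theorem hasExpGrowth_entireLFunction (χ : DirichletCharacter ℂ N) :
    HasExpGrowth (entireLFunction χ) := by
  have h2 : HasExpGrowth fun s ↦ (N : ℂ) ^ (-s) :=
    hasExpGrowth_natCast_cpow (NeZero.ne _) 2 fun z hz ↦ abs_neg_re_le hz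
  have h1 : HasExpGrowth fun z : ℂ ↦ z - 1 := HasExpGrowth.id.sub (.const 1)
  exact ((((HasExpGrowth.id.mul h1).mul (hasExpGrowth_completedLFunction₀ χ)).sub
    (h1.mul (h2.mul (.const _)))).add (HasExpGrowth.id.mul (h2.mul (.const _)))).mul
    (hasExpGrowth_inv_gammaFactor χ)

/-! ### The factor of the functional equation -/

theorem norm_rootNumber {χ : DirichletCharacter ℂ N} (hχ : χ.IsPrimitive) :
    ‖rootNumber χ‖ = 1 := by
  have hN : (0 : ℝ) < N := by exact_mod_cast NeZero.pos N
  have h1 : ‖gaussSum χ (ZMod.stdAddChar (N := N))‖ = √N := by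
    rw [← norm_gaussSum_stdAddChar_sq hχ, Real.sqrt_sq (norm_nonneg _)]
  have h2 : ‖(N : ℂ) ^ (1 / 2 : ℂ)‖ = √N := by
    rw [norm_natCast_cpow_of_pos (NeZero.pos N), Real.sqrt_eq_rpow]
    norm_num
  rw [rootNumber, norm_div, norm_div, h1, h2, norm_pow, norm_I, one_pow, div_one, div_self]
  positivity

theorem inv_even_iff {M : ℕ} (χ : DirichletCharacter ℂ M) : χ⁻¹.Even ↔ χ.Even := by
  rw [DirichletCharacter.Even, DirichletCharacter.Even, ← MulChar.star_apply', star_eq_iff_star_eq]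
  simp [eq_comm]

theorem gammaFactor_inv {M : ℕ} (χ : DirichletCharacter ℂ M) (s : ℂ) :
    gammaFactor χ⁻¹ s = gammaFactor χ s := by
  rcases χ.even_or_odd with h | h
  · rw [h.gammaFactor_def, ((inv_even_iff χ).2 h).gammaFactor_def]
  · have h' : χ⁻¹.Odd := χ⁻¹.even_or_odd.resolve_left fun h' ↦ h.not_even χ ((inv_even_iff χ).1 h')
    rw [h.gammaFactor_def, h'.gammaFactor_def]

open Classical in
/-- The function `s (s - 1) γ(1 - s) / γ(s)`, with its singularity at `1` removed. -/
noncomputable def archFactor (χ : DirichletCharacter ℂ N) (s : ℂ) : ℂ :=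
  if χ.Even then -(2 * Real.pi) * s * Gammaℝ (3 - s) * (Gammaℝ s)⁻¹
  else s * (s - 1) * Gammaℝ (2 - s) * (Gammaℝ (s + 1))⁻¹

theorem archFactor_of_even {M : ℕ} {χ : DirichletCharacter ℂ M} (h : χ.Even) (s : ℂ) :
    archFactor χ s = -(2 * Real.pi) * s * Gammaℝ (3 - s) * (Gammaℝ s)⁻¹ := by
  simp [archFactor, h]

theorem archFactor_of_odd {M : ℕ} {χ : DirichletCharacter ℂ M} (h : χ.Odd) (s : ℂ) :
    archFactor χ s = s * (s - 1) * Gammaℝ (2 - s) * (Gammaℝ (s + 1))⁻¹ := by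
  simp [archFactor, h.not_even]

theorem archFactor_eq {M : ℕ} (χ : DirichletCharacter ℂ M) {s : ℂ} (h1 : s ≠ 1) :
    archFactor χ s = s * (s - 1) * gammaFactor χ (1 - s) * (gammaFactor χ s)⁻¹ := by
  rcases χ.even_or_odd with h | h
  · rw [archFactor_of_even h, h.gammaFactor_def, h.gammaFactor_def,
      -- The recurrence absorbs s - 1 into the Γ factor, (s - 1) Γℝ(1 - s) = -2π Γℝ(3 - s), which
      -- removes the pole at 1.
      show (3 : ℂ) - s = 1 - s + 2 by ring, Gammaℝ_add_two (sub_ne_zero.2 h1.symm)]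
    have : (Real.pi : ℂ) ≠ 0 := ofReal_ne_zero.2 Real.pi_ne_zero
    field_simp
    ring
  · rw [archFactor_of_odd h, h.gammaFactor_def, h.gammaFactor_def]
    ring_nf

theorem norm_Gammaℝ_conj (s : ℂ) : ‖Gammaℝ (starRingEnd ℂ s)‖ = ‖Gammaℝ s‖ := by
  rw [Gammaℝ_def, Gammaℝ_def, norm_mul, norm_mul, norm_cpow_eq_rpow_re_of_pos Real.pi_pos,
    norm_cpow_eq_rpow_re_of_pos Real.pi_pos,
    show starRingEnd ℂ s / 2 = starRingEnd ℂ (s / 2) by simp [Complex.conj_ofNat], Complex.Gamma_conj, norm_conj]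
  simp

theorem conj_eq_of_re {s : ℂ} {σ : ℝ} (h : s.re = σ) : starRingEnd ℂ s = (2 * σ : ℝ) - s := by
  apply Complex.ext
  · simp [h]; ring
  · simp

theorem norm_archFactor_half {M : ℕ} (χ : DirichletCharacter ℂ M) {s : ℂ} (hs : s.re = 1 / 2) :
    ‖archFactor χ s‖ = ‖s‖ * ‖s - 1‖ := by
  have h1 : s ≠ 1 := by rintro rfl; norm_num at hs
  have hc := conj_eq_of_re hs
  norm_num at hc
  rw [archFactor_eq χ h1, norm_mul, norm_mul, norm_mul, norm_inv]
  have key : ‖gammaFactor χ (1 - s)‖ = ‖gammaFactor χ s‖ ∧ gammaFactor χ s ≠ 0 := by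
    rcases χ.even_or_odd with h | h
    · rw [h.gammaFactor_def, h.gammaFactor_def, ← hc, norm_Gammaℝ_conj]
      exact ⟨rfl, Gammaℝ_ne_zero_of_re_pos (by rw [hs]; norm_num)⟩
    · rw [h.gammaFactor_def, h.gammaFactor_def, ← norm_Gammaℝ_conj (s + 1), map_add, hc, map_one]
      exact ⟨rfl, Gammaℝ_ne_zero_of_re_pos (by rw [add_re, hs]; norm_num)⟩
  rw [key.1, mul_assoc, mul_inv_cancel₀ (norm_ne_zero_iff.2 key.2), mul_one]

/-- Here 3 - s is the conjugate of s, which settles even characters; for odd ones 2 - s is the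
conjugate of s - 1 and one recurrence step reaches s + 1. -/
theorem norm_archFactor_three_halves {M : ℕ} (χ : DirichletCharacter ℂ M) {s : ℂ} (hs : s.re = 3 / 2) :
    ‖archFactor χ s‖ = 2 * Real.pi * ‖s‖ := by
  have hc := conj_eq_of_re hs
  norm_num at hc
  have hpi : ‖(Real.pi : ℂ)‖ = Real.pi := by rw [norm_real, Real.norm_of_nonneg Real.pi_pos.le]
  rcases χ.even_or_odd with h | h
  · rw [archFactor_of_even h, ← hc, norm_mul, norm_mul, norm_Gammaℝ_conj, norm_inv, mul_assoc,
      mul_inv_cancel₀, mul_one, norm_mul, norm_neg, norm_mul, hpi, Complex.norm_ofNat]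
    exact norm_ne_zero_iff.2 (Gammaℝ_ne_zero_of_re_pos (by rw [hs]; norm_num))
  · have h1 : s - 1 ≠ 0 := by
      intro h; rw [sub_eq_zero.1 h] at hs; norm_num at hs
    have e : (2 : ℂ) - s = starRingEnd ℂ (s - 1) := by rw [map_sub, hc, map_one]; ring
    have h0 : ‖Gammaℝ (s - 1)‖ ≠ 0 :=
      norm_ne_zero_iff.2 (Gammaℝ_ne_zero_of_re_pos (by rw [sub_re, hs]; norm_num))
    have h1' := norm_ne_zero_iff.2 h1
    have hp := Real.pi_pos
    rw [archFactor_of_odd h, e, norm_mul, norm_mul, norm_Gammaℝ_conj,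
      show s + 1 = s - 1 + 2 by ring, Gammaℝ_add_two h1, norm_inv, norm_div, norm_div, norm_mul,
      norm_mul, hpi, Complex.norm_ofNat]
    field_simp

/-- Here 1 - s is the conjugate of s + 2, and the recurrence from s to s + 2 yields the extra factor
|s|/(2π); odd characters use -s and s + 1 in the same way. -/
theorem norm_archFactor_neg_half {M : ℕ} (χ : DirichletCharacter ℂ M) {s : ℂ} (hs : s.re = -1 / 2) :
    ‖archFactor χ s‖ = ‖s‖ ^ 2 * ‖s - 1‖ / (2 * Real.pi) := by
  have hc := conj_eq_of_re hs
  norm_num at hc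
  have hpi : ‖(Real.pi : ℂ)‖ = Real.pi := by rw [norm_real, Real.norm_of_nonneg Real.pi_pos.le]
  have hp := Real.pi_pos
  have h0 : s ≠ 0 := by rintro rfl; norm_num at hs
  have h1 : s ≠ 1 := by rintro rfl; norm_num at hs
  have h0' := norm_ne_zero_iff.2 h0
  rw [archFactor_eq χ h1, norm_mul, norm_mul, norm_mul, norm_inv]
  rcases χ.even_or_odd with h | h
  · rw [h.gammaFactor_def, h.gammaFactor_def]
    have e : (1 : ℂ) - s = starRingEnd ℂ (s + 2) := by
      rw [map_add, hc]; simp [Complex.conj_ofNat]; ring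
    have hne : ‖Gammaℝ s‖ ≠ 0 := by
      intro h
      have := norm_ne_zero_iff.2 (Gammaℝ_ne_zero_of_re_pos (s := s + 2)
        (by rw [add_re, hs]; norm_num))
      rw [Gammaℝ_add_two h0] at this
      simp [norm_eq_zero.1 h] at this
    rw [e, norm_Gammaℝ_conj, Gammaℝ_add_two h0, norm_div, norm_div, norm_mul, hpi,
      Complex.norm_ofNat]
    field_simp
  · rw [h.gammaFactor_def, h.gammaFactor_def]
    have e : -s = starRingEnd ℂ (s + 1) := by
      rw [map_add, hc]; simp; ring
    have hne : ‖Gammaℝ (s + 1)‖ ≠ 0 :=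
      norm_ne_zero_iff.2 (Gammaℝ_ne_zero_of_re_pos (by rw [add_re, hs]; norm_num))
    rw [show (1 : ℂ) - s + 1 = -s + 2 by ring, Gammaℝ_add_two (neg_ne_zero.2 h0), norm_div,
      norm_div, norm_mul, hpi, Complex.norm_ofNat, norm_neg, e, norm_Gammaℝ_conj]
    field_simp

theorem differentiableOn_archFactor {M : ℕ} (χ : DirichletCharacter ℂ M) :
    DifferentiableOn ℂ (archFactor χ) wideStrip := by
  have hG : ∀ w : ℂ, 0 < w.re → DifferentiableAt ℂ Gammaℝ w := by
    intro w hw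
    have := (differentiable_Gammaℝ_inv w).fun_inv (inv_ne_zero (Gammaℝ_ne_zero_of_re_pos hw))
    simpa only [inv_inv] using this
  intro s hs
  apply DifferentiableAt.differentiableWithinAt
  rcases χ.even_or_odd with h | h
  · rw [funext (archFactor_of_even h)]
    have h1 : DifferentiableAt ℂ (fun s : ℂ ↦ Gammaℝ (3 - s)) s :=
      (hG (3 - s) (by have := hs.2; simp; linarith)).comp s (by fun_prop)
    have h2 := differentiable_Gammaℝ_inv s
    fun_prop
  · rw [funext (archFactor_of_odd h)]
    have h1 : DifferentiableAt ℂ (fun s : ℂ ↦ Gammaℝ (2 - s)) s :=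
      (hG (2 - s) (by have := hs.2; simp; linarith)).comp s (by fun_prop)
    have h2 : DifferentiableAt ℂ (fun s : ℂ ↦ (Gammaℝ (s + 1))⁻¹) s :=
      DifferentiableAt.comp s (g := fun w ↦ (Gammaℝ w)⁻¹) (differentiable_Gammaℝ_inv (s + 1))
        (by fun_prop)
    fun_prop

theorem hasExpGrowth_archFactor {M : ℕ} (χ : DirichletCharacter ℂ M) : HasExpGrowth (archFactor χ) := by
  rcases χ.even_or_odd with h | h
  · rw [funext (archFactor_of_even h)]
    have h1 := hasExpGrowth_Gammaℝ_one_sub_add (k := 2) (by norm_num) le_rfl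
    have h2 := hasExpGrowth_inv_Gammaℝ_add (k := 0) le_rfl (by norm_num)
    have e : ∀ z : ℂ, 1 - z + ((2 : ℝ) : ℂ) = 3 - z := fun z ↦ by push_cast; ring
    simp only [e, ofReal_zero, add_zero] at h1 h2
    exact (((HasExpGrowth.const _).mul .id).mul h1).mul h2
  · rw [funext (archFactor_of_odd h)]
    have h1 := hasExpGrowth_Gammaℝ_one_sub_add (k := 1) (by norm_num) (by norm_num)
    have h2 := hasExpGrowth_inv_Gammaℝ_add (k := 1) (by norm_num) (by norm_num)
    have e : ∀ z : ℂ, 1 - z + 1 = 2 - z := fun z ↦ by ring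
    simp only [ofReal_one, e] at h1 h2
    exact ((HasExpGrowth.id.mul (.sub .id (.const 1))).mul h1).mul h2

/-- The factor `s (s - 1) Δ(s)`, where `L(s, χ) = Δ(s) L(1 - s, χ⁻¹)`. -/
noncomputable def reflectionFactor (χ : DirichletCharacter ℂ N) (s : ℂ) : ℂ :=
  rootNumber χ * (N : ℂ) ^ (1 / 2 - s) * archFactor χ s

theorem entireLFunction_eq_reflection {χ : DirichletCharacter ℂ N} (hχ : χ.IsPrimitive) {s : ℂ}
    (h0 : s ≠ 0) (h1 : s ≠ 1) (hγ : gammaFactor χ (1 - s) ≠ 0) :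
    entireLFunction χ s = reflectionFactor χ s * LFunction χ⁻¹ (1 - s) := by
  have h := hχ.completedLFunction_one_sub (1 - s)
  rw [sub_sub_cancel] at h
  rw [entireLFunction_eq χ h0 h1, LFunction_eq_completed_div_gammaFactor χ s (.inl h0), h,
    LFunction_eq_completed_div_gammaFactor χ⁻¹ (1 - s) (.inl (sub_ne_zero.2 h1.symm)),
    gammaFactor_inv, reflectionFactor, archFactor_eq χ h1,
    show (1 : ℂ) - s - 1 / 2 = 1 / 2 - s by ring, div_eq_mul_inv]
  field_simp

theorem gammaFactor_one_sub_ne_zero {M : ℕ} (χ : DirichletCharacter ℂ M) {s : ℂ}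
    (hs : s.re = -1 / 2) : gammaFactor χ (1 - s) ≠ 0 := by
  rcases χ.even_or_odd with h | h <;> rw [h.gammaFactor_def] <;>
  apply Gammaℝ_ne_zero_of_re_pos <;> simp [hs] <;> norm_num

theorem norm_reflectionFactor {χ : DirichletCharacter ℂ N} (hχ : χ.IsPrimitive) (s : ℂ) :
    ‖reflectionFactor χ s‖ = (N : ℝ) ^ (1 / 2 - s.re) * ‖archFactor χ s‖ := by
  rw [reflectionFactor, norm_mul, norm_mul, norm_rootNumber hχ, one_mul,
    norm_natCast_cpow_of_pos (NeZero.pos N)]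
  simp

theorem differentiableOn_reflectionFactor (χ : DirichletCharacter ℂ N) :
    DifferentiableOn ℂ (reflectionFactor χ) wideStrip := by
  refine DifferentiableOn.mul ?_ (differentiableOn_archFactor χ)
  exact ((differentiable_natCast_cpow (by fun_prop)).const_mul _).differentiableOn

theorem hasExpGrowth_reflectionFactor (χ : DirichletCharacter ℂ N) :
    HasExpGrowth (reflectionFactor χ) := by
  refine ((HasExpGrowth.const _).mul (hasExpGrowth_natCast_cpow (NeZero.ne _) 2 fun z hz ↦ ?_)).mul
    (hasExpGrowth_archFactor χ)
  have : (1 / 2 - z).re = 1 / 2 - z.re := by simp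
  rw [this, abs_le]
  constructor <;> linarith [hz.1, hz.2]

end LFunction

end LFunctionGrowth

/-! ### Size of the reflection factor on and between the lines. -/

section Reflection

open Set Complex DirichletCharacter

section ReflectionFactorBounds

theorem norm_le_norm_add_two {z : ℂ} (hz : z ∈ closedStrip) : ‖z‖ ≤ ‖z + 2‖ := by
  rw [← sq_le_sq₀ (norm_nonneg _) (norm_nonneg _), ← normSq_eq_norm_sq, ← normSq_eq_norm_sq,
    normSq_apply, normSq_apply]
  simp only [add_re, add_im, re_ofNat, im_ofNat, add_zero]
  nlinarith [hz.1]

theorem norm_sub_one_le_norm_add_two {z : ℂ} (hz : z ∈ closedStrip) : ‖z - 1‖ ≤ ‖z + 2‖ := by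
  rw [← sq_le_sq₀ (norm_nonneg _) (norm_nonneg _), ← normSq_eq_norm_sq, ← normSq_eq_norm_sq,
    normSq_apply, normSq_apply]
  simp only [add_re, add_im, re_ofNat, im_ofNat, add_zero, sub_re, sub_im, one_re, one_im, sub_zero]
  nlinarith [hz.1]

theorem one_add_abs_im_le {z : ℂ} (hz : z ∈ closedStrip) : 1 + |z.im| ≤ 2 * ‖z + 2‖ := by
  have h1 : |(z + 2).re| ≤ ‖z + 2‖ := abs_re_le_norm _
  have h2 : |(z + 2).im| ≤ ‖z + 2‖ := abs_im_le_norm _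
  simp only [add_re, add_im, re_ofNat, im_ofNat, add_zero] at h1 h2
  have := le_abs_self (z.re + 2)
  linarith [hz.1]

theorem norm_add_two_pos {z : ℂ} (hz : z ∈ closedStrip) : 0 < ‖z + 2‖ := by
  have := one_add_abs_im_le hz
  have := abs_nonneg z.im
  linarith

theorem norm_add_two_le {z : ℂ} (hz : z ∈ closedStrip) : ‖z + 2‖ ≤ 4 + |z.im| := by
  have h := norm_le_abs_re_add_abs_im (z + 2)
  simp only [add_re, add_im, re_ofNat, im_ofNat, add_zero] at h
  rw [abs_of_nonneg (by linarith [hz.1] : 0 ≤ z.re + 2)] at h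
  linarith [hz.2]

variable {N : ℕ} [NeZero N] {χ : DirichletCharacter ℂ N}

theorem norm_reflectionFactor_half_le (hχ : χ.IsPrimitive) {z : ℂ} (hz : z.re = 1 / 2) :
    ‖reflectionFactor χ z‖ ≤ ‖z + 2‖ ^ 2 := by
  have hs : z ∈ closedStrip := by constructor <;> norm_num [hz]
  rw [norm_reflectionFactor hχ, norm_archFactor_half χ hz, hz, sub_self, Real.rpow_zero, one_mul, sq]
  gcongr
  · exact norm_le_norm_add_two hs
  · exact norm_sub_one_le_norm_add_two hs

theorem norm_reflectionFactor_three_halves_le (hχ : χ.IsPrimitive) {z : ℂ} (hz : z.re = 3 / 2) :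
    ‖reflectionFactor χ z‖ * N ≤ 7 * ‖z + 2‖ := by
  have hs : z ∈ closedStrip := by constructor <;> norm_num [hz]
  have hN : (0 : ℝ) < N := by exact_mod_cast NeZero.pos N
  rw [norm_reflectionFactor hχ, norm_archFactor_three_halves χ hz, hz,
    show (1 / 2 - 3 / 2 : ℝ) = -1 by norm_num, Real.rpow_neg_one]
  have := norm_le_norm_add_two hs
  have h2 : 2 * Real.pi ≤ 7 := by linarith [Real.pi_lt_d2]
  calc _ = 2 * Real.pi * ‖z‖ := by field_simp
    _ ≤ _ := by gcongr

theorem norm_reflectionFactor_neg_half_le (hχ : χ.IsPrimitive) {z : ℂ} (hz : z.re = -1 / 2) :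
    ‖reflectionFactor χ z‖ ≤ N * ‖z + 2‖ ^ 3 := by
  have hs : z ∈ closedStrip := by constructor <;> norm_num [hz]
  rw [norm_reflectionFactor hχ, norm_archFactor_neg_half χ hz, hz,
    show (1 / 2 - -1 / 2 : ℝ) = 1 by norm_num, Real.rpow_one]
  gcongr
  rw [pow_succ ‖z + 2‖]
  calc ‖z‖ ^ 2 * ‖z - 1‖ / (2 * Real.pi) ≤ ‖z‖ ^ 2 * ‖z - 1‖ / 1 := by
        gcongr
        linarith [Real.pi_gt_three]
    _ ≤ _ := by
      rw [div_one]
      gcongr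
      · exact norm_le_norm_add_two hs
      · exact norm_sub_one_le_norm_add_two hs

open Filter Topology Asymptotics in
-- Phragmén-Lindelöf on a strip of width 1, where growth exp(A exp|y|) is admissible because 1 < π.
theorem norm_le_of_hasExpGrowth {f : ℂ → ℂ} (hd : DifferentiableOn ℂ f wideStrip)
    (hg : HasExpGrowth f) {C : ℝ} (h1 : ∀ z : ℂ, z.re = 1 / 2 → ‖f z‖ ≤ C)
    (h2 : ∀ z : ℂ, z.re = 3 / 2 → ‖f z‖ ≤ C) {z : ℂ} (hz1 : 1 / 2 ≤ z.re) (hz2 : z.re ≤ 3 / 2) :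
    ‖f z‖ ≤ C := by
  refine PhragmenLindelof.vertical_strip (a := 1 / 2) (b := 3 / 2) ?_ ?_ h1 h2 hz1 hz2
  · apply DifferentiableOn.diffContOnCl
    refine hd.mono ?_
    refine (closure_minimal (t := {z : ℂ | 1 / 2 ≤ z.re ∧ z.re ≤ 3 / 2}) ?_ ?_).trans ?_
    · exact fun z hz ↦ ⟨hz.1.le, hz.2.le⟩
    · exact (isClosed_le continuous_const continuous_re).inter
        (isClosed_le continuous_re continuous_const)
    · exact fun z hz ↦ ⟨by linarith [hz.1], by linarith [hz.2]⟩
  · obtain ⟨D, A, hD, hA, hDA⟩ := hg.exists_bound hd.continuousOn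
    refine ⟨1, by norm_num; linarith [Real.pi_gt_three], A, ?_⟩
    refine IsBigO.of_bound D ?_
    refine eventually_inf_principal.2 (Eventually.of_forall fun w hw ↦ ?_)
    refine (hDA w ⟨by linarith [hw.1], by linarith [hw.2]⟩).trans ?_
    rw [Real.norm_of_nonneg (Real.exp_nonneg _)]
    gcongr
    have := Real.add_one_le_exp (1 * |w.im|)
    linarith

theorem hasExpGrowth_exp_sub_sq (x : ℂ) : HasExpGrowth fun w ↦ exp ((w - x) ^ 2) := by
  refine .of_bound (Real.exp ((2 + |x.re|) ^ 2)) fun z hz _ ↦ ?_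
  rw [norm_exp]
  apply Real.exp_le_exp.2
  have e : ((z - x) ^ 2).re = (z.re - x.re) ^ 2 - (z.im - x.im) ^ 2 := by
    simp [sq]
  rw [e]
  have : (z.re - x.re) ^ 2 ≤ (2 + |x.re|) ^ 2 := by
    apply sq_le_sq'
    · linarith [hz.1, le_abs_self x.re]
    · linarith [hz.2, neg_abs_le x.re]
  linarith [sq_nonneg (z.im - x.im)]

theorem hasExpGrowth_inv_add_two : HasExpGrowth fun w ↦ (w + 2)⁻¹ := by
  refine .of_bound 2 fun z hz _ ↦ ?_
  rw [norm_inv]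
  have h := one_add_abs_im_le hz
  have := norm_add_two_pos hz
  rw [inv_le_comm₀ this (by norm_num)]
  linarith [abs_nonneg z.im]

theorem add_two_ne_zero {w : ℂ} (hw : w ∈ wideStrip) : w + 2 ≠ 0 := by
  intro h
  have h' := hw.1
  rw [eq_neg_of_add_eq_zero_left h] at h'
  norm_num at h'

theorem differentiableOn_inv_add_two : DifferentiableOn ℂ (fun w ↦ (w + 2)⁻¹) wideStrip :=
  DifferentiableOn.fun_inv (by fun_prop) fun _ ↦ add_two_ne_zero

theorem norm_reflectionFactor_interpolation (hχ : χ.IsPrimitive) {T : ℝ} (hT : 1 ≤ T) {z : ℂ}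
    (hz1 : 1 / 2 ≤ z.re) (hz2 : z.re ≤ 3 / 2) (hz : T ≤ 1 + |z.im|) :
    ‖reflectionFactor χ z‖ * (N * T) ^ (z.re - 1 / 2) ≤ 100 * ‖z + 2‖ ^ 2 := by
  have hN : (0 : ℝ) < N := by exact_mod_cast NeZero.pos N
  have hNT : 0 < N * T := by positivity
  set F : ℂ → ℂ := fun w ↦ reflectionFactor χ w * (w + 2)⁻¹ ^ 2 * ((N * T : ℝ) : ℂ) ^ (w - 1 / 2)
    * exp ((w - z) ^ 2) with hF
  have hd : DifferentiableOn ℂ F wideStrip := by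
    refine (((differentiableOn_reflectionFactor χ).mul (differentiableOn_inv_add_two.pow 2)).mul
      (fun w _ ↦ ?_)).mul (by fun_prop)
    apply DifferentiableAt.differentiableWithinAt
    exact DifferentiableAt.const_cpow (by fun_prop) (.inl (ofReal_ne_zero.2 hNT.ne'))
  have hg : HasExpGrowth F := by
    refine (((hasExpGrowth_reflectionFactor χ).mul (hasExpGrowth_inv_add_two.pow 2)).mul
      (HasExpGrowth.cpow_of_pos hNT 2 fun w hw ↦ ?_)).mul (hasExpGrowth_exp_sub_sq z)
    have : (w - 1 / 2).re = w.re - 1 / 2 := by simp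
    rw [this, abs_le]
    constructor <;> linarith [hw.1, hw.2]
  have hn (w : ℂ) : ‖F w‖ = ‖reflectionFactor χ w‖ / ‖w + 2‖ ^ 2 * (N * T) ^ (w.re - 1 / 2)
      * Real.exp ((w.re - z.re) ^ 2 - (w.im - z.im) ^ 2) := by
    have e : ((w - z) ^ 2).re = (w.re - z.re) ^ 2 - (w.im - z.im) ^ 2 := by simp [sq]
    have e' : (w - 1 / 2).re = w.re - 1 / 2 := by simp
    rw [hF, norm_mul, norm_mul, norm_mul, norm_exp, e, norm_cpow_eq_rpow_re_of_pos hNT, e',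
      norm_pow, norm_inv, inv_pow, ← div_eq_mul_inv]
  have hexp (w : ℂ) (h1 : 1 / 2 ≤ w.re) (h2 : w.re ≤ 3 / 2) :
      Real.exp ((w.re - z.re) ^ 2 - (w.im - z.im) ^ 2)
        ≤ 3 * Real.exp (-(w.im - z.im) ^ 2) := by
    rw [sub_eq_add_neg, Real.exp_add]
    gcongr
    refine (Real.exp_le_exp.2 (?_ : _ ≤ (1 : ℝ))).trans (by linarith [Real.exp_one_lt_d9])
    rw [sq_le_one_iff_abs_le_one, abs_le]
    constructor <;> linarith
  have hb := norm_le_of_hasExpGrowth hd hg (C := 100) (fun w hw ↦ ?_) (fun w hw ↦ ?_) hz1 hz2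
  · rw [hn, sub_self, sub_self] at hb
    have h2 := norm_add_two_pos (z := z) ⟨by linarith, by linarith⟩
    norm_num at hb
    rw [div_mul_eq_mul_div, div_le_iff₀ (by positivity)] at hb
    convert hb using 3
  · have h2 := norm_add_two_pos (z := w) ⟨by linarith, by linarith⟩
    rw [hn, hw, sub_self, Real.rpow_zero, mul_one, ← hw]
    calc _ ≤ 1 * (3 * Real.exp (-(w.im - z.im) ^ 2)) := by
          gcongr
          · rw [div_le_one (by positivity)]
            exact norm_reflectionFactor_half_le hχ hw
          · exact hexp w (by linarith) (by linarith)
      _ ≤ 1 * (3 * 1) := by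
        gcongr
        exact Real.exp_le_one_iff.2 (by linarith [sq_nonneg (w.im - z.im)])
      _ ≤ _ := by norm_num
  · have hs : w ∈ closedStrip := ⟨by linarith, by linarith⟩
    have h2 := norm_add_two_pos hs
    have h3 := one_add_abs_im_le hs
    set u := w.im - z.im with hu
    have h4 : T ≤ 2 * ‖w + 2‖ * (1 + |u|) := by
      have : |z.im| ≤ |w.im| + |u| := by
        rw [show z.im = w.im - u by rw [hu]; ring]; exact abs_sub _ _
      nlinarith [abs_nonneg u, abs_nonneg w.im]
    have h5 : (1 + |u|) * Real.exp (-u ^ 2) ≤ 2 := by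
      rw [Real.exp_neg, ← div_eq_mul_inv, div_le_iff₀ (Real.exp_pos _)]
      have := Real.add_one_le_exp (u ^ 2)
      nlinarith [sq_abs u, sq_nonneg (|u| - 1)]
    have h6 := norm_reflectionFactor_three_halves_le hχ hw
    rw [hn, hw, show (3 / 2 - 1 / 2 : ℝ) = 1 by norm_num, Real.rpow_one, ← hw]
    calc _ ≤ ‖reflectionFactor χ w‖ / ‖w + 2‖ ^ 2 * (N * T) * (3 * Real.exp (-u ^ 2)) := by
          gcongr
          exact hexp w (by linarith) (by linarith)
      _ = (‖reflectionFactor χ w‖ * N) * T / ‖w + 2‖ ^ 2 * (3 * Real.exp (-u ^ 2)) := by ring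
      _ ≤ (7 * ‖w + 2‖) * (2 * ‖w + 2‖ * (1 + |u|)) / ‖w + 2‖ ^ 2 * (3 * Real.exp (-u ^ 2)) := by
        gcongr
      _ = 42 * ((1 + |u|) * Real.exp (-u ^ 2)) := by field_simp; ring
      _ ≤ _ := by linarith

end ReflectionFactorBounds

end Reflection

/-! ### Mean squares of divisor polynomials over dyadic blocks. -/

section DivisorSums

open MeasureTheory Set Complex DirichletCharacter

section DivisorPolynomials

/-- The truncated Dirichlet series of `L(s, χ) ^ 4`. -/
noncomputable def divisorPolynomial {N : ℕ} (χ : DirichletCharacter ℂ N) (X : ℕ) (s : ℂ) : ℂ :=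
  ∑ n ∈ Finset.Icc 1 X, (divisorFun 4 n : ℂ) * χ n * (n : ℂ) ^ (-s)

theorem divisorPolynomial_inv_conj {N : ℕ} (χ : DirichletCharacter ℂ N) (X : ℕ) (s : ℂ) :
    divisorPolynomial χ⁻¹ X (starRingEnd ℂ s) = starRingEnd ℂ (divisorPolynomial χ X s) := by
  rw [divisorPolynomial, divisorPolynomial, map_sum]
  refine Finset.sum_congr rfl fun n _ ↦ ?_
  rw [map_mul, map_mul, ← RCLike.star_def, MulChar.star_apply', RCLike.star_def, conj_natCast,
    ← map_neg, cpow_conj _ _ (by rw [natCast_arg]; exact Real.pi_ne_zero.symm), conj_natCast]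

theorem differentiable_divisorPolynomial {N : ℕ} (χ : DirichletCharacter ℂ N) (X : ℕ) :
    Differentiable ℂ (divisorPolynomial χ X) := by
  refine Differentiable.fun_sum fun n hn ↦ Differentiable.const_mul (fun s ↦ ?_) _
  have : n ≠ 0 := by have := (Finset.mem_Icc.1 hn).1; omega
  exact DifferentiableAt.const_cpow (by fun_prop) (.inl (Nat.cast_ne_zero.2 this))

theorem hasExpGrowth_divisorPolynomial {N : ℕ} (χ : DirichletCharacter ℂ N) (X : ℕ) :
    HasExpGrowth (divisorPolynomial χ X) := by
  refine HasExpGrowth.sum _ fun n hn ↦ (HasExpGrowth.const _).mul ?_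
  have : n ≠ 0 := by have := (Finset.mem_Icc.1 hn).1; omega
  exact hasExpGrowth_natCast_cpow this 2 fun z hz ↦ abs_neg_re_le hz

/-- The primitive characters with modulus in `[Q, 2 Q)`. -/
noncomputable def primitiveCharactersBlock (Q : ℕ) : Finset (Σ k : ℕ, DirichletCharacter ℂ (k + 1)) :=
  (Finset.Ico (Q - 1) (2 * Q - 1)).sigma fun k ↦ primitiveCharacters (k + 1)

theorem primitiveCharactersBlock_subset (Q : ℕ) :
    primitiveCharactersBlock Q ⊆ primitiveCharactersUpTo (2 * Q) := by
  intro p hp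
  rw [primitiveCharactersBlock, Finset.mem_sigma, Finset.mem_Ico] at hp
  rw [primitiveCharactersUpTo, Finset.mem_sigma, Finset.mem_range]
  exact ⟨by omega, hp.2⟩

/-- The vertical shift y is kept because the three lines theorem needs bounds at every height;
enlarging the t-range to |t| ≤ 2T + |y| costs only 1 + |y|. The sieve constant Q²T is relaxed to X =
(QT)². -/
theorem sum_integral_block_le {Q T : ℕ} (hT : 1 ≤ T) (s : Finset ℕ)
    (hs : ∀ n ∈ s, 1 ≤ n) (a : ℕ → ℂ) (y : ℝ) :
    ∑ p ∈ primitiveCharactersBlock Q, ∫ t in (T - 1 : ℝ)..(2 * T - 1),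
        ‖∑ n ∈ s, a n * p.2 n * (n : ℂ) ^ (-(I * (y + t)))‖ ^ 2
      ≤ 400000 * (1 + |y|) * ∑ n ∈ s, (((Q * T) ^ 2 : ℕ) + n : ℝ) * ‖a n‖ ^ 2 := by
  have hT' : (1 : ℝ) ≤ T := by exact_mod_cast hT
  have hy := abs_nonneg y
  have hy1 := le_abs_self y
  have hy2 := neg_abs_le y
  set F : (Σ k : ℕ, DirichletCharacter ℂ (k + 1)) → ℝ → ℝ := fun p t ↦
    ‖∑ n ∈ s, a n * p.2 n * (n : ℂ) ^ (-(I * t))‖ ^ 2 with hF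
  have hFc (p) : Continuous (F p) := by
    refine ((continuous_finsetSum _ fun n hn ↦ ?_).norm).pow 2
    refine continuous_const.mul (Continuous.const_cpow (by fun_prop) (.inl ?_))
    have := hs n hn
    exact Nat.cast_ne_zero.2 (by omega)
  calc _ = ∑ p ∈ primitiveCharactersBlock Q, ∫ t in (T - 1 : ℝ) + y..(2 * T - 1) + y, F p t := by
        refine Finset.sum_congr rfl fun p _ ↦ ?_
        rw [← intervalIntegral.integral_comp_add_right]
        refine intervalIntegral.integral_congr fun t _ ↦ ?_
        simp only [hF]
        push_cast
        rw [add_comm (t : ℂ)]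
    _ ≤ ∑ p ∈ primitiveCharactersBlock Q, ∫ t in (-(2 * T + |y|))..(2 * T + |y|), F p t := by
        refine Finset.sum_le_sum fun p _ ↦ ?_
        refine intervalIntegral.integral_mono_interval (by linarith) (by linarith) (by linarith)
          (.of_forall fun t ↦ by positivity) ((hFc p).intervalIntegrable _ _)
    _ ≤ ∑ p ∈ primitiveCharactersUpTo (2 * Q),
          ∫ t in (-(2 * T + |y|))..(2 * T + |y|), F p t := by
        refine Finset.sum_le_sum_of_subset_of_nonneg (primitiveCharactersBlock_subset Q)
          fun p _ _ ↦ intervalIntegral.integral_nonneg (by linarith) fun t _ ↦ by positivity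
    _ ≤ 50000 * ∑ n ∈ s, (((2 * Q : ℕ) : ℝ) ^ 2 * (2 * T + |y|) + n) * ‖a n‖ ^ 2 :=
        hybrid_large_sieve _ (by linarith) s hs a
    _ ≤ 50000 * ∑ n ∈ s, (8 * (1 + |y|) * (((Q * T) ^ 2 : ℕ) + n : ℝ)) * ‖a n‖ ^ 2 := by
        gcongr with n hn
        push_cast
        have h1 : (2 * T + |y|) ≤ 2 * (1 + |y|) * (T : ℝ) ^ 2 := by
          have h1 : (T : ℝ) ≤ (T : ℝ) ^ 2 := by nlinarith
          have h2 := mul_le_mul_of_nonneg_left (hT'.trans h1) hy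
          linarith
        have h2 : (0 : ℝ) ≤ n := n.cast_nonneg
        have h3 := mul_le_mul_of_nonneg_left h1 (sq_nonneg (Q : ℝ))
        nlinarith [mul_nonneg hy h2]
    _ = _ := by
        simp_rw [mul_assoc (8 * (1 + |y|)), ← Finset.mul_sum]
        ring

theorem norm_natCast_rpow_mul_sq (n : ℕ) (b σ : ℝ) :
    ‖((b * (n : ℝ) ^ (-σ) : ℝ) : ℂ)‖ ^ 2 = b ^ 2 * (n : ℝ) ^ (-2 * σ) := by
  rw [norm_real, Real.norm_eq_abs, sq_abs, mul_pow]
  congr 1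
  rw [← Real.rpow_natCast, ← Real.rpow_mul n.cast_nonneg]
  congr 1
  push_cast
  ring

theorem divisor_term_eq (b : ℝ) (x : ℂ) {n : ℕ} (hn : 1 ≤ n) (σ y t : ℝ) :
    (b : ℂ) * x * (n : ℂ) ^ (-(σ + I * y + I * t))
      = ((b * (n : ℝ) ^ (-σ) : ℝ) : ℂ) * x * (n : ℂ) ^ (-(I * (y + t))) := by
  have hn0 : (n : ℂ) ≠ 0 := Nat.cast_ne_zero.2 (by omega)
  rw [show -((σ : ℂ) + I * y + I * t) = ((-σ : ℝ) : ℂ) + -(I * (y + t)) by push_cast; ring,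
    cpow_add _ _ hn0, ofReal_mul, ofReal_cpow n.cast_nonneg]
  push_cast
  ring

/-- For n ≤ X the sieve weight X + n is at most 2X and n^(-2σ) ≤ X^e/n, leaving Rankin's sum. It
serves σ = -1/2 and 1/2 ± c with e = 2, 0 and 2c. -/
theorem sum_integral_divisorPolynomial_le {Q T : ℕ} (hQ : 1 ≤ Q) (hT : 1 ≤ T) {σ e : ℝ}
    (he : 0 ≤ e) (hσ : 1 - 2 * σ ≤ e) (y : ℝ) :
    ∑ p ∈ primitiveCharactersBlock Q, ∫ t in (T - 1 : ℝ)..(2 * T - 1),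
        ‖divisorPolynomial p.2 ((Q * T) ^ 2) (σ + I * y + I * t)‖ ^ 2
      ≤ 2400000 * (1 + |y|) * ((((Q * T) ^ 2 : ℕ) : ℝ) ^ (1 + e)
        * (2 + Real.log ((Q * T) ^ 2 : ℕ)) ^ 16) := by
  set X := (Q * T) ^ 2 with hX
  have hX1 : 1 ≤ X := Nat.one_le_pow _ _ (Nat.mul_pos hQ hT)
  have hX1' : (1 : ℝ) ≤ X := by exact_mod_cast hX1
  have h1 := sum_integral_block_le (Q := Q) hT (Finset.Icc 1 X)
    (fun n hn ↦ (Finset.mem_Icc.1 hn).1)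
    (fun n ↦ (((divisorFun 4 n : ℝ) * (n : ℝ) ^ (-σ) : ℝ) : ℂ)) y
  calc _ = ∑ p ∈ primitiveCharactersBlock Q, ∫ t in (T - 1 : ℝ)..(2 * T - 1),
        ‖∑ n ∈ Finset.Icc 1 X, (((divisorFun 4 n : ℝ) * (n : ℝ) ^ (-σ) : ℝ) : ℂ) * p.2 n
          * (n : ℂ) ^ (-(I * (y + t)))‖ ^ 2 := by
        refine Finset.sum_congr rfl fun p _ ↦ intervalIntegral.integral_congr fun t _ ↦ ?_
        simp only [divisorPolynomial]
        congr 2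
        refine Finset.sum_congr rfl fun n hn ↦ ?_
        rw [← divisor_term_eq _ _ (Finset.mem_Icc.1 hn).1, ofReal_natCast]
    _ ≤ _ := h1
    _ ≤ 400000 * (1 + |y|) * ∑ n ∈ Finset.Icc 1 X,
          (2 * (X : ℝ) ^ (1 + e)) * ((divisorFun 4 n : ℝ) ^ 2 / n) := by
        refine mul_le_mul_of_nonneg_left (Finset.sum_le_sum fun n hn ↦ ?_) (by positivity)
        have hn1 := (Finset.mem_Icc.1 hn).1
        have hn0 : (0 : ℝ) < n := by exact_mod_cast hn1
        have hn1' : (1 : ℝ) ≤ n := by exact_mod_cast hn1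
        have hnX : (n : ℝ) ≤ X := by exact_mod_cast (Finset.mem_Icc.1 hn).2
        rw [norm_natCast_rpow_mul_sq]
        have h2 : (n : ℝ) ^ (-2 * σ) ≤ (X : ℝ) ^ e / n := by
          rw [le_div_iff₀ hn0]
          calc (n : ℝ) ^ (-2 * σ) * n = (n : ℝ) ^ (1 - 2 * σ) := by
                rw [← Real.rpow_add_one hn0.ne']; congr 1; ring
            _ ≤ (n : ℝ) ^ e := Real.rpow_le_rpow_of_exponent_le hn1' hσ
            _ ≤ _ := Real.rpow_le_rpow hn0.le hnX he
        calc ((X : ℝ) + n) * ((divisorFun 4 n : ℝ) ^ 2 * (n : ℝ) ^ (-2 * σ))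
            ≤ (X + X) * ((divisorFun 4 n : ℝ) ^ 2 * ((X : ℝ) ^ e / n)) := by gcongr
          _ = _ := by
            rw [add_comm 1 e, Real.rpow_add_one (by positivity)]
            ring
    _ ≤ 400000 * (1 + |y|) * ((2 * (X : ℝ) ^ (1 + e)) * (3 * (2 + Real.log X) ^ 16)) := by
        rw [← Finset.mul_sum]
        gcongr
        exact sum_divisorFun_sq_div_le hX1' _ fun n hn ↦
          ⟨(Finset.mem_Icc.1 hn).1, by exact_mod_cast (Finset.mem_Icc.1 hn).2⟩
    _ = _ := by ring

theorem sum_integral_divisorPolynomial_sub_le {Q T : ℕ} (hQ : 1 ≤ Q) (hT : 1 ≤ T) (y : ℝ) {Y : ℕ}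
    (hY : (Q * T) ^ 2 ≤ Y) :
    ∑ p ∈ primitiveCharactersBlock Q, ∫ t in (T - 1 : ℝ)..(2 * T - 1),
        ‖divisorPolynomial p.2 Y ((3 / 2 : ℝ) + I * y + I * t)
          - divisorPolynomial p.2 ((Q * T) ^ 2) ((3 / 2 : ℝ) + I * y + I * t)‖ ^ 2
      ≤ 2400000 * (1 + |y|) * ((2 + Real.log ((Q * T) ^ 2 : ℕ)) ^ 16 / ((Q * T) ^ 2 : ℕ)) := by
  set X := (Q * T) ^ 2 with hX
  have hX1 : 1 ≤ X := Nat.one_le_pow _ _ (Nat.mul_pos hQ hT)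
  have hX1' : (1 : ℝ) ≤ X := by exact_mod_cast hX1
  have h1 := sum_integral_block_le (Q := Q) hT (Finset.Ioc X Y)
    (fun n hn ↦ by have := (Finset.mem_Ioc.1 hn).1; omega)
    (fun n ↦ (((divisorFun 4 n : ℝ) * (n : ℝ) ^ (-(3 / 2 : ℝ)) : ℝ) : ℂ)) y
  calc _ = ∑ p ∈ primitiveCharactersBlock Q, ∫ t in (T - 1 : ℝ)..(2 * T - 1),
        ‖∑ n ∈ Finset.Ioc X Y, (((divisorFun 4 n : ℝ) * (n : ℝ) ^ (-(3 / 2 : ℝ)) : ℝ) : ℂ) * p.2 n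
          * (n : ℂ) ^ (-(I * (y + t)))‖ ^ 2 := by
        refine Finset.sum_congr rfl fun p _ ↦ intervalIntegral.integral_congr fun t _ ↦ ?_
        simp only [divisorPolynomial]
        congr 2
        have e : Finset.Icc 1 Y = Finset.Icc 1 X ∪ Finset.Ioc X Y := by
          ext n; simp only [Finset.mem_union, Finset.mem_Icc, Finset.mem_Ioc]; omega
        rw [e, Finset.sum_union, add_sub_cancel_left]
        · refine Finset.sum_congr rfl fun n hn ↦ ?_
          rw [← divisor_term_eq, ofReal_natCast]
          have := (Finset.mem_Ioc.1 hn).1; omega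
        · rw [Finset.disjoint_left]
          intro n; simp only [Finset.mem_Icc, Finset.mem_Ioc]; omega
    _ ≤ _ := h1
    _ ≤ 400000 * (1 + |y|) * ∑ n ∈ Finset.Ioc X Y, 2 * ((divisorFun 4 n : ℝ) ^ 2 / n ^ 2) := by
        refine mul_le_mul_of_nonneg_left (Finset.sum_le_sum fun n hn ↦ ?_) (by positivity)
        have hnX := (Finset.mem_Ioc.1 hn).1
        have hn0 : (0 : ℝ) < n := by exact_mod_cast (by omega : 0 < n)
        have hnX' : (X : ℝ) ≤ n := by exact_mod_cast hnX.le
        rw [norm_natCast_rpow_mul_sq, show (-2 * (3 / 2) : ℝ) = -(3 : ℕ) by norm_num,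
          Real.rpow_neg hn0.le, Real.rpow_natCast]
        calc ((X : ℝ) + n) * ((divisorFun 4 n : ℝ) ^ 2 * ((n : ℝ) ^ 3)⁻¹)
            ≤ (n + n) * ((divisorFun 4 n : ℝ) ^ 2 * ((n : ℝ) ^ 3)⁻¹) := by gcongr
          _ = _ := by field_simp; ring
    _ ≤ 400000 * (1 + |y|) * (2 * (3 * (2 + Real.log X) ^ 16 / X)) := by
        rw [← Finset.mul_sum]
        gcongr
        exact sum_divisorFun_sq_div_sq_le hX1' _ fun n hn ↦ by
          exact_mod_cast (Finset.mem_Ioc.1 hn).1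
    _ = _ := by ring

open Filter Topology in
theorem tendsto_divisorPolynomial {N : ℕ} [NeZero N] (χ : DirichletCharacter ℂ N) {s : ℂ} (hs : 1 < s.re) :
    Tendsto (fun Y ↦ divisorPolynomial χ Y s) atTop (𝓝 (LFunction χ s ^ 4)) := by
  have h := (LSeriesHasSum_mul_divisorFun χ 4 hs).tendsto_sum_nat.comp (tendsto_add_atTop_nat 1)
  rw [← LFunction_eq_LSeries χ hs] at h
  refine h.congr fun Y ↦ ?_
  rw [divisorPolynomial, Function.comp, Finset.range_eq_Ico, Finset.sum_eq_sum_Ico_succ_bot (by omega),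
    LSeries.term_zero, zero_add]
  refine Finset.sum_congr (by ext; simp) fun n hn ↦ ?_
  have : n ≠ 0 := by have := (Finset.mem_Icc.1 hn).1; omega
  rw [LSeries.term_of_ne_zero this, cpow_neg]
  ring

theorem norm_divisorPolynomial_le {N : ℕ} (χ : DirichletCharacter ℂ N) (Y : ℕ) {s : ℂ}
    (hs : s.re = 3 / 2) :
    ‖divisorPolynomial χ Y s‖ ≤ ∑' n : ℕ, (divisorFun 4 n : ℝ) / (n : ℝ) ^ (1 + 1 / 2 : ℝ) := by
  have h := (hasSum_divisorFun_div 4 (δ := 1 / 2) (by norm_num)).summable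
  refine (norm_sum_le _ _).trans (le_trans (Finset.sum_le_sum fun n hn ↦ ?_)
    (h.sum_le_tsum (Finset.Icc 1 Y) fun n _ ↦ by positivity))
  have hn1 := (Finset.mem_Icc.1 hn).1
  rw [norm_mul, norm_mul, norm_natCast, norm_natCast_cpow_of_pos hn1, neg_re, hs, 
    Real.rpow_neg n.cast_nonneg, show (1 + 1 / 2 : ℝ) = 3 / 2 by norm_num, div_eq_mul_inv]
  refine mul_le_mul_of_nonneg_right ?_ (by positivity)
  exact mul_le_of_le_one_right (by positivity) (χ.norm_le_one _)

theorem continuous_LFunction_vertical {N : ℕ} [NeZero N] (χ : DirichletCharacter ℂ N) {σ : ℝ}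
    (hσ : σ ≠ 1) (y : ℝ) : Continuous fun t : ℝ ↦ LFunction χ (σ + I * y + I * t) := by
  refine continuous_iff_continuousAt.2 fun t ↦ ?_
  refine ContinuousAt.comp (f := fun t : ℝ ↦ (σ + I * y + I * t : ℂ)) (g := LFunction χ)
    (differentiableAt_LFunction χ _ (.inl fun h ↦ hσ ?_)).continuousAt (by fun_prop)
  simpa using congrArg re h

open Filter Topology in
-- The finite tails obey a bound independent of Y, and absolute convergence on Re s = 3/2 dominates
-- the passage to the limit.
theorem sum_integral_LFunction_sub_divisorPolynomial_le {Q T : ℕ} (hQ : 1 ≤ Q) (hT : 1 ≤ T) (y : ℝ) :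
    ∑ p ∈ primitiveCharactersBlock Q, ∫ t in (T - 1 : ℝ)..(2 * T - 1),
        ‖LFunction p.2 ((3 / 2 : ℝ) + I * y + I * t) ^ 4
          - divisorPolynomial p.2 ((Q * T) ^ 2) ((3 / 2 : ℝ) + I * y + I * t)‖ ^ 2
      ≤ 2400000 * (1 + |y|) * ((2 + Real.log ((Q * T) ^ 2 : ℕ)) ^ 16 / ((Q * T) ^ 2 : ℕ)) := by
  set X := (Q * T) ^ 2 with hX
  have hre (t : ℝ) : (((3 / 2 : ℝ) : ℂ) + I * y + I * t).re = 3 / 2 := by simp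
  set S := ∑' n : ℕ, (divisorFun 4 n : ℝ) / (n : ℝ) ^ (1 + 1 / 2 : ℝ)
  refine le_of_tendsto (f := fun Y ↦ ∑ p ∈ primitiveCharactersBlock Q,
    ∫ t in (T - 1 : ℝ)..(2 * T - 1), ‖divisorPolynomial p.2 Y ((3 / 2 : ℝ) + I * y + I * t)
          - divisorPolynomial p.2 X ((3 / 2 : ℝ) + I * y + I * t)‖ ^ 2) (x := atTop) ?_ ?_
  · refine tendsto_finsetSum _ fun p _ ↦ ?_
    refine intervalIntegral.tendsto_integral_filter_of_dominated_convergence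
      (fun _ ↦ (S + S) ^ 2) ?_ ?_ (by simp) ?_
    · refine .of_forall fun Y ↦ Continuous.aestronglyMeasurable ?_
      have h1 := (differentiable_divisorPolynomial p.2 Y).continuous
      have h2 := (differentiable_divisorPolynomial p.2 X).continuous
      fun_prop
    · refine .of_forall fun Y ↦ .of_forall fun t _ ↦ ?_
      rw [norm_pow, norm_norm]
      gcongr
      exact (norm_sub_le _ _).trans (add_le_add (norm_divisorPolynomial_le _ _ (hre t))
        (norm_divisorPolynomial_le _ _ (hre t)))
    · refine .of_forall fun t _ ↦ ?_
      exact (((tendsto_divisorPolynomial p.2 (by rw [hre]; norm_num)).sub_const _).norm).pow 2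
  · filter_upwards [eventually_ge_atTop X] with Y hY
    exact sum_integral_divisorPolynomial_sub_le hQ hT y hY

end DivisorPolynomials

end DivisorSums

/-! ### The approximate functional equation in mean square on a block. -/

section Block

open MeasureTheory Set Complex DirichletCharacter

section BlockBound

open Filter Topology in
theorem LFunction_inv_conj_pow_four {N : ℕ} [NeZero N] (χ : DirichletCharacter ℂ N) {s : ℂ}
    (hs : 1 < s.re) :
    LFunction χ⁻¹ (starRingEnd ℂ s) ^ 4 = starRingEnd ℂ (LFunction χ s ^ 4) := by
  have h1 := tendsto_divisorPolynomial χ⁻¹ (s := starRingEnd ℂ s) (by simpa using hs)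
  have h2 := (continuous_conj.tendsto _).comp (tendsto_divisorPolynomial χ hs)
  refine tendsto_nhds_unique h1 (h2.congr fun Y ↦ ?_)
  rw [Function.comp, divisorPolynomial_inv_conj]

theorem sum_integral_le_add {ι : Type*} (s : Finset ι) {u v : ℝ} (huv : u ≤ v)
    {F G H : ι → ℝ → ℝ} (hF : ∀ i ∈ s, Continuous (F i)) (hG : ∀ i ∈ s, Continuous (G i))
    (hH : ∀ i ∈ s, Continuous (H i)) (a b : ℝ)
    (h : ∀ i ∈ s, ∀ t ∈ Icc u v, F i t ≤ a * G i t + b * H i t) :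
    ∑ i ∈ s, ∫ t in u..v, F i t
      ≤ a * ∑ i ∈ s, (∫ t in u..v, G i t) + b * ∑ i ∈ s, ∫ t in u..v, H i t := by
  rw [Finset.mul_sum, Finset.mul_sum, ← Finset.sum_add_distrib]
  refine Finset.sum_le_sum fun i hi ↦ ?_
  rw [← intervalIntegral.integral_const_mul, ← intervalIntegral.integral_const_mul,
    ← intervalIntegral.integral_add (((hG i hi).const_mul a).intervalIntegrable _ _)
      (((hH i hi).const_mul b).intervalIntegrable _ _)]
  exact intervalIntegral.integral_mono_on huv ((hF i hi).intervalIntegrable _ _)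
    ((((hG i hi).const_mul a).add ((hH i hi).const_mul b)).intervalIntegrable _ _) (h i hi)

variable {N : ℕ} [NeZero N]

/-- The remainder in the approximate functional equation for `L(z, χ) ^ 4` with both sums cut
sharply at `X`, multiplied by `(z (z - 1) / (z + 2) ^ 2) ^ 4`. -/
noncomputable def normalizedRemainder (χ : DirichletCharacter ℂ N) (X : ℕ) (z : ℂ) : ℂ :=
  (entireLFunction χ z ^ 4 - (z * (z - 1)) ^ 4 * divisorPolynomial χ X z
    - reflectionFactor χ z ^ 4 * divisorPolynomial χ⁻¹ X (1 - z)) * (z + 2)⁻¹ ^ 8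

theorem differentiableOn_normalizedRemainder (χ : DirichletCharacter ℂ N) (X : ℕ) :
    DifferentiableOn ℂ (normalizedRemainder χ X) wideStrip := by
  have h1 := (differentiable_entireLFunction χ).differentiableOn (s := wideStrip)
  have h2 := (differentiable_divisorPolynomial χ X).differentiableOn (s := wideStrip)
  have h3 : DifferentiableOn ℂ (fun z ↦ divisorPolynomial χ⁻¹ X (1 - z)) wideStrip :=
    ((differentiable_divisorPolynomial χ⁻¹ X).comp
      (by fun_prop : Differentiable ℂ fun z : ℂ ↦ 1 - z)).differentiableOn
  have h4 := differentiableOn_reflectionFactor χ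
  have h5 := differentiableOn_inv_add_two
  unfold normalizedRemainder
  fun_prop

theorem hasExpGrowth_normalizedRemainder (χ : DirichletCharacter ℂ N) (X : ℕ) :
    HasExpGrowth (normalizedRemainder χ X) :=
  ((((hasExpGrowth_entireLFunction χ).pow 4).sub
    (((HasExpGrowth.id.mul (.sub .id (.const 1))).pow 4).mul
      (hasExpGrowth_divisorPolynomial χ X))).sub
    (((hasExpGrowth_reflectionFactor χ).pow 4).mul
      (hasExpGrowth_divisorPolynomial χ⁻¹ X).comp_one_sub)).mul (hasExpGrowth_inv_add_two.pow 8)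

theorem continuous_normalizedRemainder_vertical (χ : DirichletCharacter ℂ N) (X : ℕ) {σ : ℝ}
    (h1 : -1 < σ) (h2 : σ < 2) (y : ℝ) :
    Continuous fun t : ℝ ↦ normalizedRemainder χ X (σ + I * y + I * t) := by
  refine (differentiableOn_normalizedRemainder χ X).continuousOn.comp_continuous
    (by fun_prop) fun t ↦ ?_
  constructor <;> simpa

theorem one_sub_vertical (σ y t : ℝ) :
    1 - ((σ : ℂ) + I * y + I * t) = starRingEnd ℂ (((1 - σ : ℝ) : ℂ) + I * y + I * t) := by
  simp only [map_add, map_mul, conj_ofReal, conj_I]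
  push_cast
  ring

theorem norm_mul_sub_mul_sq_le {a b x y : ℂ} {A B : ℝ} (ha : ‖a‖ ≤ A) (hb : ‖b‖ ≤ B) :
    ‖a * x - b * y‖ ^ 2 ≤ 2 * A ^ 2 * ‖x‖ ^ 2 + 2 * B ^ 2 * ‖y‖ ^ 2 := by
  have h1 : ‖a * x - b * y‖ ≤ A * ‖x‖ + B * ‖y‖ := by
    refine (norm_sub_le _ _).trans ?_
    rw [norm_mul, norm_mul]
    gcongr
  calc _ ≤ (A * ‖x‖ + B * ‖y‖) ^ 2 := by gcongr
    _ ≤ _ := by nlinarith [sq_nonneg (A * ‖x‖ - B * ‖y‖)]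

theorem norm_normalized_poles_le {z : ℂ} (hz : z ∈ closedStrip) :
    ‖(z * (z - 1)) ^ 4 * (z + 2)⁻¹ ^ 8‖ ≤ 1 := by
  have h := norm_add_two_pos hz
  rw [norm_mul, norm_pow, norm_pow, norm_inv, norm_mul, inv_pow, ← div_eq_mul_inv,
    div_le_one (by positivity)]
  calc (‖z‖ * ‖z - 1‖) ^ 4 ≤ (‖z + 2‖ * ‖z + 2‖) ^ 4 := by
        gcongr
        · exact norm_le_norm_add_two hz
        · exact norm_sub_one_le_norm_add_two hz
    _ = _ := by ring

theorem norm_normalized_reflectionFactor_le {χ : DirichletCharacter ℂ N} {z : ℂ}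
    (hz : z ∈ closedStrip) {R : ℝ} (h : ‖reflectionFactor χ z‖ ≤ R * ‖z + 2‖ ^ 2) :
    ‖reflectionFactor χ z ^ 4 * (z + 2)⁻¹ ^ 8‖ ≤ R ^ 4 := by
  have h0 := norm_add_two_pos hz
  rw [norm_mul, norm_pow, norm_pow, norm_inv, inv_pow, ← div_eq_mul_inv, div_le_iff₀ (by positivity)]
  calc ‖reflectionFactor χ z‖ ^ 4 ≤ (R * ‖z + 2‖ ^ 2) ^ 4 := by gcongr
    _ = _ := by ring

/-- The reflection factor has size about |z + 2|/N, and NT(1 + |z.im|) controls QT up to 1 + |y|.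
The fourth power, then squared, gives (QT)^(-8) = X^(-4) in front of the dual polynomial, which
conjugation moves to the line -1/2. -/
theorem norm_normalizedRemainder_three_halves_le {χ : DirichletCharacter ℂ N} (hχ : χ.IsPrimitive)
    {Q T : ℕ} (hQ1 : 1 ≤ Q) (hT : 1 ≤ T) (hQ : Q ≤ N) (y : ℝ) {t : ℝ} (ht : (T : ℝ) - 1 ≤ t) :
    ‖normalizedRemainder χ ((Q * T) ^ 2) ((3 / 2 : ℝ) + I * y + I * t)‖ ^ 2
      ≤ 2 * ‖LFunction χ ((3 / 2 : ℝ) + I * y + I * t) ^ 4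
          - divisorPolynomial χ ((Q * T) ^ 2) ((3 / 2 : ℝ) + I * y + I * t)‖ ^ 2
        + 2 * (14 * (1 + |y|)) ^ 8 / (((Q * T) ^ 2 : ℕ) : ℝ) ^ 4
          * ‖divisorPolynomial χ ((Q * T) ^ 2) ((-1 / 2 : ℝ) + I * y + I * t)‖ ^ 2 := by
  set X := (Q * T) ^ 2 with hX
  set z : ℂ := (3 / 2 : ℝ) + I * y + I * t with hz
  have hQ' : (1 : ℝ) ≤ Q := by exact_mod_cast hQ1
  have hT' : (1 : ℝ) ≤ T := by exact_mod_cast hT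
  have hN' : (Q : ℝ) ≤ N := by exact_mod_cast hQ
  have hre : z.re = 3 / 2 := by simp [hz]
  have him : z.im = y + t := by simp [hz]
  have hs : z ∈ closedStrip := by constructor <;> norm_num [hre]
  have h0 : z ≠ 0 := by rintro h; rw [h] at hre; norm_num at hre
  have h1 : z ≠ 1 := by rintro h; rw [h] at hre; norm_num at hre
  have hp := norm_add_two_pos hs
  have e1 : 1 - z = starRingEnd ℂ ((-1 / 2 : ℝ) + I * y + I * t) := by
    rw [hz, one_sub_vertical, show (1 - 3 / 2 : ℝ) = -1 / 2 by norm_num]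
  have hy := abs_nonneg y
  have h2 : (Q * T : ℝ) ≤ N * (2 * ‖z + 2‖ * (1 + |y|)) := by
    have h3 := one_add_abs_im_le hs
    rw [him] at h3
    have h4 : (T : ℝ) ≤ 2 * ‖z + 2‖ * (1 + |y|) := by
      calc (T : ℝ) ≤ 1 + |y + t| + |y| := by linarith [le_abs_self (y + t), neg_abs_le y]
        _ ≤ (1 + |y + t|) * (1 + |y|) := by nlinarith [abs_nonneg (y + t)]
        _ ≤ _ := by gcongr
    gcongr
  have hR : ‖reflectionFactor χ z‖ ≤ 14 * (1 + |y|) / (Q * T) * ‖z + 2‖ ^ 2 := by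
    have h3 := norm_reflectionFactor_three_halves_le hχ hre
    have hN : (0 : ℝ) < N := by linarith
    rw [← le_div_iff₀ hN] at h3
    refine h3.trans ?_
    rw [div_mul_eq_mul_div, div_le_div_iff₀ hN (by positivity)]
    nlinarith [mul_le_mul_of_nonneg_left h2 hp.le]
  -- The tail of L^4 gets a coefficient of modulus at most 1; the other term is the dual sum.
  have e2 : normalizedRemainder χ X z = ((z * (z - 1)) ^ 4 * (z + 2)⁻¹ ^ 8)
      * (LFunction χ z ^ 4 - divisorPolynomial χ X z) - (reflectionFactor χ z ^ 4 * (z + 2)⁻¹ ^ 8)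
      * starRingEnd ℂ (divisorPolynomial χ X ((-1 / 2 : ℝ) + I * y + I * t)) := by
    rw [normalizedRemainder, entireLFunction_eq χ h0 h1, e1, divisorPolynomial_inv_conj]
    ring
  rw [e2]
  refine (norm_mul_sub_mul_sq_le (norm_normalized_poles_le hs)
    (norm_normalized_reflectionFactor_le hs hR)).trans_eq ?_
  rw [norm_conj, hX]
  push_cast
  ring

/-- By the functional equation the reflection factor now multiplies the conjugate of the tail of L^4
at 3/2, with weight X^4, while the direct polynomial keeps a bounded coefficient. -/
theorem norm_normalizedRemainder_neg_half_le {χ : DirichletCharacter ℂ N} (hχ : χ.IsPrimitive)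
    {Q T : ℕ} (hQ1 : 1 ≤ Q) (hT : 1 ≤ T) (hQ : N ≤ 2 * Q) (y : ℝ) {t : ℝ} (ht1 : (T : ℝ) - 1 ≤ t)
    (ht2 : t ≤ 2 * (T : ℝ) - 1) :
    ‖normalizedRemainder χ ((Q * T) ^ 2) ((-1 / 2 : ℝ) + I * y + I * t)‖ ^ 2
      ≤ 2 * (12 * (1 + |y|)) ^ 8 * (((Q * T) ^ 2 : ℕ) : ℝ) ^ 4
          * ‖LFunction χ ((3 / 2 : ℝ) + I * y + I * t) ^ 4
          - divisorPolynomial χ ((Q * T) ^ 2) ((3 / 2 : ℝ) + I * y + I * t)‖ ^ 2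
        + 2 * ‖divisorPolynomial χ ((Q * T) ^ 2) ((-1 / 2 : ℝ) + I * y + I * t)‖ ^ 2 := by
  set X := (Q * T) ^ 2 with hX
  set z : ℂ := (-1 / 2 : ℝ) + I * y + I * t with hz
  have hQ' : (1 : ℝ) ≤ Q := by exact_mod_cast hQ1
  have hT' : (1 : ℝ) ≤ T := by exact_mod_cast hT
  have hN' : (N : ℝ) ≤ 2 * Q := by exact_mod_cast hQ
  have hre : z.re = -1 / 2 := by simp [hz]
  have him : z.im = y + t := by simp [hz]
  have hs : z ∈ closedStrip := by constructor <;> norm_num [hre]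
  have h0 : z ≠ 0 := by rintro h; rw [h] at hre; norm_num at hre
  have h1 : z ≠ 1 := by rintro h; rw [h] at hre; norm_num at hre
  have hp := norm_add_two_pos hs
  have e1 : 1 - z = starRingEnd ℂ ((3 / 2 : ℝ) + I * y + I * t) := by
    rw [hz, one_sub_vertical, show (1 - -1 / 2 : ℝ) = 3 / 2 by norm_num]
  have hy := abs_nonneg y
  have hR : ‖reflectionFactor χ z‖ ≤ 12 * (1 + |y|) * (Q * T) * ‖z + 2‖ ^ 2 := by
    have h3 := norm_reflectionFactor_neg_half_le hχ hre
    have h4 := norm_add_two_le hs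
    rw [him] at h4
    have h5 : ‖z + 2‖ ≤ 6 * (T * (1 + |y|)) := by
      have h6 := abs_add_le y t
      rw [abs_of_nonneg (by linarith : 0 ≤ t)] at h6
      nlinarith
    calc ‖reflectionFactor χ z‖ ≤ N * ‖z + 2‖ ^ 3 := h3
      _ = N * ‖z + 2‖ * ‖z + 2‖ ^ 2 := by ring
      _ ≤ (2 * Q) * (6 * (T * (1 + |y|))) * ‖z + 2‖ ^ 2 := by gcongr
      _ = _ := by ring
  have e2 : normalizedRemainder χ X z = (reflectionFactor χ z ^ 4 * (z + 2)⁻¹ ^ 8)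
      * starRingEnd ℂ (LFunction χ ((3 / 2 : ℝ) + I * y + I * t) ^ 4
        - divisorPolynomial χ X ((3 / 2 : ℝ) + I * y + I * t))
      - ((z * (z - 1)) ^ 4 * (z + 2)⁻¹ ^ 8) * divisorPolynomial χ X z := by
    rw [normalizedRemainder, entireLFunction_eq_reflection hχ h0 h1
      (gammaFactor_one_sub_ne_zero χ hre), e1, divisorPolynomial_inv_conj, mul_pow,
      LFunction_inv_conj_pow_four χ (by simp; norm_num), map_sub]
    ring
  rw [e2]
  refine (norm_mul_sub_mul_sq_le (norm_normalized_reflectionFactor_le hs hR)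
    (norm_normalized_poles_le hs)).trans_eq ?_
  rw [norm_conj, hX]
  push_cast
  ring

/-- Nine powers arise, eight from the reflection factor and one from the shifted sieve; the right
side has the form required on the boundary by `meanSquare_three_lines`. Completing the square needs
81/8 ≤ 11. -/
theorem one_add_abs_pow_nine_le (y : ℝ) : (1 + |y|) ^ 9 ≤ Real.exp 11 * Real.exp (2 * y ^ 2) := by
  rw [← Real.exp_add]
  calc (1 + |y|) ^ 9 ≤ (Real.exp |y|) ^ 9 := by
        gcongr
        linarith [Real.add_one_le_exp |y|]
    _ = Real.exp (9 * |y|) := by rw [← Real.exp_nat_mul]; norm_num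
    _ ≤ _ := by
      apply Real.exp_le_exp.2
      nlinarith [sq_abs y, sq_nonneg (|y| - 9 / 4)]

theorem isPrimitive_of_mem_block {Q : ℕ} {p : Σ k : ℕ, DirichletCharacter ℂ (k + 1)}
    (hp : p ∈ primitiveCharactersBlock Q) : p.2.IsPrimitive ∧ Q ≤ p.1 + 1 ∧ p.1 + 1 ≤ 2 * Q := by
  rw [primitiveCharactersBlock, Finset.mem_sigma, Finset.mem_Ico, mem_primitiveCharacters] at hp
  exact ⟨hp.2, by omega, by omega⟩

theorem continuous_norm_sq_divisorPolynomial {N : ℕ} (χ : DirichletCharacter ℂ N) (X : ℕ)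
    (σ y : ℝ) : Continuous fun t : ℝ ↦ ‖divisorPolynomial χ X (σ + I * y + I * t)‖ ^ 2 := by
  have := (differentiable_divisorPolynomial χ X).continuous
  fun_prop

theorem continuous_norm_sq_LFunction_sub {N : ℕ} [NeZero N] (χ : DirichletCharacter ℂ N) (X : ℕ)
    (y : ℝ) : Continuous fun t : ℝ ↦ ‖LFunction χ ((3 / 2 : ℝ) + I * y + I * t) ^ 4
      - divisorPolynomial χ X ((3 / 2 : ℝ) + I * y + I * t)‖ ^ 2 := by
  have h1 := (differentiable_divisorPolynomial χ X).continuous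
  have h2 := continuous_LFunction_vertical χ (σ := 3 / 2) (by norm_num) y
  fun_prop

theorem sum_integral_normalizedRemainder_three_halves_le {Q T : ℕ} (hQ : 1 ≤ Q) (hT : 1 ≤ T)
    (y : ℝ) :
    ∑ p ∈ primitiveCharactersBlock Q, ∫ t in (T - 1 : ℝ)..(2 * T - 1),
        ‖normalizedRemainder p.2 ((Q * T) ^ 2) ((3 / 2 : ℝ) + I * y + I * t)‖ ^ 2
      ≤ (Real.exp 11 * 4800000 * (1 + 14 ^ 8) * ((2 + Real.log ((Q * T) ^ 2 : ℕ)) ^ 16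
        / (((Q * T) ^ 2 : ℕ) : ℝ))) * Real.exp (2 * y ^ 2) := by
  have hT' : (1 : ℝ) ≤ T := by exact_mod_cast hT
  have h1 := sum_integral_LFunction_sub_divisorPolynomial_le hQ hT y
  have h2 := sum_integral_divisorPolynomial_le hQ hT (σ := -1 / 2) (e := 2) (by norm_num)
    (by norm_num) y
  have h3 := sum_integral_le_add (primitiveCharactersBlock Q)
    (by linarith : (T - 1 : ℝ) ≤ 2 * T - 1)
    (fun p _ ↦ ((continuous_normalizedRemainder_vertical p.2 ((Q * T) ^ 2) (σ := 3 / 2)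
      (by norm_num) (by norm_num) y).norm.pow 2))
    (fun p _ ↦ continuous_norm_sq_LFunction_sub p.2 ((Q * T) ^ 2) y)
    (fun p _ ↦ continuous_norm_sq_divisorPolynomial p.2 ((Q * T) ^ 2) (-1 / 2) y)
    2 (2 * (14 * (1 + |y|)) ^ 8 / (((Q * T) ^ 2 : ℕ) : ℝ) ^ 4)
    (fun p hp t ht ↦ norm_normalizedRemainder_three_halves_le (isPrimitive_of_mem_block hp).1 hQ hT
      (isPrimitive_of_mem_block hp).2.1 y ht.1)
  set X := (Q * T) ^ 2 with hX
  have hX0 : (0 : ℝ) < X := by exact_mod_cast Nat.pow_pos (Nat.mul_pos hQ hT)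
  set L := (2 + Real.log X) ^ 16 with hL
  have hL0 : 0 ≤ L := by positivity
  rw [show (1 + 2 : ℝ) = (3 : ℕ) by norm_num, Real.rpow_natCast] at h2
  have hy := abs_nonneg y
  have h4 : (1 + |y|) ≤ (1 + |y|) ^ 9 := le_self_pow₀ (by linarith) (by norm_num)
  calc _ ≤ _ := h3
    _ ≤ 2 * (2400000 * (1 + |y|) * (L / X)) + (2 * (14 * (1 + |y|)) ^ 8 / (X : ℝ) ^ 4)
        * (2400000 * (1 + |y|) * ((X : ℝ) ^ 3 * L)) := by gcongr
    _ = 4800000 * ((1 + |y|) + 14 ^ 8 * (1 + |y|) ^ 9) * (L / X) := by field_simp; ring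
    _ ≤ 4800000 * ((1 + |y|) ^ 9 + 14 ^ 8 * (1 + |y|) ^ 9) * (L / X) := by gcongr
    _ = 4800000 * (1 + 14 ^ 8) * (L / X) * (1 + |y|) ^ 9 := by ring
    _ ≤ 4800000 * (1 + 14 ^ 8) * (L / X) * (Real.exp 11 * Real.exp (2 * y ^ 2)) := by
      gcongr
      exact one_add_abs_pow_nine_le y
    _ = _ := by ring

theorem sum_integral_normalizedRemainder_neg_half_le {Q T : ℕ} (hQ : 1 ≤ Q) (hT : 1 ≤ T)
    (y : ℝ) :
    ∑ p ∈ primitiveCharactersBlock Q, ∫ t in (T - 1 : ℝ)..(2 * T - 1),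
        ‖normalizedRemainder p.2 ((Q * T) ^ 2) ((-1 / 2 : ℝ) + I * y + I * t)‖ ^ 2
      ≤ (Real.exp 11 * 4800000 * (1 + 14 ^ 8) * ((2 + Real.log ((Q * T) ^ 2 : ℕ)) ^ 16
        * (((Q * T) ^ 2 : ℕ) : ℝ) ^ 3)) * Real.exp (2 * y ^ 2) := by
  have hT' : (1 : ℝ) ≤ T := by exact_mod_cast hT
  have h1 := sum_integral_LFunction_sub_divisorPolynomial_le hQ hT y
  have h2 := sum_integral_divisorPolynomial_le hQ hT (σ := -1 / 2) (e := 2) (by norm_num)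
    (by norm_num) y
  have h3 := sum_integral_le_add (primitiveCharactersBlock Q)
    (by linarith : (T - 1 : ℝ) ≤ 2 * T - 1)
    (fun p _ ↦ ((continuous_normalizedRemainder_vertical p.2 ((Q * T) ^ 2) (σ := -1 / 2)
      (by norm_num) (by norm_num) y).norm.pow 2))
    (fun p _ ↦ continuous_norm_sq_LFunction_sub p.2 ((Q * T) ^ 2) y)
    (fun p _ ↦ continuous_norm_sq_divisorPolynomial p.2 ((Q * T) ^ 2) (-1 / 2) y)
    (2 * (12 * (1 + |y|)) ^ 8 * (((Q * T) ^ 2 : ℕ) : ℝ) ^ 4) 2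
    (fun p hp t ht ↦ norm_normalizedRemainder_neg_half_le (isPrimitive_of_mem_block hp).1 hQ hT
      (isPrimitive_of_mem_block hp).2.2 y ht.1 ht.2)
  set X := (Q * T) ^ 2 with hX
  have hX0 : (0 : ℝ) < X := by exact_mod_cast Nat.pow_pos (Nat.mul_pos hQ hT)
  set L := (2 + Real.log X) ^ 16 with hL
  have hL0 : 0 ≤ L := by positivity
  rw [show (1 + 2 : ℝ) = (3 : ℕ) by norm_num, Real.rpow_natCast] at h2
  have hy := abs_nonneg y
  have h4 : (1 + |y|) ≤ (1 + |y|) ^ 9 := le_self_pow₀ (by linarith) (by norm_num)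
  calc _ ≤ _ := h3
    _ ≤ (2 * (12 * (1 + |y|)) ^ 8 * (X : ℝ) ^ 4) * (2400000 * (1 + |y|) * (L / X))
        + 2 * (2400000 * (1 + |y|) * ((X : ℝ) ^ 3 * L)) := by gcongr
    _ = 4800000 * ((1 + |y|) + 12 ^ 8 * (1 + |y|) ^ 9) * (L * (X : ℝ) ^ 3) := by field_simp; ring
    _ ≤ 4800000 * ((1 + |y|) ^ 9 + 14 ^ 8 * (1 + |y|) ^ 9) * (L * (X : ℝ) ^ 3) := by
      gcongr
      norm_num
    _ = 4800000 * (1 + 14 ^ 8) * (L * (X : ℝ) ^ 3) * (1 + |y|) ^ 9 := by ring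
    _ ≤ 4800000 * (1 + 14 ^ 8) * (L * (X : ℝ) ^ 3) * (Real.exp 11 * Real.exp (2 * y ^ 2)) := by
      gcongr
      exact one_add_abs_pow_nine_le y
    _ = _ := by ring

theorem sum_integral_normalizedRemainder_le {Q T : ℕ} (hQ : 1 ≤ Q) (hT : 1 ≤ T) {σ : ℝ}
    (h1 : 1 / 2 ≤ σ) (h2 : σ ≤ 3 / 2) :
    ∑ p ∈ primitiveCharactersBlock Q, ∫ t in (T - 1 : ℝ)..(2 * T - 1),
        ‖normalizedRemainder p.2 ((Q * T) ^ 2) (σ + I * t)‖ ^ 2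
      ≤ 100 * (Real.exp 11 * 4800000 * (1 + 14 ^ 8)) * ((((Q * T) ^ 2 : ℕ) : ℝ)
        * (2 + Real.log ((Q * T) ^ 2 : ℕ)) ^ 16) := by
  have hT' : (1 : ℝ) ≤ T := by exact_mod_cast hT
  have hA := sum_integral_normalizedRemainder_neg_half_le hQ hT
  have hB := sum_integral_normalizedRemainder_three_halves_le hQ hT
  set X := (Q * T) ^ 2 with hX
  have hX1 : (1 : ℝ) ≤ X := by exact_mod_cast Nat.one_le_pow _ _ (Nat.mul_pos hQ hT)
  have hX0 : (0 : ℝ) < X := by linarith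
  have hlog := Real.log_nonneg hX1
  set L := (2 + Real.log X) ^ 16 with hL
  have hL0 : 0 < L := by positivity
  set C := Real.exp 11 * 4800000 * (1 + 14 ^ 8) with hC
  have hC0 : 0 < C := by positivity
  refine (meanSquare_three_lines (primitiveCharactersBlock Q) (fun p ↦ normalizedRemainder p.2 X)
    (fun p _ ↦ differentiableOn_normalizedRemainder _ _)
    (fun p _ ↦ hasExpGrowth_normalizedRemainder _ _)
    (by linarith) (by positivity) (by positivity) hA hB (by linarith) h2).trans ?_
  -- Exponents 3 at -1/2 and -1 at 3/2 interpolate linearly to 2 - 2σ, which is at most 1 for σ ≥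
  -- 1/2.
  have e : (C * (L * (X : ℝ) ^ 3)) ^ (1 - (σ + 1 / 2) / 2) * (C * (L / X)) ^ ((σ + 1 / 2) / 2)
      = C * L * (X : ℝ) ^ (2 - 2 * σ) := by
    have e1 : C * (L * (X : ℝ) ^ 3) = (C * L) * (X : ℝ) ^ (3 : ℝ) := by
      rw [← Real.rpow_natCast]; push_cast; ring
    have e2 : C * (L / X) = (C * L) * (X : ℝ) ^ (-1 : ℝ) := by
      rw [Real.rpow_neg_one]; ring
    have hCL : 0 < C * L := by positivity
    rw [e1, e2, Real.mul_rpow hCL.le (by positivity), Real.mul_rpow hCL.le (by positivity),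
      ← Real.rpow_mul hX0.le, ← Real.rpow_mul hX0.le, mul_mul_mul_comm, ← Real.rpow_add hCL,
      ← Real.rpow_add hX0, sub_add_cancel, Real.rpow_one]
    congr 2
    ring
  rw [e]
  calc 100 * (C * L * (X : ℝ) ^ (2 - 2 * σ)) ≤ 100 * (C * L * (X : ℝ) ^ (1 : ℝ)) := by
        gcongr
        linarith
    _ = _ := by rw [Real.rpow_one]; ring

theorem norm_LFunction_pow_eight_le {N : ℕ} [NeZero N] {χ : DirichletCharacter ℂ N}
    (hχ : χ.IsPrimitive) {Q T : ℕ} (hQ1 : 1 ≤ Q) (hT : 1 ≤ T) (hQ : Q ≤ N) {c : ℝ} (hc : 0 ≤ c)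
    (hc1 : c ≤ 1 / 100) {t : ℝ} (ht : (T : ℝ) - 1 ≤ t) :
    ‖LFunction χ ((1 / 2 + c : ℝ) + I * t)‖ ^ 8
      ≤ 36 ^ 8 * 3 * (‖normalizedRemainder χ ((Q * T) ^ 2) ((1 / 2 + c : ℝ) + I * t)‖ ^ 2
        + ‖divisorPolynomial χ ((Q * T) ^ 2) ((1 / 2 + c : ℝ) + I * t)‖ ^ 2
        + 100 ^ 8 / (((Q * T) ^ 2 : ℕ) : ℝ) ^ (4 * c)
          * ‖divisorPolynomial χ ((Q * T) ^ 2) ((1 / 2 - c : ℝ) + I * t)‖ ^ 2) := by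
  set X := (Q * T) ^ 2 with hX
  set z : ℂ := (1 / 2 + c : ℝ) + I * t with hz
  have hQ' : (1 : ℝ) ≤ Q := by exact_mod_cast hQ1
  have hT' : (1 : ℝ) ≤ T := by exact_mod_cast hT
  have hN' : (Q : ℝ) ≤ N := by exact_mod_cast hQ
  have hre : z.re = 1 / 2 + c := by simp [hz]
  have him : z.im = t := by simp [hz]
  have hs : z ∈ closedStrip := by constructor <;> rw [hre] <;> linarith
  have h0 : z ≠ 0 := by rintro h; rw [h, zero_re] at hre; linarith
  have h1 : z ≠ 1 := by rintro h; rw [h, one_re] at hre; linarith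
  have hp := norm_add_two_pos hs
  have hQT : (0 : ℝ) < Q * T := by positivity
  have e1 : 1 - z = starRingEnd ℂ ((1 / 2 - c : ℝ) + I * t) := by
    have := one_sub_vertical (1 / 2 + c) 0 t
    rw [show 1 - (1 / 2 + c) = 1 / 2 - c by ring] at this
    simpa [hz] using this
  have hR : ‖reflectionFactor χ z‖ ≤ 100 / (Q * T : ℝ) ^ c * ‖z + 2‖ ^ 2 := by
    have h3 := norm_reflectionFactor_interpolation hχ hT' (z := z) (by linarith) (by linarith)
      (by rw [him]; linarith [le_abs_self t])
    rw [hre, add_sub_cancel_left] at h3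
    rw [div_mul_eq_mul_div, le_div_iff₀ (by positivity)]
    refine le_trans ?_ h3
    gcongr
  have hD := norm_normalized_reflectionFactor_le hs hR
  -- Undoes the normalization. The distance of z from 1 must stay bounded below, and c ≤ 1/100 makes
  -- the factor 6 sufficient.
  have hlow : ‖z + 2‖ ^ 2 ≤ 36 * (‖z‖ * ‖z - 1‖) := by
    have n1 : ‖z + 2‖ ≤ 6 * ‖z‖ := by
      rw [← sq_le_sq₀ (norm_nonneg _) (by positivity), mul_pow, ← normSq_eq_norm_sq,
        ← normSq_eq_norm_sq, normSq_apply, normSq_apply]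
      simp only [add_re, add_im, re_ofNat, im_ofNat, add_zero, hre]
      nlinarith
    have n2 : ‖z + 2‖ ≤ 6 * ‖z - 1‖ := by
      rw [← sq_le_sq₀ (norm_nonneg _) (by positivity), mul_pow, ← normSq_eq_norm_sq,
        ← normSq_eq_norm_sq, normSq_apply, normSq_apply]
      simp only [add_re, add_im, re_ofNat, im_ofNat, add_zero, sub_re, sub_im, one_re, one_im,
        sub_zero, hre]
      nlinarith
    calc ‖z + 2‖ ^ 2 = ‖z + 2‖ * ‖z + 2‖ := sq _
      _ ≤ (6 * ‖z‖) * (6 * ‖z - 1‖) := by gcongr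
      _ = _ := by ring
  have e2 : (z * (z - 1)) ^ 4 * (z + 2)⁻¹ ^ 8 * LFunction χ z ^ 4
      = normalizedRemainder χ X z + ((z * (z - 1)) ^ 4 * (z + 2)⁻¹ ^ 8) * divisorPolynomial χ X z
        + (reflectionFactor χ z ^ 4 * (z + 2)⁻¹ ^ 8)
          * starRingEnd ℂ (divisorPolynomial χ X ((1 / 2 - c : ℝ) + I * t)) := by
    rw [normalizedRemainder, entireLFunction_eq χ h0 h1, e1, divisorPolynomial_inv_conj]
    ring
  set ρ := ‖(z * (z - 1)) ^ 4 * (z + 2)⁻¹ ^ 8‖ with hρ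
  have hρ1 : ρ ≤ 1 := norm_normalized_poles_le hs
  have hρ2 : 1 ≤ 36 ^ 4 * ρ := by
    rw [hρ, norm_mul, norm_pow, norm_pow, norm_inv, norm_mul, inv_pow, ← div_eq_mul_inv,
      mul_div_assoc', le_div_iff₀ (by positivity), one_mul, ← mul_pow]
    calc ‖z + 2‖ ^ 8 = (‖z + 2‖ ^ 2) ^ 4 := by ring
      _ ≤ _ := by gcongr
  set F := ‖normalizedRemainder χ X z‖
  set S := ‖divisorPolynomial χ X z‖
  set S' := ‖divisorPolynomial χ X ((1 / 2 - c : ℝ) + I * t)‖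
  have h5 : ρ * ‖LFunction χ z‖ ^ 4 ≤ F + S + (100 / (Q * T : ℝ) ^ c) ^ 4 * S' := by
    have := congrArg norm e2
    rw [norm_mul, norm_pow] at this
    rw [this]
    refine (norm_add₃_le).trans ?_
    rw [norm_mul _ (divisorPolynomial χ X z), norm_mul _ (starRingEnd ℂ _), norm_conj]
    gcongr
    exact mul_le_of_le_one_left (norm_nonneg _) hρ1
  have h6 : ‖LFunction χ z‖ ^ 4 ≤ 36 ^ 4 * (F + S + (100 / (Q * T : ℝ) ^ c) ^ 4 * S') := by
    calc ‖LFunction χ z‖ ^ 4 ≤ 36 ^ 4 * ρ * ‖LFunction χ z‖ ^ 4 :=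
          le_mul_of_one_le_left (by positivity) hρ2
      _ = 36 ^ 4 * (ρ * ‖LFunction χ z‖ ^ 4) := by ring
      _ ≤ _ := by gcongr
  have e3 : (100 : ℝ) ^ 8 / (X : ℝ) ^ (4 * c) = ((100 / (Q * T : ℝ) ^ c) ^ 4) ^ 2 := by
    rw [div_pow, div_pow, hX]
    push_cast
    rw [← Real.rpow_natCast (_ * _) 2, ← Real.rpow_mul hQT.le, ← Real.rpow_mul_natCast hQT.le,
      ← Real.rpow_mul_natCast hQT.le]
    norm_num
    ring_nf
  rw [e3]
  set R := (100 / (Q * T : ℝ) ^ c) ^ 4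
  calc ‖LFunction χ z‖ ^ 8 = (‖LFunction χ z‖ ^ 4) ^ 2 := by ring
    _ ≤ (36 ^ 4 * (F + S + R * S')) ^ 2 := by gcongr
    _ ≤ _ := by
      have e4 : 36 ^ 8 * 3 * (F ^ 2 + S ^ 2 + R ^ 2 * S' ^ 2) - (36 ^ 4 * (F + S + R * S')) ^ 2
        = 36 ^ 8 * ((F - S) ^ 2 + (F - R * S') ^ 2 + (S - R * S') ^ 2) := by ring
      rw [← sub_nonneg, e4]
      positivity

theorem sum_integral_LFunction_block_le : ∃ C : ℝ, 0 ≤ C ∧ ∀ Q T : ℕ, 1 ≤ Q → 1 ≤ T → ∀ c : ℝ,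
    0 ≤ c → c ≤ 1 / 100 →
    ∑ p ∈ primitiveCharactersBlock Q, ∫ t in (T - 1 : ℝ)..(2 * T - 1),
        ‖LFunction p.2 ((1 / 2 + c : ℝ) + I * t)‖ ^ 8
      ≤ C * ((((Q * T) ^ 2 : ℕ) : ℝ) * (2 + Real.log ((Q * T) ^ 2 : ℕ)) ^ 16) := by
  set C₁ := 100 * (Real.exp 11 * 4800000 * (1 + 14 ^ 8)) with hC₁
  refine ⟨36 ^ 8 * 3 * (C₁ + 2400000 + 100 ^ 8 * 2400000), by positivity,
    fun Q T hQ hT c hc hc1 ↦ ?_⟩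
  have hT' : (1 : ℝ) ≤ T := by exact_mod_cast hT
  have h1 := sum_integral_normalizedRemainder_le hQ hT (σ := 1 / 2 + c) (by linarith) (by linarith)
  have h2 := sum_integral_divisorPolynomial_le hQ hT (σ := 1 / 2 + c) (e := 0) le_rfl
    (by linarith) 0
  have h3 := sum_integral_divisorPolynomial_le hQ hT (σ := 1 / 2 - c) (e := 2 * c) (by linarith)
    (by linarith) 0
  simp only [ofReal_zero, mul_zero, add_zero, abs_zero, mul_one, Real.rpow_one] at h2 h3
  have c1 (p : Σ k : ℕ, DirichletCharacter ℂ (k + 1)) : Continuous fun t : ℝ ↦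
      ‖LFunction p.2 ((1 / 2 + c : ℝ) + I * t)‖ ^ 8 := by
    have := continuous_LFunction_vertical p.2 (σ := 1 / 2 + c) (by linarith) 0
    simp only [ofReal_zero, mul_zero, add_zero] at this
    fun_prop
  have c2 (p : Σ k : ℕ, DirichletCharacter ℂ (k + 1)) : Continuous fun t : ℝ ↦
      ‖normalizedRemainder p.2 ((Q * T) ^ 2) ((1 / 2 + c : ℝ) + I * t)‖ ^ 2 := by
    have := continuous_normalizedRemainder_vertical p.2 ((Q * T) ^ 2) (σ := 1 / 2 + c) (by linarith)
      (by linarith) 0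
    simp only [ofReal_zero, mul_zero, add_zero] at this
    fun_prop
  have c3 (σ : ℝ) (p : Σ k : ℕ, DirichletCharacter ℂ (k + 1)) : Continuous fun t : ℝ ↦
      ‖divisorPolynomial p.2 ((Q * T) ^ 2) (σ + I * t)‖ ^ 2 := by
    simpa using continuous_norm_sq_divisorPolynomial p.2 ((Q * T) ^ 2) σ 0
  have hle : (T - 1 : ℝ) ≤ 2 * T - 1 := by linarith
  have h4 := sum_integral_le_add (primitiveCharactersBlock Q) hle (fun p _ ↦ c1 p)
    (fun p _ ↦ (c2 p).add (c3 (1 / 2 + c) p)) (fun p _ ↦ c3 (1 / 2 - c) p)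
    (36 ^ 8 * 3) (36 ^ 8 * 3 * (100 ^ 8 / (((Q * T) ^ 2 : ℕ) : ℝ) ^ (4 * c)))
    (fun p hp t ht ↦ (norm_LFunction_pow_eight_le (isPrimitive_of_mem_block hp).1 hQ hT
      (isPrimitive_of_mem_block hp).2.1 hc hc1 ht.1).trans_eq
        (by rw [mul_add, mul_assoc (36 ^ 8 * 3)]; rfl))
  have h5 := sum_integral_le_add (primitiveCharactersBlock Q) hle
    (fun p _ ↦ (c2 p).add (c3 (1 / 2 + c) p)) (fun p _ ↦ c2 p) (fun p _ ↦ c3 (1 / 2 + c) p) 1 1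
    (fun p _ t _ ↦ by simp)
  rw [one_mul, one_mul] at h5
  set X := (Q * T) ^ 2 with hX
  have hX1 : (1 : ℝ) ≤ X := by exact_mod_cast Nat.one_le_pow _ _ (Nat.mul_pos hQ hT)
  have hX0 : (0 : ℝ) < X := by linarith
  set L := (2 + Real.log X) ^ 16 with hL
  have hL0 : 0 ≤ L := by positivity
  -- The dual polynomial at 1/2 - c has mean square up to X^(1 + 2c); the reflection factor saves
  -- X^(4c), so the net exponent is 1 - 2c.
  have h6 : (X : ℝ) ^ (1 + 2 * c) / (X : ℝ) ^ (4 * c) ≤ X := by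
    rw [← Real.rpow_sub hX0]
    calc _ ≤ (X : ℝ) ^ (1 : ℝ) := Real.rpow_le_rpow_of_exponent_le hX1 (by linarith)
      _ = _ := Real.rpow_one _
  refine h4.trans ?_
  calc _ ≤ 36 ^ 8 * 3 * (C₁ * (X * L) + 2400000 * (X * L))
        + 36 ^ 8 * 3 * (100 ^ 8 / (X : ℝ) ^ (4 * c)) * (2400000 * ((X : ℝ) ^ (1 + 2 * c) * L)) := by
        gcongr
        exact h5.trans (add_le_add h1 h2)
    _ = 36 ^ 8 * 3 * (C₁ * (X * L) + 2400000 * (X * L)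
        + 100 ^ 8 * 2400000 * ((X : ℝ) ^ (1 + 2 * c) / (X : ℝ) ^ (4 * c) * L)) := by ring
    _ ≤ 36 ^ 8 * 3 * (C₁ * (X * L) + 2400000 * (X * L) + 100 ^ 8 * 2400000 * (X * L)) := by
        gcongr
    _ = _ := by ring

end BlockBound

end Block

/-! ### Dyadic summation over primitive characters. -/

section EighthMoment

open MeasureTheory Set DirichletCharacter

section PrimitiveCharacters

theorem sum_primitiveCharactersUpTo_two_pow (g : (Σ k : ℕ, DirichletCharacter ℂ (k + 1)) → ℝ)
    (A : ℕ) :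
    ∑ p ∈ primitiveCharactersUpTo (2 ^ A - 1), g p
      = ∑ a ∈ Finset.range A, ∑ p ∈ primitiveCharactersBlock (2 ^ a), g p := by
  induction A with
  | zero => simp [primitiveCharactersUpTo, Finset.sum_sigma]
  | succ A ih =>
    rw [Finset.sum_range_succ, ← ih, primitiveCharactersUpTo, primitiveCharactersUpTo,
      primitiveCharactersBlock, Finset.sum_sigma, Finset.sum_sigma, Finset.sum_sigma, pow_succ',
      Finset.range_eq_Ico, Finset.range_eq_Ico, Finset.sum_Ico_consecutive _ (Nat.zero_le _)]
    omega

theorem sum_four_pow_le (A : ℕ) : ∑ a ∈ Finset.range A, ((2 : ℝ) ^ a) ^ 2 ≤ (2 ^ A) ^ 2 := by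
  induction A with
  | zero => simp
  | succ A ih =>
    rw [Finset.sum_range_succ, pow_succ (2 : ℝ) A]
    nlinarith [sq_nonneg ((2 : ℝ) ^ A)]

theorem continuous_norm_LFunction_pow {N : ℕ} [NeZero N] (χ : DirichletCharacter ℂ N) {σ : ℝ}
    (hσ : σ ≠ 1) (n : ℕ) : Continuous fun t : ℝ ↦ ‖LFunction χ (σ + Complex.I * t)‖ ^ n := by
  have := continuous_LFunction_vertical χ hσ 0
  simp only [Complex.ofReal_zero, mul_zero, add_zero] at this
  fun_prop

theorem two_pow_log_succ_bounds {n : ℕ} (hn : n ≠ 0) :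
    n ≤ 2 ^ (Nat.log 2 n + 1) - 1 ∧ 2 ^ (Nat.log 2 n + 1) ≤ 2 * n := by
  have h1 := Nat.lt_pow_succ_log_self (b := 2) (by norm_num) n
  have h2 := Nat.pow_log_le_self 2 hn
  rw [Nat.succ_eq_add_one] at h1
  constructor
  · omega
  · rw [pow_succ]; omega

/-- The range D of moduli is separate from the Q in the logarithm because D will be ⌊Q⌋/m, which may
be as small as 1. -/
theorem sum_integral_primitive_LFunction_le : ∃ C : ℝ, 0 ≤ C ∧ ∀ (Q T c : ℝ) (D : ℕ), 3 ≤ Q →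
    3 ≤ T → 0 ≤ c → c ≤ 1 / 100 → D ≠ 0 → (D : ℝ) ≤ Q →
    ∑ p ∈ primitiveCharactersUpTo D, ∫ t in (0 : ℝ)..T,
        ‖LFunction p.2 ((1 / 2 + c : ℝ) + Complex.I * t)‖ ^ 8
      ≤ C * ((D : ℝ) ^ 2 * T ^ 2 * Real.log (Q * T) ^ 16) := by
  obtain ⟨C, hC, h⟩ := sum_integral_LFunction_block_le
  refine ⟨C * 5 ^ 16 * 64, by positivity, fun Q T c D hQ hT hc hc1 hD hDQ ↦ ?_⟩
  set F : (Σ k : ℕ, DirichletCharacter ℂ (k + 1)) → ℝ → ℝ := fun p t ↦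
    ‖LFunction p.2 ((1 / 2 + c : ℝ) + Complex.I * t)‖ ^ 8 with hF
  have hFc (p) : Continuous (F p) := continuous_norm_LFunction_pow p.2 (by linarith) 8
  have hF0 (p t) : 0 ≤ F p t := by positivity
  set A := Nat.log 2 D + 1 with hA
  obtain ⟨hA1, hA2⟩ := two_pow_log_succ_bounds hD
  have hTc : ⌈T⌉₊ ≠ 0 := (Nat.ceil_pos.2 (by linarith)).ne'
  set B := Nat.log 2 ⌈T⌉₊ + 1 with hB
  obtain ⟨hB1, hB2⟩ := two_pow_log_succ_bounds hTc
  rw [← hA] at hA1 hA2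
  rw [← hB] at hB1 hB2
  have hA3 : (2 : ℝ) ^ A ≤ 2 * D := by exact_mod_cast hA2
  have hB3 : (2 : ℝ) ^ B ≤ 4 * T := by
    have h1 : (2 : ℝ) ^ B ≤ 2 * (⌈T⌉₊ : ℝ) := by exact_mod_cast hB2
    have := Nat.ceil_lt_add_one (by linarith : 0 ≤ T)
    linarith
  have hB4 : T ≤ (2 : ℝ) ^ B - 1 := by
    have h1 : ⌈T⌉₊ + 1 ≤ 2 ^ B := by have := Nat.one_le_two_pow (n := B); omega
    have h2 : ((⌈T⌉₊ : ℝ)) + 1 ≤ 2 ^ B := by exact_mod_cast h1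
    linarith [Nat.le_ceil T]
  have hlogQT : 2 ≤ Real.log (Q * T) := by
    rw [Real.le_log_iff_exp_le (by positivity)]
    have : Real.exp 2 = Real.exp 1 ^ 2 := by rw [← Real.exp_nat_mul]; norm_num
    rw [this]
    nlinarith [Real.exp_one_lt_d9, Real.exp_pos 1]
  -- The block parameters satisfy 2^a 2^b ≤ 8QT ≤ (QT)², since QT ≥ 9, and the leading 2 is at most
  -- log(QT).
  have hlog (a b : ℕ) (ha : a < A) (hb : b < B) :
      2 + Real.log ((2 ^ a * 2 ^ b) ^ 2 : ℕ) ≤ 5 * Real.log (Q * T) := by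
    have ha' : (2 : ℝ) ^ a ≤ 2 * D := (pow_le_pow_right₀ (by norm_num) ha.le).trans hA3
    have hb' : (2 : ℝ) ^ b ≤ 4 * T := (pow_le_pow_right₀ (by norm_num) hb.le).trans hB3
    have h1 : (2 : ℝ) ^ a * 2 ^ b ≤ (Q * T) ^ 2 := by
      calc (2 : ℝ) ^ a * 2 ^ b ≤ (2 * D) * (4 * T) := by gcongr
        _ ≤ (2 * Q) * (4 * T) := by gcongr
        _ ≤ (Q * T) ^ 2 := by nlinarith [mul_le_mul hQ hT (by norm_num) (by linarith)]
    push_cast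
    rw [Real.log_pow]
    have h2 := Real.log_le_log (by positivity) h1
    rw [Real.log_pow] at h2
    push_cast at h2 ⊢
    linarith
  calc ∑ p ∈ primitiveCharactersUpTo D, ∫ t in (0 : ℝ)..T, F p t
      ≤ ∑ p ∈ primitiveCharactersUpTo (2 ^ A - 1), ∫ t in (0 : ℝ)..(2 ^ B - 1), F p t := by
        refine (Finset.sum_le_sum fun p _ ↦ ?_).trans
          (Finset.sum_le_sum_of_subset_of_nonneg ?_ fun p _ _ ↦ ?_)
        · exact intervalIntegral.integral_mono_interval le_rfl (by linarith) hB4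
            (.of_forall fun t ↦ hF0 p t) ((hFc p).intervalIntegrable _ _)
        · exact Finset.sigma_mono (Finset.range_mono hA1) fun _ ↦ subset_rfl
        · exact intervalIntegral.integral_nonneg (by linarith) fun t _ ↦ hF0 p t
    -- The segments [2^b - 1, 2^(b + 1) - 1] are adjacent and start at 0; the shift by 1 is why
    -- blocks use T - 1 and 2T - 1.
    _ = ∑ a ∈ Finset.range A, ∑ b ∈ Finset.range B, ∑ p ∈ primitiveCharactersBlock (2 ^ a),
          ∫ t in (((2 ^ b : ℕ) : ℝ) - 1)..(2 * ((2 ^ b : ℕ) : ℝ) - 1), F p t := by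
        rw [sum_primitiveCharactersUpTo_two_pow]
        refine Finset.sum_congr rfl fun a _ ↦ ?_
        rw [Finset.sum_comm]
        refine Finset.sum_congr rfl fun p _ ↦ ?_
        have := intervalIntegral.sum_integral_adjacent_intervals (μ := volume) (f := F p)
          (a := fun b ↦ (2 : ℝ) ^ b - 1) (n := B) fun k _ ↦ (hFc p).intervalIntegrable _ _
        rw [pow_zero, sub_self] at this
        rw [← this]
        refine Finset.sum_congr rfl fun b _ ↦ ?_
        push_cast
        rw [pow_succ']
    _ ≤ ∑ a ∈ Finset.range A, ∑ b ∈ Finset.range B,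
          C * (5 * Real.log (Q * T)) ^ 16 * (((2 : ℝ) ^ a) ^ 2 * ((2 : ℝ) ^ b) ^ 2) := by
        refine Finset.sum_le_sum fun a ha ↦ Finset.sum_le_sum fun b hb ↦ ?_
        refine (h (2 ^ a) (2 ^ b) Nat.one_le_two_pow Nat.one_le_two_pow c hc hc1).trans ?_
        have h1 := hlog a b (Finset.mem_range.1 ha) (Finset.mem_range.1 hb)
        have h2 : 0 ≤ 2 + Real.log ((2 ^ a * 2 ^ b) ^ 2 : ℕ) := by
          have := Real.log_natCast_nonneg ((2 ^ a * 2 ^ b) ^ 2)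
          linarith
        calc _ ≤ C * ((((2 ^ a * 2 ^ b) ^ 2 : ℕ) : ℝ) * (5 * Real.log (Q * T)) ^ 16) := by gcongr
          _ = _ := by push_cast; ring
    _ = C * (5 * Real.log (Q * T)) ^ 16 * ((∑ a ∈ Finset.range A, ((2 : ℝ) ^ a) ^ 2)
          * ∑ b ∈ Finset.range B, ((2 : ℝ) ^ b) ^ 2) := by
        simp_rw [← Finset.mul_sum]
        rw [← Finset.sum_mul]
    _ ≤ C * (5 * Real.log (Q * T)) ^ 16 * ((2 * D) ^ 2 * (4 * T) ^ 2) := by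
        gcongr
        · exact (sum_four_pow_le A).trans (by gcongr)
        · exact (sum_four_pow_le B).trans (by gcongr)
    _ = _ := by ring

end PrimitiveCharacters

/-! ### From primitive characters to all characters. -/

section AllCharacters

theorem two_pow_card_primeFactors_le {m : ℕ} (hm : m ≠ 0) :
    2 ^ m.primeFactors.card ≤ divisorFun 2 m := by
  have h1 : divisorFun 2 m = m.divisors.card := by
    rw [divisorFun_succ, Finset.card_eq_sum_ones]
    refine Finset.sum_congr rfl fun d hd ↦ ?_
    rw [divisorFun, pow_one, ArithmeticFunction.zeta_apply_ne (Nat.pos_of_mem_divisors hd).ne']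
  rw [h1, Nat.card_divisors hm, ← Finset.prod_const]
  refine Finset.prod_le_prod' fun p hp ↦ ?_
  have := (Nat.prime_of_mem_primeFactors hp).factorization_pos_of_dvd hm
    (Nat.dvd_of_mem_primeFactors hp)
  omega

/-- At primes dividing d the factor is 1 because ψ vanishes; each remaining prime divides m and
contributes at most 2. -/
theorem norm_prod_one_sub_le {d m : ℕ} [NeZero d] (hm : m ≠ 0) (ψ : DirichletCharacter ℂ d)
    {s : ℂ} (hs : 0 ≤ s.re) :
    ‖∏ p ∈ (m * d).primeFactors, (1 - ψ p * (p : ℂ) ^ (-s))‖ ≤ divisorFun 2 m := by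
  have hd : d ≠ 0 := NeZero.ne d
  rw [Nat.primeFactors_mul hm hd, ← Finset.sdiff_union_self_eq_union, Finset.prod_union
    Finset.sdiff_disjoint, Finset.prod_eq_one (s := d.primeFactors), mul_one, norm_prod]
  · calc _ ≤ ∏ p ∈ m.primeFactors \ d.primeFactors, (2 : ℝ) := by
          refine Finset.prod_le_prod (fun _ _ ↦ norm_nonneg _) fun p hp ↦ ?_
          have hp' := Nat.prime_of_mem_primeFactors (Finset.mem_sdiff.1 hp).1
          have h1 : ‖ψ p * (p : ℂ) ^ (-s)‖ ≤ 1 := by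
            rw [norm_mul, Complex.norm_natCast_cpow_of_pos hp'.pos]
            refine mul_le_one₀ (ψ.norm_le_one _) (by positivity) ?_
            refine Real.rpow_le_one_of_one_le_of_nonpos (by exact_mod_cast hp'.one_le) (by simpa)
          refine (norm_sub_le _ _).trans ?_
          rw [norm_one]
          linarith
      _ ≤ 2 ^ m.primeFactors.card := by
          rw [Finset.prod_const]
          exact pow_le_pow_right₀ (by norm_num) (Finset.card_le_card Finset.sdiff_subset)
      _ ≤ _ := by exact_mod_cast two_pow_card_primeFactors_le hm
  · intro p hp
    have h : ¬ IsUnit ((p : ℕ) : ZMod d) := by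
      rw [ZMod.isUnit_iff_coprime, (Nat.prime_of_mem_primeFactors hp).coprime_iff_not_dvd, not_not]
      exact Nat.dvd_of_mem_primeFactors hp
    rw [MulChar.map_nonunit _ h, zero_mul, sub_zero]

theorem norm_LFunction_changeLevel_le {d m N : ℕ} [NeZero d] [NeZero N] (hN : N = m * d)
    (h : d ∣ N) (ψ : DirichletCharacter ℂ d) {s : ℂ} (hs : 0 ≤ s.re) (h1 : s ≠ 1) :
    ‖LFunction (changeLevel h ψ) s‖ ≤ divisorFun 2 m * ‖LFunction ψ s‖ := by
  have hm : m ≠ 0 := by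
    rintro rfl
    exact NeZero.ne N (by rw [hN, zero_mul])
  rw [LFunction_changeLevel h ψ (.inr h1), norm_mul, mul_comm, hN]
  gcongr
  exact norm_prod_one_sub_le hm ψ hs

theorem exists_primitive_changeLevel {M : ℕ} (x : Σ k : ℕ, DirichletCharacter ℂ (k + 1))
    (hx : x.1 < M) :
    ∃ (y : Σ _ : ℕ, Σ k : ℕ, DirichletCharacter ℂ (k + 1)),
      y ∈ (Finset.Icc 1 M).sigma (fun m ↦ primitiveCharactersUpTo (M / m)) ∧
      x.1 + 1 = y.1 * (y.2.1 + 1) ∧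
      ∃ h : y.2.1 + 1 ∣ x.1 + 1, x.2 = changeLevel h y.2.2 := by
  obtain ⟨k, χ⟩ := x
  have h : ∃ (d : ℕ) (ψ : DirichletCharacter ℂ d) (h : d ∣ k + 1), ψ.IsPrimitive ∧
      χ = changeLevel h ψ :=
    ⟨_, χ.primitiveCharacter, χ.conductor_dvd_level, χ.primitiveCharacter_isPrimitive,
      χ.changeLevel_primitiveCharacter.symm⟩
  obtain ⟨d, ψ, hd, hψ, hχ⟩ := h
  obtain ⟨k', rfl⟩ := Nat.exists_eq_succ_of_ne_zero (ne_zero_of_dvd_ne_zero k.succ_ne_zero hd)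
  obtain ⟨m, hm⟩ := hd
  refine ⟨⟨m, k', ψ⟩, ?_, by rw [hm, mul_comm], _, hχ⟩
  have hm0 : 1 ≤ m := Nat.one_le_iff_ne_zero.2 (by rintro rfl; simp at hm)
  have hmM : m * (k' + 1) ≤ M := by
    have hx' : k + 1 ≤ M := hx
    rw [hm] at hx'
    rwa [mul_comm]
  rw [Finset.mem_sigma, primitiveCharactersUpTo, Finset.mem_sigma, Finset.mem_Icc,
    Finset.mem_range, mem_primitiveCharacters]
  refine ⟨⟨hm0, (Nat.le_mul_of_pos_right m k'.succ_pos).trans hmM⟩, ?_, hψ⟩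
  rw [← Nat.succ_le_iff, Nat.le_div_iff_mul_le hm0, mul_comm]
  exact hmM

/-- d_2^8 ≤ d_256, whose Dirichlet series at 2 is ζ(2)^256 with ζ(2) ≤ 2. -/
theorem sum_divisorFun_pow_eight_div_sq_le (s : Finset ℕ) :
    ∑ m ∈ s, (divisorFun 2 m : ℝ) ^ 8 / (m : ℝ) ^ 2 ≤ 2 ^ 256 := by
  have h := (hasSum_divisorFun_div 256 (δ := 1) one_pos).summable
  calc _ ≤ ∑ m ∈ s, (divisorFun 256 m : ℝ) / (m : ℝ) ^ (1 + 1 : ℝ) := by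
        refine Finset.sum_le_sum fun m _ ↦ ?_
        rw [show (1 + 1 : ℝ) = (2 : ℕ) by norm_num, Real.rpow_natCast]
        rcases eq_or_ne m 0 with rfl | hm
        · simp
        gcongr
        exact_mod_cast divisorFun_pow_le 2 8 hm
    _ ≤ ∑' m : ℕ, (divisorFun 256 m : ℝ) / (m : ℝ) ^ (1 + 1 : ℝ) :=
        h.sum_le_tsum _ fun m _ ↦ by positivity
    _ ≤ (1 + 1 / 1) ^ 256 := tsum_divisorFun_div_le 256 one_pos
    _ = _ := by norm_num

theorem sum_le_sum_of_injOn_of_le {ι κ : Type*} {s : Finset ι} {t : Finset κ} {r : ι → κ}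
    {f : ι → ℝ} {g : κ → ℝ} (hr : ∀ x ∈ s, r x ∈ t) (hinj : Set.InjOn r s) (hg : ∀ y, 0 ≤ g y)
    (h : ∀ x ∈ s, f x ≤ g (r x)) : ∑ x ∈ s, f x ≤ ∑ y ∈ t, g y := by
  classical
  calc _ ≤ ∑ x ∈ s, g (r x) := Finset.sum_le_sum h
    _ = ∑ y ∈ s.image r, g y := (Finset.sum_image hinj).symm
    _ ≤ _ := Finset.sum_le_sum_of_subset_of_nonneg (Finset.image_subset_iff.2 hr) fun y _ _ ↦ hg y

theorem changeLevel_eq_of_sigma_eq {n : ℕ} {x y : Σ k : ℕ, DirichletCharacter ℂ (k + 1)}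
    (hxy : x = y) (hx : x.1 + 1 ∣ n) (hy : y.1 + 1 ∣ n) :
    changeLevel hx x.2 = changeLevel hy y.2 := by
  subst hxy
  rfl

theorem integral_norm_LFunction_changeLevel_le {d m N : ℕ} [NeZero d] [NeZero N] (hN : N = m * d)
    (h : d ∣ N) (ψ : DirichletCharacter ℂ d) {T σ : ℝ} (hT : 0 ≤ T) (h0 : 0 ≤ σ) (h1 : σ ≠ 1) :
    ∫ t in (0 : ℝ)..T, ‖LFunction (changeLevel h ψ) (σ + Complex.I * t)‖ ^ 8
      ≤ (divisorFun 2 m : ℝ) ^ 8 * ∫ t in (0 : ℝ)..T, ‖LFunction ψ (σ + Complex.I * t)‖ ^ 8 := by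
  rw [← intervalIntegral.integral_const_mul]
  refine intervalIntegral.integral_mono_on hT
    ((continuous_norm_LFunction_pow _ h1 8).intervalIntegrable _ _)
    (((continuous_norm_LFunction_pow _ h1 8).const_mul _).intervalIntegrable _ _) fun t _ ↦ ?_
  rw [← mul_pow]
  gcongr
  refine norm_LFunction_changeLevel_le hN h ψ (by simpa using h0) fun hs ↦ h1 ?_
  simpa using congrArg Complex.re hs

/-- Each character is sent to its cofactor m and the primitive character inducing it. The product of
m with the primitive level recovers the modulus and lifting recovers the character, so the map is
injective, and positivity allows summing over all pairs. -/
theorem sum_integral_LFunction_le_sum_primitive (M : ℕ) {T σ : ℝ} (hT : 0 ≤ T) (h0 : 0 ≤ σ)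
    (h1 : σ ≠ 1) :
    ∑ k ∈ Finset.range M, ∑ χ : DirichletCharacter ℂ (k + 1),
        ∫ t in (0 : ℝ)..T, ‖LFunction χ (σ + Complex.I * t)‖ ^ 8
      ≤ ∑ m ∈ Finset.Icc 1 M, (divisorFun 2 m : ℝ) ^ 8 *
        ∑ p ∈ primitiveCharactersUpTo (M / m),
          ∫ t in (0 : ℝ)..T, ‖LFunction p.2 (σ + Complex.I * t)‖ ^ 8 := by
  set I : (Σ k : ℕ, DirichletCharacter ℂ (k + 1)) → ℝ := fun p ↦
    ∫ t in (0 : ℝ)..T, ‖LFunction p.2 (σ + Complex.I * t)‖ ^ 8 with hI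
  have hI0 (p) : 0 ≤ I p := intervalIntegral.integral_nonneg hT fun t _ ↦ by positivity
  choose! r hr1 hr2 hr3 using fun x (hx : x.1 < M) ↦ exists_primitive_changeLevel (M := M) x hx
  set S := (Finset.range M).sigma fun k ↦ (Finset.univ : Finset (DirichletCharacter ℂ (k + 1)))
  have hS (x) (hx : x ∈ S) : x.1 < M := Finset.mem_range.1 (Finset.mem_sigma.1 hx).1
  have hinj : Set.InjOn r S := by
    rintro ⟨k, χ⟩ hx ⟨k', χ'⟩ hx' he
    have e1 := hr2 _ (hS _ hx)
    have e2 := hr2 _ (hS _ hx')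
    rw [he, ← e2] at e1
    obtain rfl : k = k' := by simpa using e1
    obtain ⟨h, e⟩ := hr3 _ (hS _ hx)
    obtain ⟨h', e'⟩ := hr3 _ (hS _ hx')
    simp only at e e' h h'
    rw [e, e', changeLevel_eq_of_sigma_eq (congrArg Sigma.snd he) h h']
  have hle (x) (hx : x ∈ S) : I x ≤ (divisorFun 2 (r x).1 : ℝ) ^ 8 * I (r x).2 := by
    have e1 := hr2 x (hS x hx)
    obtain ⟨h, e⟩ := hr3 x (hS x hx)
    have := integral_norm_LFunction_changeLevel_le e1 h (r x).2.2 hT h0 h1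
    rw [← e] at this
    exact this
  set g : (Σ _ : ℕ, Σ k : ℕ, DirichletCharacter ℂ (k + 1)) → ℝ := fun y ↦
    (divisorFun 2 y.1 : ℝ) ^ 8 * I y.2 with hg
  set U := (Finset.Icc 1 M).sigma fun m ↦ primitiveCharactersUpTo (M / m) with hU
  have h : ∑ x ∈ S, I x ≤ ∑ y ∈ U, g y := by
    refine sum_le_sum_of_injOn_of_le (r := r) ?_ hinj ?_ ?_
    · exact fun x hx ↦ hr1 x (hS x hx)
    · exact fun y ↦ mul_nonneg (by positivity) (hI0 y.2)
    · exact hle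
  have e1 : ∑ x ∈ S, I x = ∑ k ∈ Finset.range M, ∑ χ : DirichletCharacter ℂ (k + 1), I ⟨k, χ⟩ :=
    Finset.sum_sigma _ _ _
  have e2 : ∑ y ∈ U, g y = ∑ m ∈ Finset.Icc 1 M, (divisorFun 2 m : ℝ) ^ 8
      * ∑ p ∈ primitiveCharactersUpTo (M / m), I p := by
    rw [hU, Finset.sum_sigma]
    refine Finset.sum_congr rfl fun m _ ↦ ?_
    rw [Finset.mul_sum]
  rw [e1, e2] at h
  exact h

end AllCharacters

end EighthMoment

theorem proposition3p2 :
    ∃ C : ℝ, ∀ Q T c : ℝ, 3 ≤ Q → 3 ≤ T → 0 ≤ c → c ≤ 1 / 100 →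
      -- the modulus is `k + 1`, and it runs over the positive integers up to `Q`
      ∑ k ∈ Finset.range ⌊Q⌋₊, ∑ χ : DirichletCharacter ℂ (k + 1),
          ∫ t in (0 : ℝ)..T,
            ‖DirichletCharacter.LFunction χ (1 / 2 + (c : ℂ) + Complex.I * (t : ℂ))‖ ^ 8
        ≤ C * (Q ^ 2 * T ^ 2 * Real.log (Q * T) ^ 16) := by
  obtain ⟨C, hC, h⟩ := sum_integral_primitive_LFunction_le
  refine ⟨C * 2 ^ 256, fun Q T c hQ hT hc hc1 ↦ ?_⟩
  have hQ0 : 0 ≤ Q := by linarith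
  have h1 := sum_integral_LFunction_le_sum_primitive ⌊Q⌋₊ (T := T) (σ := 1 / 2 + c) (by linarith)
    (by linarith) (by linarith)
  have e : (((1 / 2 + c : ℝ)) : ℂ) = 1 / 2 + (c : ℂ) := by push_cast; rfl
  rw [← e]
  have hlog : 0 ≤ Real.log (Q * T) := Real.log_nonneg (by nlinarith)
  refine h1.trans ?_
  -- The saving m^(-2) comes from the bound being quadratic in the range of moduli; it beats the
  -- loss d_2(m)^8.
  calc _ ≤ ∑ m ∈ Finset.Icc 1 ⌊Q⌋₊, (divisorFun 2 m : ℝ) ^ 8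
        * (C * ((Q / m) ^ 2 * T ^ 2 * Real.log (Q * T) ^ 16)) := by
        refine Finset.sum_le_sum fun m hm ↦ mul_le_mul_of_nonneg_left ?_ (by positivity)
        obtain ⟨hm1, hm2⟩ := Finset.mem_Icc.1 hm
        have hm1' : (1 : ℝ) ≤ m := by exact_mod_cast hm1
        have h2 : ((⌊Q⌋₊ / m : ℕ) : ℝ) ≤ Q / m :=
          Nat.cast_div_le.trans (by gcongr; exact Nat.floor_le hQ0)
        refine (h Q T c (⌊Q⌋₊ / m) hQ hT hc hc1 (Nat.div_pos hm2 hm1).ne'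
          (h2.trans (div_le_self hQ0 hm1'))).trans ?_
        gcongr
    _ = C * (∑ m ∈ Finset.Icc 1 ⌊Q⌋₊, (divisorFun 2 m : ℝ) ^ 8 / (m : ℝ) ^ 2)
          * (Q ^ 2 * T ^ 2 * Real.log (Q * T) ^ 16) := by
        rw [Finset.mul_sum, Finset.sum_mul]
        refine Finset.sum_congr rfl fun m _ ↦ ?_
        rw [div_pow]
        ring
    _ ≤ _ := by
        gcongr
        exact sum_divisorFun_pow_eight_div_sq_le _
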